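/- **Conventions.** For $a\in\mathbb R^m$ and $r>0$, $Q^m_r(a)=\{x\in\mathbb R^m: |x_s-a_s|\le r \text{ for all } s\}$ is the closed cube of center $a$ and radius $r$, and $Q^m_r=Q^m_r(0)$. A cubication of $\mathbb R^m$ of radius $\eta>0$ is a family $\mathcal S^m$ of cubes $Q^m_\eta(a)$ whose union is $\mathbb R^m$ and such that any two cubes of the family that are not disjoint intersect in a common face (of some dimension $i\in\{0,\dots,m\}$). $\mathcal S^i$ is the set of all $i$-dimensional faces of cubes of $\mathcal S^m$. For $\ell\in\{0,\dots,m-1\}$ let $\ell^*=m-\ell-1$; the dual skeleton $\mathcal T^{\ell^*}$ of $\mathcal S^\ell$ is the set of all cubes $\sigma^{\ell^*}+x-a$ with $\sigma^{\ell^*}\in\mathcal S^{\ell^*}$, $a$ the center and $x$ a vertex of a cube of $\mathcal S^m$, and $T^{\ell^*}$ is the union of its elements. For $\Phi:\mathbb R^m\to\mathbb R^m$, $\operatorname{Supp}\Phi$ is the closure of $\{x:\Phi(x)\neq x\}$ and $\operatorname{jac}\Phi(x)=|\det D\Phi(x)|$. For a set $A\subset\mathbb R^m$, $W^{k,p}(A;\mathbb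 R^\nu)$ denotes the space of $u\in L^p$ on the interior of $A$ whose weak derivatives $D^1u,\dots,D^ku$ there exist and belong to $L^p$. **Theorem.** Let $m\ge1$. There are constants $C=C(\beta,j,m)>0$, $C'=C'(\beta,j,m)>0$ and $C''=C''(m,k,p)>0$ such that the following holds. Let $\ell\in\{0,\dots,m-1\}$, $\eta>0$, $0<\mu<\frac12$, $0<\tau<\frac12$, let $\mathcal S^m$ be a cubication of $\mathbb R^m$ of radius $\eta$ and let $\mathcal T^{\ell^*}$ be the dual skeleton of $\mathcal S^\ell$. Then there is a smooth map $\Phi:\mathbb R^m\to\mathbb R^m$ such that 1. $\Phi$ is injective; 2. $\Phi(\sigma^m)\subset\sigma^m$ for every $\sigma^m\in\mathcal S^m$; 3. $\operatorname{Supp}\Phi\subset T^{\ell^*}+Q^m_{2\mu\eta}$ and $\Phi\big(T^{\ell^*}+Q^m_{\tau\mu\eta}\big)\supset T^{\ell^*}+Q^m_{\mu\eta}$; 4. for every $0<\beta<\ell+1$, every integer $j\ge1$ and every $x\in\mathbb R^m$, $$(\mu\eta)^{j-1}|D^j\Phi(x)|\le C\,\big(\operatorname{jac}\Phi(x)\big)^{j/\beta};$$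 5. for every $0<\beta<\ell+1$, every integer $j\ge1$ and every $x\in\Phi^{-1}(T^{\ell^*}+Q^m_{\mu\eta})$, $$(\mu\eta)^{j-1}|D^j\Phi(x)|\le C'\,\tau^{j\left(\frac{\ell+1}{\beta}-1\right)}\big(\operatorname{jac}\Phi(x)\big)^{j/\beta};$$ 6. for every $\mathcal K^m\subset\mathcal S^m$ with union $K^m$, every integer $k\ge1$ and real $1\le p<\infty$ with $kp<\ell+1$, every $\nu\in\mathbb N$ and every $u\in W^{k,p}(K^m\cap(T^{\ell^*}+Q^m_{2\mu\eta});\mathbb R^\nu)$, one has $u\circ\Phi\in W^{k,p}(K^m\cap(T^{\ell^*}+Q^m_{2\mu\eta});\mathbb R^\nu)$ and, for every $j\in\{1,\dots,k\}$, $$\begin{aligned}(\mu\eta)^j\|D^j(u\circ\Phi)\|_{L^p(K^m\cap(T^{\ell^*}+Q^m_{2\mu\eta}))}&\le C''\sum_{i=1}^j(\mu\eta)^i\|D^iu\|_{L^p\left(K^m\cap(T^{\ell^*}+Q^m_{2\mu\eta})\setminus(T^{\ell^*}+Q^m_{\mu\eta})\right)}\\&\quad+C''\,\tau^{\frac{\ell+1-kp}{p}}\sum_{i=1}^j(\mu\eta)^i\|D^iu\|_{L^p\left(K^m\cap(T^{\ell^*}+Q^m_{\mu\eta})\right)}.\end{aligned}$$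 -/

import Mathlib

open Set MeasureTheory
open scoped Pointwise ContDiff ENNReal

namespace Cubication

/-- The Euclidean space `ℝ^m`. -/
abbrev Euc (m : ℕ) : Type := EuclideanSpace ℝ (Fin m)

/-- The closed cube `Q^m_r(a)` with center `a` and radius `r` (half of the side length). -/
def cube {m : ℕ} (a : Euc m) (r : ℝ) : Set (Euc m) :=
  {x | ∀ s, |x s - a s| ≤ r}

/-- `F` is an `i` dimensional face of `σ`, where `σ` is a cube of radius `r`: the coordinates in a
set `J` of cardinality `i` are free, and each of the other coordinates is fixed at one of its two
extreme values. -/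
def IsFace {m : ℕ} (r : ℝ) (i : ℕ) (F σ : Set (Euc m)) : Prop :=
  ∃ a : Euc m, σ = cube a r ∧
    ∃ (J : Finset (Fin m)) (ε : Fin m → ℝ), J.card = i ∧ (∀ s, ε s = 1 ∨ ε s = -1) ∧
      F = {x | (∀ s ∈ J, |x s - a s| ≤ r) ∧ ∀ s ∉ J, x s = a s + ε s * r}

/-- `S` is a cubication of `A` of radius `η`: a family of closed cubes of radius `η` with union
`A`, any two of which are disjoint or meet exactly in a common face. -/
def IsCubication {m : ℕ} (η : ℝ) (S : Set (Set (Euc m))) (A : Set (Euc m)) : Prop :=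
  (∀ σ ∈ S, ∃ a, σ = cube a η) ∧
  ⋃₀ S = A ∧
  ∀ σ₁ ∈ S, ∀ σ₂ ∈ S, (σ₁ ∩ σ₂).Nonempty →
    ∃ i : ℕ, IsFace η i (σ₁ ∩ σ₂) σ₁ ∧ IsFace η i (σ₁ ∩ σ₂) σ₂

/-- The skeleton of dimension `i` of a cubication `S` of radius `η`: the set of all `i` dimensional
faces of cubes in `S`. -/
def skeleton {m : ℕ} (η : ℝ) (i : ℕ) (S : Set (Set (Euc m))) : Set (Set (Euc m)) :=
  {F | ∃ σ ∈ S, IsFace η i F σ}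

/-- The dual skeleton of the `ℓ` dimensional skeleton of `S` (for `ℓ < m`): all translates
`σ' + x - a`, where `σ'` is a face of dimension `ℓ* = m - ℓ - 1` in the skeleton of `S`, and `a` is
the center and `x` a vertex of a cube of `S`. -/
def dualSkeleton {m : ℕ} (η : ℝ) (ℓ : ℕ) (S : Set (Set (Euc m))) : Set (Set (Euc m)) :=
  {F | ∃ σ' ∈ skeleton η (m - ℓ - 1) S, ∃ a x : Euc m,
    cube a η ∈ S ∧ IsFace η 0 {x} (cube a η) ∧ F = (fun y => y + (x - a)) '' σ'}

/-- The neighborhood `T + Q^m_r`, where `T` is the union of the cubes of the dual skeleton. -/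
def dualNhd {m : ℕ} (η : ℝ) (ℓ : ℕ) (S : Set (Set (Euc m))) (r : ℝ) : Set (Euc m) :=
  ⋃₀ dualSkeleton η ℓ S + cube 0 r

/-- The geometric support of a map: the closure of the set of points that it moves. -/
def geomSupport {m : ℕ} (Φ : Euc m → Euc m) : Set (Euc m) :=
  closure {x | Φ x ≠ x}

/-- The Jacobian `|det DΦ(x)|`. -/
noncomputable def jac {m : ℕ} (Φ : Euc m → Euc m) (x : Euc m) : ℝ :=
  |(fderiv ℝ Φ x).det|

/-- `g` is the weak (distributional) derivative of order `i` of `u` on the open set `Ω`. The value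
`g x` is the `i`-linear map `D^i u(x)`. -/
def IsWeakDeriv {m ν : ℕ} (Ω : Set (Euc m)) (i : ℕ) (u : Euc m → Euc ν)
    (g : Euc m → ContinuousMultilinearMap ℝ (fun _ : Fin i => Euc m) (Euc ν)) : Prop :=
  LocallyIntegrableOn u Ω volume ∧ LocallyIntegrableOn g Ω volume ∧
  ∀ φ : Euc m → ℝ, ContDiff ℝ ∞ φ → HasCompactSupport φ → tsupport φ ⊆ Ω →
    ∀ v : Fin i → Euc m,
      ∫ x in Ω, (iteratedFDeriv ℝ i φ x v) • u x = (-1 : ℝ) ^ i • ∫ x in Ω, φ x • g x v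

/-- `u ∈ W^{k,p}(Ω; ℝ^ν)` for an open set `Ω`. -/
def MemSobolev {m ν : ℕ} (Ω : Set (Euc m)) (k : ℕ) (p : ℝ≥0∞) (u : Euc m → Euc ν) : Prop :=
  MemLp u p (volume.restrict Ω) ∧
  ∀ i ∈ Finset.Icc 1 k,
    ∃ g : Euc m → ContinuousMultilinearMap ℝ (fun _ : Fin i => Euc m) (Euc ν),
      IsWeakDeriv Ω i u g ∧ MemLp g p (volume.restrict Ω)

end Cubication

open Cubication

/-!
The union of the dual skeleton consists of the points at least `ℓ + 1` of whose coordinates agree with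
those of centers of cubes. Indeed the cubes of a cubication of `ℝ^m` form a lattice
(`IsCubication.exists_lattice`), and so the neighborhood of radius `r` is the set `latticeNhd` of the
points with at least `ℓ + 1` coordinates within `r` of the lattice of centers
(`dualNhd_eq_latticeNhd`). Hence `Φ` can be built from maps that expand `ℓ + 1` of the coordinates.

In the scale `μ * η = 1`, let `J` be a set of `ℓ + 1` coordinates and let `P` be the sum of the powers
`x_s ^ (2 * q)` over `s ∈ J`. The map `Cutoff.expand` multiplies the coordinates in `J` by a factor
whose `2 * q`-th power is, with `z = P + τ ^ (2 * q)`, equal to `1 + (2 * m + 1 + slow z) / z` for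
`z ≤ 1`, and to `1` for `z ≥ 4 ^ q`. It sends a neighborhood of radius `τ` of the plane `x_J = 0` onto
a set that contains the unit neighborhood, and it is the identity from distance `2` on. With a constant
in place of `slow z`, the spheres around the plane of radii between `τ` and `1` would be sent close to a
single sphere, and the Jacobian would lose a power of `z` in the radial direction. Since `slow z` tends
to `0` with `z`, but only logarithmically, its derivative keeps these spheres so far apart that the loss
is smaller than any power of `z` (`exists_rpow_le_slow_sq`, `slow_sq_mul_profile_le`). Therefore
the derivatives of order `n` are bounded by the power `w ^ n` of a frequency `w`, of the order of the
inverse distance to the plane (`exists_norm_iteratedFDeriv_expand_le`, by the calculus of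
`SymbolBound`), and `w ^ β` is bounded by the Jacobian for every `β < ℓ + 1`
(`exists_freq_rpow_le`). Over the unit neighborhood the Jacobian gains a further power of `1 / τ`
(`exists_freq_rpow_mul_le`).

The map `Φ` is the composition, over all sets `J`, of these expansions repeated around the points of the
lattice. A factor preserves the cubes of the cubication and moves no coordinate towards the lattice, so
that the inclusions survive the composition. Frequencies and Jacobians of the factors multiply, so that
the estimates survive it as well. This gives `exists_isShrinking`.

For the Sobolev estimates, the formula of Faà di Bruno holds for weak derivatives (`IsWeakDeriv.comp`).
Tested against a smooth function, the classical formula and integration by parts give a relation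
between integrals of its derivatives with smooth weights. As it holds for every smooth function, it is
an identity between the weights, and so it also holds for weakly differentiable functions
(`integral_smul_eq_sum_of_forall_contDiff`). In the formula of order `j`, the pointwise estimates with
`β = j * p` bound the product of the derivatives of `Φ` along any partition by the power `1 / p` of the
Jacobian, with an additional power of `τ` where `Φ x` is in the inner neighborhood. The change of
variables `y = Φ x` turns this into the estimate in `L^p` (`IsShrinking.eLpNorm_weakDeriv_le`). The set
`A` may be replaced by its interior, because its boundary lies in countably many hyperplanes
(`volume_diff_interior_eq_zero`).
-/

namespace Cubication

/-! ### Uniform bounds for iterated derivatives -/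

section Symbol

variable {V F G H : Type*} [NormedAddCommGroup V] [NormedSpace ℝ V]
  [NormedAddCommGroup F] [NormedSpace ℝ F] [NormedAddCommGroup G] [NormedSpace ℝ G]
  [NormedAddCommGroup H] [NormedSpace ℝ H]

theorem norm_iteratedFDeriv_comp_le_sum {g : F → G} {f : V → F} {x : V} {n : ℕ}
    (hg : ContDiffAt ℝ ∞ g (f x)) (hf : ContDiffAt ℝ ∞ f x) :
    ‖iteratedFDeriv ℝ n (g ∘ f) x‖ ≤ ∑ c : OrderedFinpartition n,
      ‖iteratedFDeriv ℝ c.length g (f x)‖ * ∏ i, ‖iteratedFDeriv ℝ (c.partSize i) f x‖ := by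
  rw [iteratedFDeriv_comp hg hf (i := n) (mod_cast le_top)]
  refine (norm_sum_le _ _).trans (Finset.sum_le_sum fun c _ => ?_)
  exact c.norm_compAlongOrderedFinpartition_le _ _

theorem norm_iteratedFDeriv_bilinear_le_sum (B : F →L[ℝ] G →L[ℝ] H) {f : V → F} {g : V → G} {x : V}
    (hf : ContDiffAt ℝ ∞ f x) (hg : ContDiffAt ℝ ∞ g x) (n : ℕ) :
    ‖iteratedFDeriv ℝ n (fun y => B (f y) (g y)) x‖ ≤ ‖B‖ * ∑ i ∈ Finset.range (n + 1),
      (n.choose i : ℝ) * ‖iteratedFDeriv ℝ i f x‖ * ‖iteratedFDeriv ℝ (n - i) g x‖ := by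
  obtain ⟨u, hu, hfu⟩ := (hf.of_le (m := n) (mod_cast le_top)).contDiffOn le_rfl (by simp)
  obtain ⟨v, hv, hgv⟩ := (hg.of_le (m := n) (mod_cast le_top)).contDiffOn le_rfl (by simp)
  obtain ⟨w, hw, hwo, hxw⟩ := mem_nhds_iff.1 (Filter.inter_mem hu hv)
  have := B.norm_iteratedFDerivWithin_le_of_bilinear (ContDiffOn.mono hfu (hw.trans inter_subset_left))
    (ContDiffOn.mono hgv (hw.trans inter_subset_right)) hwo.uniqueDiffOn hxw le_rfl
  simpa only [iteratedFDerivWithin_of_isOpen _ hwo hxw] using this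

theorem norm_iteratedFDeriv_succ_clm_le (T : V →L[ℝ] F) (x : V) (n : ℕ) :
    ‖iteratedFDeriv ℝ (n + 1) T x‖ ≤ if n = 0 then ‖T‖ else 0 := by
  have hd : fderiv ℝ T = fun _ => T := funext fun _ => T.fderiv
  rw [← norm_iteratedFDeriv_fderiv, hd]
  rcases n with _ | n
  · simp [norm_iteratedFDeriv_zero]
  · rw [iteratedFDeriv_const_of_ne (Nat.succ_ne_zero n)]
    simp

/-- A family `f i` of maps, each considered at a base point `x i`, is a symbol of amplitude `A` and
frequency `w` if `‖D^n (f i) (x i)‖ ≤ C n * A i * w i ^ n` for every `n`, with constants `C n` that do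
not depend on the index `i`. -/
structure SymbolBound {ι : Type*} (x : ι → V) (w A : ι → ℝ) (f : ι → V → F) : Prop where
  contDiffAt : ∀ i, ContDiffAt ℝ ∞ (f i) (x i)
  bound : ∀ n : ℕ, ∃ C, 0 ≤ C ∧ ∀ i, ‖iteratedFDeriv ℝ n (f i) (x i)‖ ≤ C * A i * w i ^ n

namespace SymbolBound

variable {ι : Type*} {x : ι → V} {w A A' : ι → ℝ} {f : ι → V → F} {g : ι → V → G}

theorem mono (hf : SymbolBound x w A f) (hw : ∀ i, 0 ≤ w i) {K : ℝ} (hK : 0 ≤ K)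
    (h : ∀ i, A i ≤ K * A' i) : SymbolBound x w A' f := by
  refine ⟨hf.contDiffAt, fun n => ?_⟩
  obtain ⟨C, hC, h1⟩ := hf.bound n
  refine ⟨C * K, by positivity, fun i => (h1 i).trans ?_⟩
  have := hw i
  calc C * A i * w i ^ n ≤ C * (K * A' i) * w i ^ n := by gcongr; exact h i
    _ = _ := by ring

theorem congr (hf : SymbolBound x w A f) {f' : ι → V → F} (h : ∀ i, f i =ᶠ[nhds (x i)] f' i) :
    SymbolBound x w A f' := by
  refine ⟨fun i => (hf.contDiffAt i).congr_of_eventuallyEq (h i).symm, fun n => ?_⟩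
  obtain ⟨C, hC, h1⟩ := hf.bound n
  exact ⟨C, hC, fun i => by rw [← ((h i).iteratedFDeriv ℝ n).eq_of_nhds]; exact h1 i⟩

theorem const (hw : ∀ i, 0 ≤ w i) (c : ι → F) (hc : ∀ i, ‖c i‖ ≤ A i) :
    SymbolBound x w A (fun i _ => c i) := by
  refine ⟨fun i => contDiffAt_const, fun n => ⟨1, zero_le_one, fun i => ?_⟩⟩
  have h1 := hw i
  have h2 := (norm_nonneg _).trans (hc i)
  rcases Nat.eq_zero_or_pos n with rfl | hn
  · simpa [norm_iteratedFDeriv_zero] using hc i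
  · rw [iteratedFDeriv_const_of_ne hn.ne']
    simp only [Pi.zero_apply, norm_zero]
    positivity

theorem clm (hw : ∀ i, 0 ≤ w i) (T : ι → V →L[ℝ] F) (h0 : ∀ i, ‖T i (x i)‖ ≤ A i)
    (h1 : ∀ i, ‖T i‖ ≤ A i * w i) : SymbolBound x w A (fun i => T i) := by
  refine ⟨fun i => (T i).contDiff.contDiffAt, fun n => ⟨1, zero_le_one, fun i => ?_⟩⟩
  have hwi := hw i
  have hA := (norm_nonneg _).trans (h0 i)
  rcases n with _ | n
  · simpa [norm_iteratedFDeriv_zero] using h0 i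
  · refine (norm_iteratedFDeriv_succ_clm_le _ _ _).trans ?_
    split_ifs with hn
    · simpa [hn] using h1 i
    · positivity

theorem add {g : ι → V → F} (hf : SymbolBound x w A f) (hg : SymbolBound x w A g) :
    SymbolBound x w A (fun i y => f i y + g i y) := by
  refine ⟨fun i => (hf.contDiffAt i).add (hg.contDiffAt i), fun n => ?_⟩
  obtain ⟨C, hC, h1⟩ := hf.bound n
  obtain ⟨D, hD, h2⟩ := hg.bound n
  refine ⟨C + D, by positivity, fun i => ?_⟩
  have h3 := iteratedFDeriv_add_apply (i := n) ((hf.contDiffAt i).of_le (mod_cast le_top))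
    ((hg.contDiffAt i).of_le (mod_cast le_top))
  have h4 : (fun y => f i y + g i y) = f i + g i := rfl
  rw [h4, h3]
  refine (norm_add_le _ _).trans ((add_le_add (h1 i) (h2 i)).trans (le_of_eq (by ring)))

theorem bilinear (B : F →L[ℝ] G →L[ℝ] H) (hf : SymbolBound x w A f) (hg : SymbolBound x w A' g)
    (hw : ∀ i, 0 ≤ w i) (hA : ∀ i, 0 ≤ A i) :
    SymbolBound x w (fun i => A i * A' i) (fun i y => B (f i y) (g i y)) := by
  refine ⟨fun i => B.isBoundedBilinearMap.contDiff.contDiffAt.comp (x i)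
    ((hf.contDiffAt i).prodMk (hg.contDiffAt i)), fun n => ?_⟩
  choose C hC h1 using hf.bound
  choose D hD h2 using hg.bound
  refine ⟨‖B‖ * ∑ k ∈ Finset.range (n + 1), (n.choose k : ℝ) * C k * D (n - k),
    mul_nonneg (norm_nonneg B) (Finset.sum_nonneg fun k _ => by
      have := hC k
      have := hD (n - k)
      positivity),
    fun i => ?_⟩
  refine (norm_iteratedFDeriv_bilinear_le_sum B (hf.contDiffAt i) (hg.contDiffAt i) n).trans ?_
  have hwi := hw i
  have hAi := hA i
  rw [mul_assoc, mul_assoc]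
  refine mul_le_mul_of_nonneg_left ?_ (norm_nonneg B)
  rw [Finset.sum_mul]
  refine Finset.sum_le_sum fun k hk => ?_
  have hk' : w i ^ n = w i ^ k * w i ^ (n - k) := by
    rw [← pow_add, Nat.add_sub_cancel' (Nat.lt_succ_iff.1 (Finset.mem_range.1 hk))]
  calc (n.choose k : ℝ) * ‖iteratedFDeriv ℝ k (f i) (x i)‖ * ‖iteratedFDeriv ℝ (n - k) (g i) (x i)‖
      ≤ (n.choose k : ℝ) * (C k * A i * w i ^ k) * (D (n - k) * A' i * w i ^ (n - k)) := by
        have := hC k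
        gcongr
        · exact h1 k i
        · exact h2 (n - k) i
    _ = _ := by rw [hk']; ring

theorem mul {f g : ι → V → ℝ} (hf : SymbolBound x w A f) (hg : SymbolBound x w A' g)
    (hw : ∀ i, 0 ≤ w i) (hA : ∀ i, 0 ≤ A i) :
    SymbolBound x w (fun i => A i * A' i) (fun i y => f i y * g i y) :=
  bilinear (ContinuousLinearMap.mul ℝ ℝ) hf hg hw hA

theorem smul {f : ι → V → ℝ} (hf : SymbolBound x w A f) (hg : SymbolBound x w A' g)
    (hw : ∀ i, 0 ≤ w i) (hA : ∀ i, 0 ≤ A i) :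
    SymbolBound x w (fun i => A i * A' i) (fun i y => f i y • g i y) :=
  bilinear (ContinuousLinearMap.lsmul ℝ ℝ) hf hg hw hA

theorem pow {f : ι → V → ℝ} (hf : SymbolBound x w A f) (hw : ∀ i, 0 ≤ w i) (hA : ∀ i, 0 ≤ A i)
    (k : ℕ) : SymbolBound x w (fun i => A i ^ k) (fun i y => f i y ^ k) := by
  induction k with
  | zero => simpa using const (x := x) hw (fun _ : ι => (1 : ℝ)) (A := fun _ => 1) (by simp)
  | succ k ih => simpa only [pow_succ] using ih.mul hf hw (fun i => pow_nonneg (hA i) k)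

theorem sum {κ : Type*} (s : Finset κ) {f : κ → ι → V → F} (hw : ∀ i, 0 ≤ w i) (hA : ∀ i, 0 ≤ A i)
    (hf : ∀ k ∈ s, SymbolBound x w A (f k)) :
    SymbolBound x w A (fun i y => ∑ k ∈ s, f k i y) := by
  classical
  induction s using Finset.induction_on with
  | empty => simpa using const (x := x) hw (fun _ : ι => (0 : F)) (A := A) (by simpa using hA)
  | insert a s ha ih =>
    simp only [Finset.sum_insert ha]
    exact (hf a (by simp)).add (ih fun k hk => hf k (by simp [hk]))

/-- Composition with a function of one variable that varies, at scale `f i (x i)` near the point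
`f i (x i)`, by at most `A'`. The derivatives of the composition are at most those of `f`, relative
to the size of `f`. -/
theorem comp {f : ι → V → ℝ} {φ : ℝ → ℝ} (hf : SymbolBound x w (fun i => f i (x i)) f)
    (hpos : ∀ i, 0 < f i (x i)) (hφ : ∀ i, ContDiffAt ℝ ∞ φ (f i (x i)))
    (hb : ∀ n : ℕ, ∃ C, 0 ≤ C ∧ ∀ i, |iteratedDeriv n φ (f i (x i))| * f i (x i) ^ n ≤ C * A' i)
    (hw : ∀ i, 0 ≤ w i) : SymbolBound x w A' (fun i y => φ (f i y)) := by
  refine ⟨fun i => (hφ i).comp (x i) (hf.contDiffAt i), fun n => ?_⟩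
  choose C hC h1 using hf.bound
  choose D hD h2 using hb
  refine ⟨∑ c : OrderedFinpartition n, D c.length * ∏ k, C (c.partSize k),
    Finset.sum_nonneg fun c _ => mul_nonneg (hD _) (Finset.prod_nonneg fun k _ => hC _), fun i => ?_⟩
  refine (norm_iteratedFDeriv_comp_le_sum (g := φ) (hφ i) (hf.contDiffAt i)).trans ?_
  rw [Finset.sum_mul, Finset.sum_mul]
  refine Finset.sum_le_sum fun c _ => ?_
  rw [norm_iteratedFDeriv_eq_norm_iteratedDeriv, Real.norm_eq_abs]
  have hwi := hw i
  have hp := hpos i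
  have hn : ∏ k, w i ^ c.partSize k = w i ^ n := by
    simpa using c.prod_sigma_eq_prod (fun _ => w i)
  have hprod : ∏ k, ‖iteratedFDeriv ℝ (c.partSize k) (f i) (x i)‖
      ≤ (∏ k, C (c.partSize k)) * f i (x i) ^ c.length * w i ^ n := by
    calc _ ≤ ∏ k, (C (c.partSize k) * f i (x i) * w i ^ c.partSize k) :=
          Finset.prod_le_prod (fun _ _ => norm_nonneg _) fun k _ => h1 _ i
      _ = _ := by
          rw [Finset.prod_mul_distrib, Finset.prod_mul_distrib, hn]
          simp
  have hCp : 0 ≤ ∏ k, C (c.partSize k) := Finset.prod_nonneg fun k _ => hC _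
  calc |iteratedDeriv c.length φ (f i (x i))| * ∏ k, ‖iteratedFDeriv ℝ (c.partSize k) (f i) (x i)‖
      ≤ |iteratedDeriv c.length φ (f i (x i))| *
        ((∏ k, C (c.partSize k)) * f i (x i) ^ c.length * w i ^ n) := by gcongr
    _ = (|iteratedDeriv c.length φ (f i (x i))| * f i (x i) ^ c.length) *
        ((∏ k, C (c.partSize k)) * w i ^ n) := by ring
    _ ≤ (D c.length * A' i) * ((∏ k, C (c.partSize k)) * w i ^ n) := by
        refine mul_le_mul_of_nonneg_right (h2 _ i) (by positivity)
    _ = _ := by ring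

theorem rpow {f : ι → V → ℝ} (hf : SymbolBound x w (fun i => f i (x i)) f)
    (hpos : ∀ i, 0 < f i (x i)) (hw : ∀ i, 0 ≤ w i) (r : ℝ) :
    SymbolBound x w (fun i => f i (x i) ^ r) (fun i y => f i y ^ r) := by
  refine hf.comp (φ := fun t => t ^ r) hpos
    (fun i => Real.contDiffAt_rpow_const_of_ne (hpos i).ne') (fun n => ?_) hw
  refine ⟨|(descPochhammer ℝ n).eval r|, abs_nonneg _, fun i => le_of_eq ?_⟩
  have h := hpos i
  rw [iteratedDeriv_eq_iterate, Real.iter_deriv_rpow_const, abs_mul,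
    abs_of_nonneg (Real.rpow_nonneg h.le _), mul_assoc, ← Real.rpow_natCast, ← Real.rpow_add h]
  simp

theorem inv {f : ι → V → ℝ} (hf : SymbolBound x w (fun i => f i (x i)) f)
    (hpos : ∀ i, 0 < f i (x i)) (hw : ∀ i, 0 ≤ w i) :
    SymbolBound x w (fun i => (f i (x i))⁻¹) (fun i y => (f i y)⁻¹) := by
  simpa only [Real.rpow_neg_one] using hf.rpow hpos hw (-1)

theorem one_add_log {f : ι → V → ℝ} (hf : SymbolBound x w (fun i => f i (x i)) f)
    (h1 : ∀ i, 1 ≤ f i (x i)) (hw : ∀ i, 0 ≤ w i) :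
    SymbolBound x w (fun i => 1 + Real.log (f i (x i))) (fun i y => 1 + Real.log (f i y)) := by
  have hpos : ∀ i, 0 < f i (x i) := fun i => zero_lt_one.trans_le (h1 i)
  have hlog : ∀ i, 0 ≤ Real.log (f i (x i)) := fun i => Real.log_nonneg (h1 i)
  refine SymbolBound.add (SymbolBound.const hw _ fun i => by simpa using hlog i) ?_
  refine hf.comp hpos (fun i => Real.contDiffAt_log.2 (hpos i).ne') (fun n => ?_) hw
  rcases n with _ | n
  · exact ⟨1, zero_le_one, fun i => by simp [abs_of_nonneg (hlog i)]⟩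
  · refine ⟨n.factorial, by positivity, fun i => ?_⟩
    have h := hpos i
    rw [iteratedDeriv_succ', Real.deriv_log', iteratedDeriv_eq_iterate]
    have h2 := iter_deriv_inv n (f i (x i))
    have h3 : deriv^[n] (fun y : ℝ => y⁻¹) (f i (x i)) = _ := h2
    rw [h3, abs_mul, abs_mul, abs_pow, abs_neg, abs_one, one_pow, one_mul, Nat.abs_cast,
      abs_of_pos (zpow_pos h _), mul_assoc]
    have h4 : (f i (x i)) ^ (-1 - n : ℤ) * f i (x i) ^ (n + 1) = 1 := by
      rw [← zpow_natCast, ← zpow_add₀ h.ne']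
      push_cast
      ring_nf
      simp
    rw [h4]
    have := hlog i
    have h5 : (0 : ℝ) ≤ n.factorial := by positivity
    nlinarith

end SymbolBound

end Symbol

/-! ### The radial profile -/

/-- A cutoff `χ` in the gauge variable: it is `1` up to `1`, it vanishes from `4 ^ q` on, and `q` is so
large that its slope is small compared with `1 / (2 * m + 2)`. -/
structure Cutoff (m : ℕ) where
  q : ℕ
  χ : ℝ → ℝ
  q_pos : 0 < q
  contDiff : ContDiff ℝ ∞ χ
  nonneg : ∀ t, 0 ≤ χ t
  le_one : ∀ t, χ t ≤ 1
  eq_one : ∀ t ≤ 1, χ t = 1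
  eq_zero : ∀ t, 4 ^ q ≤ t → χ t = 0
  deriv_le : ∀ t, |deriv χ t| * (2 * m + 2) ≤ 1 / 2

theorem exists_abs_deriv_smoothTransition_le :
    ∃ K, 0 ≤ K ∧ ∀ t, |deriv Real.smoothTransition t| ≤ K := by
  have hc : Continuous (deriv Real.smoothTransition) :=
    (Real.smoothTransition.contDiff (n := 1)).continuous_deriv le_rfl
  obtain ⟨K, hK⟩ := (isCompact_Icc (a := (0 : ℝ)) (b := 1)).exists_bound_of_continuousOn hc.continuousOn
  refine ⟨max K 0, le_max_right _ _, fun t => ?_⟩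
  by_cases ht : t ∈ Icc (0 : ℝ) 1
  · exact (hK t ht).trans (le_max_left _ _)
  · have : deriv Real.smoothTransition t = 0 := by
      rw [mem_Icc, not_and_or, not_le, not_le] at ht
      rcases ht with ht | ht
      · have : Real.smoothTransition =ᶠ[nhds t] fun _ => 0 := by
          filter_upwards [Iio_mem_nhds ht] with s hs
          exact Real.smoothTransition.zero_of_nonpos (le_of_lt hs)
        rw [this.deriv_eq, deriv_const]
      · have : Real.smoothTransition =ᶠ[nhds t] fun _ => 1 := by
          filter_upwards [Ioi_mem_nhds ht] with s hs
          exact Real.smoothTransition.one_of_one_le (le_of_lt hs)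
        rw [this.deriv_eq, deriv_const]
    simp [this]

theorem nonempty_cutoff (m : ℕ) : Nonempty (Cutoff m) := by
  obtain ⟨K, hK0, hK⟩ := exists_abs_deriv_smoothTransition_le
  obtain ⟨q, hq⟩ := pow_unbounded_of_one_lt (K * (4 * m + 4) + 1) (by norm_num : (1 : ℝ) < 4)
  have hpow : (4 : ℝ) ^ q ≤ 4 ^ (q + 1) := pow_le_pow_right₀ (by norm_num) (by omega)
  have h0 : 0 ≤ K * (4 * m + 4) := by positivity
  set D : ℝ := 4 ^ (q + 1) - 1 with hD
  have hDp : 0 < D := by linarith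
  have hDK : K * (4 * m + 4) ≤ D := by linarith
  refine ⟨⟨q + 1, fun t => Real.smoothTransition ((4 ^ (q + 1) - t) / D), Nat.succ_pos _, ?_,
    fun t => Real.smoothTransition.nonneg _, fun t => Real.smoothTransition.le_one _, ?_, ?_, ?_⟩⟩
  · exact Real.smoothTransition.contDiff.comp (by fun_prop)
  · intro t ht
    refine Real.smoothTransition.one_of_one_le ?_
    rw [le_div_iff₀ hDp]
    linarith
  · intro t ht
    exact Real.smoothTransition.zero_of_nonpos (div_nonpos_of_nonpos_of_nonneg (by linarith) hDp.le)
  · intro t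
    have h1 : HasDerivAt (fun t : ℝ => (4 ^ (q + 1) - t) / D) (-1 / D) t :=
      ((hasDerivAt_id t).const_sub _).div_const D
    have h2 := ((Real.smoothTransition.contDiff (n := 1)).differentiable one_ne_zero
      ((4 ^ (q + 1) - t) / D)).hasDerivAt.comp t h1
    have h3 : deriv (fun t => Real.smoothTransition ((4 ^ (q + 1) - t) / D)) t = _ := h2.deriv
    rw [h3, abs_mul, abs_div, abs_neg, abs_one, abs_of_pos hDp]
    have := hK ((4 ^ (q + 1) - t) / D)
    calc _ ≤ K * (1 / D) * (2 * m + 2) := by gcongr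
      _ ≤ 1 / 2 := by
        rw [mul_one_div, div_mul_eq_mul_div, div_le_iff₀ hDp]
        linarith

/-- The function `1 / (1 + log (1 + 1 / z))`, which tends to `0` as `z → 0` more slowly than every
positive power of `z`. -/
noncomputable def slow (z : ℝ) : ℝ := (1 + Real.log (1 + z⁻¹))⁻¹

section

variable {z : ℝ}

theorem one_le_one_add_log (hz : 0 < z) : 1 ≤ 1 + Real.log (1 + z⁻¹) := by
  have : 0 ≤ Real.log (1 + z⁻¹) := Real.log_nonneg (by have := inv_pos.2 hz; linarith)
  linarith

theorem slow_pos (hz : 0 < z) : 0 < slow z :=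
  inv_pos.2 (zero_lt_one.trans_le (one_le_one_add_log hz))

theorem slow_le_one (hz : 0 < z) : slow z ≤ 1 := inv_le_one_of_one_le₀ (one_le_one_add_log hz)

theorem hasDerivAt_slow (hz : 0 < z) : HasDerivAt slow (slow z ^ 2 / (z * (z + 1))) z := by
  have h1 : (0 : ℝ) < 1 + z⁻¹ := by positivity
  have h2 := ((((hasDerivAt_inv hz.ne').const_add 1).log h1.ne').const_add 1).fun_inv
    (zero_lt_one.trans_le (one_le_one_add_log hz)).ne'
  refine h2.congr_deriv ?_
  unfold slow
  field_simp

/-- Every positive power of `z` is dominated by the square of `slow z`. -/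
theorem exists_rpow_le_slow_sq (R : ℝ) (hR : 0 < R) {s : ℝ} (hs : 0 < s) :
    ∃ C, 0 < C ∧ ∀ z, 0 < z → z ≤ R → z ^ s ≤ C * slow z ^ 2 := by
  refine ⟨((1 + (s / 2)⁻¹) * (R + 1) ^ (s / 2)) ^ 2, by positivity, fun z hz hzR => ?_⟩
  have hy : 1 + z⁻¹ ≤ (R + 1) / z := by
    rw [le_div_iff₀ hz]
    field_simp
    linarith
  have hy1 : 1 ≤ (R + 1) / z := by
    have := inv_pos.2 hz
    linarith
  have hl : 1 + Real.log (1 + z⁻¹) ≤ (1 + (s / 2)⁻¹) * ((R + 1) / z) ^ (s / 2) := by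
    have h1 : Real.log (1 + z⁻¹) ≤ Real.log ((R + 1) / z) := Real.log_le_log (by positivity) hy
    have h2 := Real.log_le_rpow_div (x := (R + 1) / z) (by positivity) (half_pos hs)
    have h3 : 1 ≤ ((R + 1) / z) ^ (s / 2) := Real.one_le_rpow hy1 (by positivity)
    rw [div_eq_mul_inv _ (s / 2)] at h2
    linarith
  have hzs : (z ^ (s / 2)) ^ 2 = z ^ s := by
    rw [← Real.rpow_natCast, ← Real.rpow_mul hz.le]
    norm_num
  have hpos := zero_lt_one.trans_le (one_le_one_add_log hz)
  rw [Real.div_rpow (by positivity) hz.le] at hl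
  have hzp : 0 < z ^ (s / 2) := by positivity
  rw [← hzs, ← mul_pow]
  refine pow_le_pow_left₀ hzp.le ?_ 2
  rw [slow, ← div_eq_mul_inv, le_div_iff₀ hpos]
  calc z ^ (s / 2) * (1 + Real.log (1 + z⁻¹))
      ≤ z ^ (s / 2) * ((1 + (s / 2)⁻¹) * ((R + 1) ^ (s / 2) / z ^ (s / 2))) := by gcongr
    _ = _ := by field_simp

end

namespace Cutoff

variable {m : ℕ} (p : Cutoff m) {z : ℝ}

/-- The `2 * q`-th power of the stretch factor, as a function of `z = P + ε`, where `P` is the gauge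
and `ε` the regularization parameter. -/
noncomputable def profile (z : ℝ) : ℝ := 1 + p.χ z * ((2 * m + 1 + slow z) * z⁻¹)

theorem one_le_profile (hz : 0 < z) : 1 ≤ p.profile z := by
  have := slow_pos hz
  have := p.nonneg z
  have : 0 ≤ p.χ z * ((2 * m + 1 + slow z) * z⁻¹) := by positivity
  unfold profile
  linarith

theorem inv_le_profile (hz : 0 < z) : z⁻¹ ≤ p.profile z := by
  rcases le_total z 1 with h | h
  · have hs := slow_pos hz
    have hz' := inv_pos.2 hz
    rw [profile, p.eq_one z h, one_mul]
    have hm : (0 : ℝ) ≤ m := by positivity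
    nlinarith [mul_nonneg hm hz'.le, mul_pos hs hz']
  · exact (inv_le_one_of_one_le₀ h).trans (p.one_le_profile hz)

theorem profile_le (hz : 0 < z) (hz' : z ≤ 4 ^ p.q) : p.profile z ≤ (4 ^ p.q + 2 * m + 2) * z⁻¹ := by
  have hs := slow_pos hz
  have hs1 := slow_le_one hz
  have h1 : 1 ≤ 4 ^ p.q * z⁻¹ := by
    rw [← div_eq_mul_inv, le_div_iff₀ hz]
    linarith
  have h2 : p.χ z * ((2 * m + 1 + slow z) * z⁻¹) ≤ 1 * ((2 * m + 1 + 1) * z⁻¹) := by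
    gcongr
    exact p.le_one z
  unfold profile
  linarith

theorem profile_eq_one (hz : 4 ^ p.q ≤ z) : p.profile z = 1 := by
  simp [profile, p.eq_zero z hz]

theorem hasDerivAt_profile (hz : 0 < z) : HasDerivAt p.profile
    (deriv p.χ z * ((2 * m + 1 + slow z) * z⁻¹) +
      p.χ z * (slow z ^ 2 / (z * (z + 1)) * z⁻¹ + (2 * m + 1 + slow z) * (-(z ^ 2)⁻¹))) z := by
  have h1 := (p.contDiff.differentiable (by simp) z).hasDerivAt
  exact (h1.mul (((hasDerivAt_slow hz).const_add _).mul (hasDerivAt_inv hz.ne'))).const_add 1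

/-- The derivative at `P` of `P ↦ P * profile (P + ε)`, the gauge of the stretched point as a function
of the gauge of the point. -/
noncomputable def radialDeriv (ε P : ℝ) : ℝ := p.profile (P + ε) + P * deriv p.profile (P + ε)

theorem hasDerivAt_radial {ε P : ℝ} (hε : 0 < ε) (hP : 0 ≤ P) :
    HasDerivAt (fun P => P * p.profile (P + ε)) (p.radialDeriv ε P) P := by
  have h1 := (p.hasDerivAt_profile (add_pos_of_nonneg_of_pos hP hε)).differentiableAt.hasDerivAt
  have h2 := (hasDerivAt_id P).mul (h1.comp_add_const P ε)
  exact h2.congr_deriv (by simp [radialDeriv])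

/-- The slow factor of the profile contributes the term with `slow z ^ 2`, and the regularization the
term with `ε`. The cutoff costs at most `1 / 2`. -/
theorem le_radialDeriv {ε P : ℝ} (hε : 0 < ε) (hP : 0 ≤ P) :
    1 / 2 + p.χ (P + ε) * (ε * ((P + ε) ^ 2)⁻¹ +
      P * (slow (P + ε) ^ 2 / ((P + ε) ^ 2 * (P + ε + 1)))) ≤ p.radialDeriv ε P := by
  have hz : 0 < P + ε := add_pos_of_nonneg_of_pos hP hε
  rw [radialDeriv, (p.hasDerivAt_profile hz).deriv]
  generalize hzdef : P + ε = z at *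
  have hs := slow_pos hz
  have hs1 := slow_le_one hz
  have hχ := p.nonneg z
  have hd := p.deriv_le z
  have hPz : P * z⁻¹ ≤ 1 := by
    rw [← div_eq_mul_inv, div_le_one hz]
    linarith
  have hPz0 : 0 ≤ P * z⁻¹ := by positivity
  have h1 : -(1 / 2) ≤ deriv p.χ z * ((2 * m + 1 + slow z) * (P * z⁻¹)) := by
    have : |deriv p.χ z * ((2 * m + 1 + slow z) * (P * z⁻¹))| ≤ 1 / 2 := by
      rw [abs_mul, abs_of_nonneg (by positivity : 0 ≤ (2 * m + 1 + slow z) * (P * z⁻¹))]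
      calc _ ≤ |deriv p.χ z| * ((2 * m + 1 + 1) * 1) := by gcongr
        _ ≤ 1 / 2 := by
          refine le_trans (le_of_eq ?_) hd
          ring
    exact (abs_le.1 this).1
  have h2 : p.χ z * (ε * (z ^ 2)⁻¹) ≤ p.χ z * ((2 * m + 1 + slow z) * (ε * (z ^ 2)⁻¹)) := by
    refine mul_le_mul_of_nonneg_left ?_ hχ
    refine le_mul_of_one_le_left (by positivity) ?_
    have : (0 : ℝ) ≤ m := by positivity
    linarith
  have hPe : P = z - ε := by linarith
  have h3 : p.profile z + P * (deriv p.χ z * ((2 * m + 1 + slow z) * z⁻¹) +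
      p.χ z * (slow z ^ 2 / (z * (z + 1)) * z⁻¹ + (2 * m + 1 + slow z) * (-(z ^ 2)⁻¹))) =
      1 + deriv p.χ z * ((2 * m + 1 + slow z) * (P * z⁻¹)) +
      p.χ z * ((2 * m + 1 + slow z) * (ε * (z ^ 2)⁻¹)) +
      p.χ z * (P * (slow z ^ 2 / (z ^ 2 * (z + 1)))) := by
    rw [profile, hPe]
    field_simp
    ring
  rw [h3]
  linarith

theorem radialDeriv_pos {ε P : ℝ} (hε : 0 < ε) (hP : 0 ≤ P) : 0 < p.radialDeriv ε P := by
  refine lt_of_lt_of_le ?_ (p.le_radialDeriv hε hP)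
  have hz : 0 < P + ε := add_pos_of_nonneg_of_pos hP hε
  have := p.nonneg (P + ε)
  positivity

theorem slow_sq_mul_profile_le {ε P : ℝ} (hε : 0 < ε) (hP : 0 ≤ P) (hz' : P + ε ≤ 4 ^ p.q) :
    slow (P + ε) ^ 2 * p.profile (P + ε) ≤ 2 * (4 ^ p.q + 2 * m + 2) * p.radialDeriv ε P := by
  have hz : 0 < P + ε := add_pos_of_nonneg_of_pos hP hε
  have h := p.le_radialDeriv hε hP
  have hB := p.profile_le hz hz'
  have hs := slow_pos hz
  have hs1 := slow_le_one hz
  generalize hzdef : P + ε = z at *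
  have hs2 : slow z ^ 2 ≤ 1 := pow_le_one₀ hs.le hs1
  set K : ℝ := 4 ^ p.q + 2 * m + 2
  have hK : 0 < K := by positivity
  have key : slow z ^ 2 * z⁻¹ ≤ 2 * p.radialDeriv ε P := by
    rcases le_total z 1 with h1 | h1
    · rw [p.eq_one z h1, one_mul] at h
      have e1 : slow z ^ 2 * (ε * (z ^ 2)⁻¹) ≤ ε * (z ^ 2)⁻¹ :=
        mul_le_of_le_one_left (by positivity) hs2
      have e2 : P * (slow z ^ 2 / (z ^ 2 * 2)) ≤ P * (slow z ^ 2 / (z ^ 2 * (z + 1))) := by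
        gcongr
        linarith
      have e3 : slow z ^ 2 * z⁻¹ =
          slow z ^ 2 * (ε * (z ^ 2)⁻¹) + 2 * (P * (slow z ^ 2 / (z ^ 2 * 2))) := by
        have : P = z - ε := by linarith
        rw [this]
        field_simp
        ring
      rw [e3]
      have : 0 ≤ ε * (z ^ 2)⁻¹ := by positivity
      linarith
    · have e1 : slow z ^ 2 * z⁻¹ ≤ 1 := mul_le_one₀ hs2 (by positivity) (inv_le_one_of_one_le₀ h1)
      have := p.nonneg z
      have e2 : 0 ≤ p.χ z * (ε * (z ^ 2)⁻¹ + P * (slow z ^ 2 / (z ^ 2 * (z + 1)))) := by positivity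
      linarith
  calc slow z ^ 2 * p.profile z ≤ slow z ^ 2 * (K * z⁻¹) := by gcongr
    _ = K * (slow z ^ 2 * z⁻¹) := by ring
    _ ≤ K * (2 * p.radialDeriv ε P) := by gcongr
    _ = _ := by ring

theorem profile_le_of_le {ε P : ℝ} (hε : 0 < ε) (hε' : ε ≤ 1 / 2) (hP : 0 ≤ P) (hPε : P ≤ ε) :
    p.profile (P + ε) ≤ 2 * (4 ^ p.q + 2 * m + 2) * p.radialDeriv ε P := by
  have hz : 0 < P + ε := add_pos_of_nonneg_of_pos hP hε
  have h := p.le_radialDeriv hε hP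
  have h4 : (1 : ℝ) ≤ 4 ^ p.q := one_le_pow₀ (by norm_num)
  have hB := p.profile_le hz (by linarith)
  rw [p.eq_one _ (by linarith), one_mul] at h
  have hs := slow_pos hz
  generalize hzdef : P + ε = z at *
  have e1 : z⁻¹ ≤ 2 * (ε * (z ^ 2)⁻¹) := by
    rw [pow_two, mul_inv, ← mul_assoc, ← mul_assoc]
    refine le_mul_of_one_le_left (by positivity) ?_
    rw [← div_eq_mul_inv, le_div_iff₀ hz]
    linarith
  have e2 : 0 ≤ P * (slow z ^ 2 / (z ^ 2 * (z + 1))) := by positivity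
  calc p.profile z ≤ (4 ^ p.q + 2 * m + 2) * z⁻¹ := hB
    _ ≤ (4 ^ p.q + 2 * m + 2) * (2 * p.radialDeriv ε P) := by
      gcongr
      linarith
    _ = _ := by ring

theorem strictMonoOn_radial {ε : ℝ} (hε : 0 < ε) :
    StrictMonoOn (fun P => P * p.profile (P + ε)) (Ici 0) := by
  refine strictMonoOn_of_deriv_pos (convex_Ici 0)
    (fun P hP => (p.hasDerivAt_radial hε hP).continuousAt.continuousWithinAt) fun P hP => ?_
  rw [interior_Ici] at hP
  rw [(p.hasDerivAt_radial hε (le_of_lt hP)).deriv]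
  exact p.radialDeriv_pos hε (le_of_lt hP)

/-- A point whose image lies in the unit cube has gauge less than `ε`: at `P = ε` the gauge of the image
exceeds `m`, the bound of the gauge on the unit cube. -/
theorem lt_of_radial_le {ε P : ℝ} (hε : 0 < ε) (hε' : ε ≤ 1 / 2)
    (h : P * p.profile (P + ε) ≤ m) : P < ε := by
  by_contra! hc
  have h1 := (p.strictMonoOn_radial hε).monotoneOn hε.le (hε.le.trans hc) hc
  have h2 : ε * p.profile (ε + ε) ≤ m := le_trans h1 h
  rw [profile, p.eq_one _ (by linarith), one_mul] at h2
  have hs := slow_pos (add_pos hε hε)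
  have h3 : ε * (1 + (2 * m + 1 + slow (ε + ε)) * (ε + ε)⁻¹) =
      ε + (2 * m + 1 + slow (ε + ε)) / 2 := by
    field_simp
    ring
  rw [h3] at h2
  linarith

end Cutoff

/-! ### The expansion of a set of coordinates about the origin -/

/-- The projection of `ℝ^m` that keeps the coordinates in `J` and annihilates the others. -/
noncomputable def coordProj {m : ℕ} (J : Finset (Fin m)) : Euc m →L[ℝ] Euc m :=
  LinearMap.toContinuousLinearMap
    { toFun := fun x => WithLp.toLp 2 fun s => if s ∈ J then x s else 0
      map_add' := fun x y => by ext s; by_cases h : s ∈ J <;> simp [h]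
      map_smul' := fun c x => by ext s; by_cases h : s ∈ J <;> simp [h] }

theorem coordProj_apply {m : ℕ} (J : Finset (Fin m)) (x : Euc m) (s : Fin m) :
    coordProj J x s = if s ∈ J then x s else 0 := rfl

namespace Cutoff

variable {m : ℕ} (p : Cutoff m) (J : Finset (Fin m))

/-- The `2 * q`-th power of the `ℓ^(2q)` norm of the coordinates in `J`. For large `q` its balls are
close to cubes. -/
noncomputable def gauge (x : Euc m) : ℝ := ∑ s ∈ J, x s ^ (2 * p.q)

theorem gauge_nonneg (x : Euc m) : 0 ≤ p.gauge J x :=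
  Finset.sum_nonneg fun s _ => (even_two_mul p.q).pow_nonneg (x s)

theorem two_mul_q_ne_zero : 2 * p.q ≠ 0 := by have := p.q_pos; omega

theorem pow_le_gauge {s : Fin m} (hs : s ∈ J) (x : Euc m) : x s ^ (2 * p.q) ≤ p.gauge J x :=
  Finset.single_le_sum (f := fun s => x s ^ (2 * p.q))
    (fun s _ => (even_two_mul p.q).pow_nonneg (x s)) hs

theorem abs_le_of_gauge_le {s : Fin m} (hs : s ∈ J) {x : Euc m} {r : ℝ} (hr : 0 ≤ r)
    (h : p.gauge J x ≤ r ^ (2 * p.q)) : |x s| ≤ r := by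
  refine le_of_pow_le_pow_left₀ p.two_mul_q_ne_zero hr ?_
  rw [(even_two_mul p.q).pow_abs]
  exact (p.pow_le_gauge J hs x).trans h

theorem gauge_le_card {x : Euc m} (h : ∀ s ∈ J, |x s| ≤ 1) : p.gauge J x ≤ m := by
  calc p.gauge J x ≤ ∑ s ∈ J, (1 : ℝ) := Finset.sum_le_sum fun s hs => by
        rw [← (even_two_mul p.q).pow_abs]
        exact pow_le_one₀ (abs_nonneg _) (h s hs)
    _ ≤ m := by
        simp only [Finset.sum_const, nsmul_eq_mul, mul_one, Nat.cast_le]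
        exact (Finset.card_le_univ J).trans (by simp)

theorem two_pow_two_mul_q : (2 : ℝ) ^ (2 * p.q) = 4 ^ p.q := by
  rw [pow_mul]
  norm_num

/-- The factor by which the coordinates in `J` are multiplied. -/
noncomputable def stretch (z : ℝ) : ℝ := p.profile z ^ ((2 * p.q : ℕ) : ℝ)⁻¹

theorem stretch_pow {z : ℝ} (hz : 0 < z) : p.stretch z ^ (2 * p.q) = p.profile z :=
  Real.rpow_inv_natCast_pow (zero_le_one.trans (p.one_le_profile hz)) p.two_mul_q_ne_zero

theorem one_le_stretch {z : ℝ} (hz : 0 < z) : 1 ≤ p.stretch z :=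
  Real.one_le_rpow (p.one_le_profile hz) (by positivity)

/-- The expansion of the coordinates in `J` by the factor `stretch`. It maps points at distance `τ`
from the origin in these coordinates to points at distance about `1`, and is the identity from
distance `2` on. -/
noncomputable def expand (τ : ℝ) (x : Euc m) : Euc m :=
  x + (p.stretch (p.gauge J x + τ ^ (2 * p.q)) - 1) • coordProj J x

variable {J} {τ : ℝ} {x : Euc m}

theorem expand_apply_of_mem {s : Fin m} (hs : s ∈ J) :
    p.expand J τ x s = p.stretch (p.gauge J x + τ ^ (2 * p.q)) * x s := by
  simp only [expand, PiLp.add_apply, PiLp.smul_apply, coordProj_apply, if_pos hs, smul_eq_mul]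
  ring

theorem expand_apply_of_notMem {s : Fin m} (hs : s ∉ J) : p.expand J τ x s = x s := by
  simp [expand, coordProj_apply, hs]

variable (J) in
theorem gauge_add_pos (hτ : 0 < τ) (x : Euc m) : 0 < p.gauge J x + τ ^ (2 * p.q) :=
  add_pos_of_nonneg_of_pos (p.gauge_nonneg J x) (pow_pos hτ _)

theorem tau_pow_le (hτ : 0 < τ) (hτ' : τ < 1 / 2) : τ ^ (2 * p.q) ≤ 1 / 2 :=
  (pow_le_of_le_one hτ.le (by linarith) p.two_mul_q_ne_zero).trans hτ'.le

theorem gauge_expand (hτ : 0 < τ) : p.gauge J (p.expand J τ x) =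
    p.gauge J x * p.profile (p.gauge J x + τ ^ (2 * p.q)) := by
  rw [← p.stretch_pow (p.gauge_add_pos J hτ x), gauge, gauge, Finset.sum_mul]
  refine Finset.sum_congr rfl fun s hs => ?_
  rw [p.expand_apply_of_mem hs, mul_pow, mul_comm]
  rfl

theorem expand_eq_self (h : 4 ^ p.q ≤ p.gauge J x + τ ^ (2 * p.q)) : p.expand J τ x = x := by
  simp [expand, stretch, p.profile_eq_one h]

theorem expand_eq_self_of_lt (hτ : 0 < τ) {s : Fin m} (hs : s ∈ J) (h : 2 < |x s|) :
    p.expand J τ x = x := by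
  refine p.expand_eq_self ?_
  have h1 : (2 : ℝ) ^ (2 * p.q) ≤ |x s| ^ (2 * p.q) := pow_le_pow_left₀ (by norm_num) h.le _
  rw [(even_two_mul p.q).pow_abs, p.two_pow_two_mul_q] at h1
  have := p.pow_le_gauge J hs x
  have := pow_pos hτ (2 * p.q)
  linarith

theorem abs_le_abs_expand (hτ : 0 < τ) (x : Euc m) (s : Fin m) : |x s| ≤ |p.expand J τ x s| := by
  by_cases hs : s ∈ J
  · rw [p.expand_apply_of_mem hs, abs_mul]
    refine le_mul_of_one_le_left (abs_nonneg _) ?_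
    exact (p.one_le_stretch (p.gauge_add_pos J hτ x)).trans (le_abs_self _)
  · rw [p.expand_apply_of_notMem hs]

theorem expand_eq_self_or (hτ : 0 < τ) (x : Euc m) :
    p.expand J τ x = x ∨ ∀ s ∈ J, |x s| ≤ 2 ∧ |p.expand J τ x s| ≤ 2 := by
  rcases le_total (4 ^ p.q) (p.gauge J x) with h | h
  · exact Or.inl (p.expand_eq_self (h.trans (le_add_of_nonneg_right (pow_pos hτ _).le)))
  · right
    have h1 : p.gauge J (p.expand J τ x) ≤ 4 ^ p.q := by
      have h2 := (p.strictMonoOn_radial (pow_pos hτ (2 * p.q))).monotoneOn (p.gauge_nonneg J x)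
        (by simp : (4 : ℝ) ^ p.q ∈ Ici 0) h
      rw [p.gauge_expand hτ]
      refine h2.trans ?_
      rw [p.profile_eq_one (le_add_of_nonneg_right (pow_pos hτ _).le), mul_one]
    rw [← p.two_pow_two_mul_q] at h h1
    exact fun s hs => ⟨p.abs_le_of_gauge_le J hs (by norm_num) h,
      p.abs_le_of_gauge_le J hs (by norm_num) h1⟩

/-- The preimage of the unit cube in the coordinates `J` is contained in the cube of radius `τ`. -/
theorem gauge_lt_of_abs_expand_le (hτ : 0 < τ) (hτ' : τ < 1 / 2)
    (h : ∀ s ∈ J, |p.expand J τ x s| ≤ 1) : p.gauge J x < τ ^ (2 * p.q) := by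
  refine p.lt_of_radial_le (pow_pos hτ _) (p.tau_pow_le hτ hτ') ?_
  rw [← p.gauge_expand hτ]
  exact p.gauge_le_card J h

theorem abs_le_of_abs_expand_le (hτ : 0 < τ) (hτ' : τ < 1 / 2)
    (h : ∀ s ∈ J, |p.expand J τ x s| ≤ 1) : ∀ s ∈ J, |x s| ≤ τ := fun _ hs =>
  p.abs_le_of_gauge_le J hs hτ.le (p.gauge_lt_of_abs_expand_le hτ hτ' h).le

variable (J) in
theorem injective_expand (hτ : 0 < τ) : Function.Injective (p.expand J τ) := by
  intro x y h
  have hg : p.gauge J x = p.gauge J y := by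
    refine (p.strictMonoOn_radial (pow_pos hτ (2 * p.q))).injOn (p.gauge_nonneg J x)
      (p.gauge_nonneg J y) ?_
    rw [← p.gauge_expand hτ, ← p.gauge_expand hτ, h]
  ext s
  have hs' : p.expand J τ x s = p.expand J τ y s := by rw [h]
  by_cases hs : s ∈ J
  · rw [p.expand_apply_of_mem hs, p.expand_apply_of_mem hs, hg] at hs'
    exact mul_left_cancel₀
      (zero_lt_one.trans_le (p.one_le_stretch (p.gauge_add_pos J hτ y))).ne' hs'
  · rwa [p.expand_apply_of_notMem hs, p.expand_apply_of_notMem hs] at hs'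

theorem contDiff_gauge : ContDiff ℝ ∞ (p.gauge J) := by
  unfold gauge
  fun_prop

theorem contDiffAt_profile {z : ℝ} (hz : 0 < z) : ContDiffAt ℝ ∞ p.profile z := by
  have h1 := one_le_one_add_log hz
  have h2 : (1 + z⁻¹) ≠ 0 := by positivity
  have h3 : (1 + Real.log (1 + z⁻¹)) ≠ 0 := by linarith
  have hi : ContDiffAt ℝ ∞ (fun z : ℝ => z⁻¹) z := contDiffAt_inv ℝ hz.ne'
  have h4 : ContDiffAt ℝ ∞ slow z :=
    (contDiffAt_const.add ((contDiffAt_const.add hi).log h2)).inv h3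
  exact contDiffAt_const.add (p.contDiff.contDiffAt.mul ((contDiffAt_const.add h4).mul hi))

theorem contDiffAt_stretch {z : ℝ} (hz : 0 < z) : ContDiffAt ℝ ∞ p.stretch z :=
  (p.contDiffAt_profile hz).rpow_const_of_ne (zero_lt_one.trans_le (p.one_le_profile hz)).ne'

variable (J) in
theorem contDiff_stretch_gauge (hτ : 0 < τ) :
    ContDiff ℝ ∞ fun x => p.stretch (p.gauge J x + τ ^ (2 * p.q)) :=
  contDiff_iff_contDiffAt.2 fun x => ContDiffAt.comp x (g := p.stretch)
    (p.contDiffAt_stretch (p.gauge_add_pos J hτ x))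
    (p.contDiff_gauge.add contDiff_const).contDiffAt

variable (J) in
theorem contDiff_expand (hτ : 0 < τ) : ContDiff ℝ ∞ (p.expand J τ) :=
  contDiff_id.add (((p.contDiff_stretch_gauge J hτ).sub contDiff_const).smul (coordProj J).contDiff)

variable (J) in
theorem surjective_expand (hτ : 0 < τ) : Function.Surjective (p.expand J τ) := by
  intro y
  -- the preimage is found on the segment from the projection of `y` off `J` to `y`
  let γ : ℝ → Euc m := fun t => y + (t - 1) • coordProj J y
  have hγ : ∀ t s, s ∈ J → γ t s = t * y s := fun t s hs => by
    simp only [γ, PiLp.add_apply, PiLp.smul_apply, coordProj_apply, if_pos hs, smul_eq_mul]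
    ring
  have hγ' : ∀ t s, s ∉ J → γ t s = y s := fun t s hs => by simp [γ, coordProj_apply, hs]
  have hγc : Continuous γ := by fun_prop
  have hc : Continuous fun t => t * p.stretch (p.gauge J (γ t) + τ ^ (2 * p.q)) :=
    continuous_id.mul ((p.contDiff_stretch_gauge J hτ).continuous.comp hγc)
  have h1 : (1 : ℝ) ≤ 1 * p.stretch (p.gauge J (γ 1) + τ ^ (2 * p.q)) := by
    rw [one_mul]
    exact p.one_le_stretch (p.gauge_add_pos J hτ _)
  obtain ⟨t, -, ht⟩ := intermediate_value_Icc (zero_le_one' ℝ) hc.continuousOn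
    (show (1 : ℝ) ∈ Icc _ _ from ⟨by simp, h1⟩)
  refine ⟨γ t, ?_⟩
  ext s
  by_cases hs : s ∈ J
  · rw [p.expand_apply_of_mem hs, hγ t s hs, ← mul_assoc, mul_comm _ t]
    simp only at ht
    rw [ht, one_mul]
  · rw [p.expand_apply_of_notMem hs, hγ' t s hs]

end Cutoff

/-! ### The Jacobian of the expansion -/

namespace Cutoff

variable {m : ℕ} (p : Cutoff m) {J : Finset (Fin m)} {τ : ℝ} {x : Euc m}

theorem det_id_add_smul_coordProj (J : Finset (Fin m)) (c : ℝ) :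
    LinearMap.det (LinearMap.id + (c - 1) • (coordProj J : Euc m →ₗ[ℝ] Euc m)) = c ^ J.card := by
  rw [← LinearMap.det_toMatrix (EuclideanSpace.basisFun (Fin m) ℝ).toBasis]
  have : LinearMap.toMatrix (EuclideanSpace.basisFun (Fin m) ℝ).toBasis
      (EuclideanSpace.basisFun (Fin m) ℝ).toBasis
      (LinearMap.id + (c - 1) • (coordProj J : Euc m →ₗ[ℝ] Euc m)) =
      Matrix.diagonal fun s => if s ∈ J then c else 1 := by
    ext i j
    rw [LinearMap.toMatrix_apply]
    by_cases hij : i = j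
    · subst hij
      by_cases hi : i ∈ J <;> simp [coordProj_apply, hi]
    · by_cases hi : i ∈ J <;> simp [coordProj_apply, hi, hij]
  rw [this, Matrix.det_diagonal, Finset.prod_ite]
  simp

theorem hasFDerivAt_gauge (J : Finset (Fin m)) (x : Euc m) : HasFDerivAt (p.gauge J)
    (∑ s ∈ J, ((2 * p.q : ℕ) * x s ^ (2 * p.q - 1)) •
      (EuclideanSpace.proj s : Euc m →L[ℝ] ℝ)) x := by
  unfold gauge
  refine HasFDerivAt.fun_sum fun s _ => ?_
  have h := ((EuclideanSpace.proj s : Euc m →L[ℝ] ℝ).hasFDerivAt (x := x)).pow (2 * p.q)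
  simpa using h

theorem fderiv_gauge_coordProj (J : Finset (Fin m)) (x : Euc m) :
    fderiv ℝ (p.gauge J) x (coordProj J x) = (2 * p.q : ℕ) * p.gauge J x := by
  rw [(p.hasFDerivAt_gauge J x).fderiv, gauge, Finset.mul_sum, sum_apply]
  refine Finset.sum_congr rfl fun s hs => ?_
  have h : x s ^ (2 * p.q) = x s ^ (2 * p.q - 1) * x s := by
    rw [← pow_succ, Nat.sub_add_cancel (Nat.one_le_iff_ne_zero.2 p.two_mul_q_ne_zero)]
  simp [coordProj_apply, hs, h, mul_assoc]

theorem hasDerivAt_stretch {z : ℝ} (hz : 0 < z) : HasDerivAt p.stretch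
    (((2 * p.q : ℕ) : ℝ)⁻¹ * p.stretch z * (deriv p.profile z / p.profile z)) z := by
  have hB : 0 < p.profile z := zero_lt_one.trans_le (p.one_le_profile hz)
  have h := (p.hasDerivAt_profile hz).differentiableAt.hasDerivAt.rpow_const
    (p := ((2 * p.q : ℕ) : ℝ)⁻¹) (Or.inl hB.ne')
  refine h.congr_deriv ?_
  rw [Real.rpow_sub_one hB.ne', stretch]
  ring

/-- The differential is a diagonal map followed by a rank one perturbation in the radial direction:
the stretch factor to the power `|J|`, and the logarithmic derivative of the radial function. -/
theorem det_fderiv_expand (hτ : 0 < τ) (x : Euc m) : (fderiv ℝ (p.expand J τ) x).det =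
    p.stretch (p.gauge J x + τ ^ (2 * p.q)) ^ J.card *
      (p.radialDeriv (τ ^ (2 * p.q)) (p.gauge J x) / p.profile (p.gauge J x + τ ^ (2 * p.q))) := by
  have hz := p.gauge_add_pos J hτ x
  have hg := (p.hasFDerivAt_gauge J x).differentiableAt.hasFDerivAt
  have h1 : HasFDerivAt (p.stretch ∘ fun x => p.gauge J x + τ ^ (2 * p.q)) _ x :=
    (p.hasDerivAt_stretch hz).comp_hasFDerivAt x (hg.add_const (τ ^ (2 * p.q)))
  have h2 : HasFDerivAt (p.expand J τ) _ x :=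
    (hasFDerivAt_id x).add ((h1.sub_const 1).smul (coordProj J).hasFDerivAt)
  rw [h2.fderiv]
  simp only [Function.comp_apply]
  set z := p.gauge J x + τ ^ (2 * p.q) with hzdef
  have hB : 0 < p.profile z := zero_lt_one.trans_le (p.one_le_profile hz)
  have hs : 0 < p.stretch z := zero_lt_one.trans_le (p.one_le_stretch hz)
  set c := ((2 * p.q : ℕ) : ℝ)⁻¹ * p.stretch z * (deriv p.profile z / p.profile z) with hc
  have hdec : ((ContinuousLinearMap.id ℝ (Euc m) + ((p.stretch z - 1) • coordProj J +
      (c • fderiv ℝ (p.gauge J) x).smulRight (coordProj J x)) : Euc m →L[ℝ] Euc m) :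
        Euc m →ₗ[ℝ] Euc m) =
      (LinearMap.id + (p.stretch z - 1) • (coordProj J : Euc m →ₗ[ℝ] Euc m)) ∘ₗ
        LinearMap.transvection (c • fderiv ℝ (p.gauge J) x : Euc m →L[ℝ] ℝ).toLinearMap
          ((p.stretch z)⁻¹ • coordProj J x) := by
    ext v s
    by_cases h : s ∈ J
    · simp [LinearMap.transvection.apply, coordProj_apply, h]
      field_simp
      ring
    · simp [LinearMap.transvection.apply, coordProj_apply, h]
  rw [ContinuousLinearMap.det, hdec, LinearMap.det_comp, det_id_add_smul_coordProj,
    LinearMap.transvection.det]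
  congr 1
  have h3 : (c • fderiv ℝ (p.gauge J) x : Euc m →L[ℝ] ℝ).toLinearMap
      ((p.stretch z)⁻¹ • coordProj J x) = c * (p.stretch z)⁻¹ * ((2 * p.q : ℕ) * p.gauge J x) := by
    rw [← p.fderiv_gauge_coordProj J x]
    simp
    ring
  have hq : ((2 * p.q : ℕ) : ℝ) ≠ 0 := Nat.cast_ne_zero.2 p.two_mul_q_ne_zero
  rw [h3, hc, radialDeriv, ← hzdef]
  field_simp

theorem det_fderiv_expand_pos (hτ : 0 < τ) (x : Euc m) : 0 < (fderiv ℝ (p.expand J τ) x).det := by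
  rw [p.det_fderiv_expand hτ]
  have hz := p.gauge_add_pos J hτ x
  exact mul_pos (pow_pos (zero_lt_one.trans_le (p.one_le_stretch hz)) _)
    (div_pos (p.radialDeriv_pos (pow_pos hτ _) (p.gauge_nonneg J x))
      (zero_lt_one.trans_le (p.one_le_profile hz)))

/-- A regularized distance to the plane on which the coordinates in `J` vanish. -/
noncomputable def dist (J : Finset (Fin m)) (τ : ℝ) (x : Euc m) : ℝ :=
  (p.gauge J x + τ ^ (2 * p.q)) ^ ((2 * p.q : ℕ) : ℝ)⁻¹

theorem dist_pos (hτ : 0 < τ) : 0 < p.dist J τ x := Real.rpow_pos_of_pos (p.gauge_add_pos J hτ x) _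

theorem dist_pow (hτ : 0 < τ) : p.dist J τ x ^ (2 * p.q) = p.gauge J x + τ ^ (2 * p.q) :=
  Real.rpow_inv_natCast_pow (p.gauge_add_pos J hτ x).le p.two_mul_q_ne_zero

theorem dist_le_two (hτ : 0 < τ) (h : p.gauge J x + τ ^ (2 * p.q) ≤ 4 ^ p.q) :
    p.dist J τ x ≤ 2 := by
  refine le_of_pow_le_pow_left₀ p.two_mul_q_ne_zero (by norm_num) ?_
  rwa [p.dist_pow hτ, p.two_pow_two_mul_q]

theorem abs_le_dist (hτ : 0 < τ) {s : Fin m} (hs : s ∈ J) : |x s| ≤ p.dist J τ x := by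
  refine p.abs_le_of_gauge_le J hs (p.dist_pos hτ).le ?_
  rw [p.dist_pow hτ]
  exact le_add_of_nonneg_right (pow_pos hτ _).le

theorem inv_dist_le_stretch (hτ : 0 < τ) :
    (p.dist J τ x)⁻¹ ≤ p.stretch (p.gauge J x + τ ^ (2 * p.q)) := by
  have hz := p.gauge_add_pos J hτ x
  rw [dist, ← Real.inv_rpow hz.le, stretch]
  exact Real.rpow_le_rpow (by positivity) (p.inv_le_profile hz) (by positivity)

/-- The frequency of `expand` at `x`: its derivatives of order `n` are at most of the order
of the `n`-th power of the frequency. -/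
noncomputable def freq (J : Finset (Fin m)) (τ : ℝ) (x : Euc m) : ℝ :=
  if p.gauge J x + τ ^ (2 * p.q) ≤ 4 ^ p.q then 2 * (p.dist J τ x)⁻¹ else 1

theorem one_le_freq (hτ : 0 < τ) : 1 ≤ p.freq J τ x := by
  unfold freq
  split_ifs with h
  · rw [← div_eq_mul_inv, le_div_iff₀ (p.dist_pos hτ), one_mul]
    exact p.dist_le_two hτ h
  · exact le_rfl

end Cutoff

/-! ### Estimates of the expansion in terms of its frequency -/

namespace Cutoff

variable {m : ℕ} (p : Cutoff m) {J : Finset (Fin m)} {τ : ℝ} {x : Euc m}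

/-- The parameters of `expand`, together with a point at which it is not locally the identity. -/
structure Index where
  J : Finset (Fin m)
  τ : ℝ
  x : Euc m
  τ_pos : 0 < τ
  le : p.gauge J x + τ ^ (2 * p.q) ≤ 4 ^ p.q

namespace Index

variable {p}

/-- The regularized gauge, the argument of the stretch factor. -/
noncomputable def z (i : p.Index) (y : Euc m) : ℝ := p.gauge i.J y + i.τ ^ (2 * p.q)

/-- The frequency at the point of the index. -/
noncomputable def w (i : p.Index) : ℝ := 2 * (p.dist i.J i.τ i.x)⁻¹

theorem z_pos (i : p.Index) : 0 < i.z i.x := p.gauge_add_pos i.J i.τ_pos i.x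

theorem w_nonneg (i : p.Index) : 0 ≤ i.w :=
  mul_nonneg zero_le_two (inv_nonneg.2 (p.dist_pos i.τ_pos).le)

theorem dist_mul_w (i : p.Index) : p.dist i.J i.τ i.x * i.w = 2 := by
  have := (p.dist_pos (J := i.J) (x := i.x) i.τ_pos).ne'
  unfold w
  field_simp

end Index

theorem norm_coordProj_le (J : Finset (Fin m)) : ‖coordProj J‖ ≤ 1 := by
  refine ContinuousLinearMap.opNorm_le_bound _ zero_le_one fun x => ?_
  rw [one_mul, EuclideanSpace.norm_eq, EuclideanSpace.norm_eq]
  refine Real.sqrt_le_sqrt (Finset.sum_le_sum fun s _ => ?_)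
  rw [coordProj_apply]
  split_ifs
  · exact le_rfl
  · simpa using sq_nonneg (x s)

theorem symbolBound_coord (s : Fin m) :
    SymbolBound (fun i : p.Index => i.x) Index.w (fun i => p.dist i.J i.τ i.x)
      (fun i y => if s ∈ i.J then y s else 0) := by
  have h := SymbolBound.clm (x := fun i : p.Index => i.x) (w := Index.w)
    (A := fun i => p.dist i.J i.τ i.x) Index.w_nonneg
    (fun i => (EuclideanSpace.proj s : Euc m →L[ℝ] ℝ).comp (coordProj i.J)) (fun i => ?_) fun i => ?_
  · exact h
  · have hd := (p.dist_pos (J := i.J) (x := i.x) i.τ_pos).le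
    by_cases hs : s ∈ i.J
    · simpa [coordProj_apply, hs] using p.abs_le_dist i.τ_pos hs
    · simpa [coordProj_apply, hs] using hd
  · rw [i.dist_mul_w]
    refine ContinuousLinearMap.opNorm_le_bound _ zero_le_two fun v => ?_
    have h1 : ‖coordProj i.J v s‖ ≤ ‖coordProj i.J v‖ := PiLp.norm_apply_le _ s
    have h2 := (coordProj i.J).le_of_opNorm_le (norm_coordProj_le i.J) v
    have h3 := norm_nonneg v
    change ‖coordProj i.J v s‖ ≤ _
    linarith

theorem symbolBound_z : SymbolBound (fun i : p.Index => i.x) Index.w (fun i => i.z i.x)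
    (fun i => i.z) := by
  have hd : ∀ i : p.Index, 0 ≤ p.dist i.J i.τ i.x := fun i => (p.dist_pos i.τ_pos).le
  have hA : ∀ i : p.Index, 0 ≤ i.z i.x := fun i => i.z_pos.le
  have h1 : SymbolBound (fun i : p.Index => i.x) Index.w (fun i => i.z i.x)
      (fun i y => ∑ s : Fin m, (if s ∈ i.J then y s else 0) ^ (2 * p.q)) := by
    refine SymbolBound.sum _ Index.w_nonneg hA fun s _ => ?_
    refine ((p.symbolBound_coord s).pow Index.w_nonneg hd (2 * p.q)).mono Index.w_nonneg
      zero_le_one fun i => ?_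
    rw [p.dist_pow i.τ_pos, one_mul, Index.z]
  have h2 : SymbolBound (fun i : p.Index => i.x) Index.w (fun i => i.z i.x)
      (fun i _ => i.τ ^ (2 * p.q)) := by
    refine SymbolBound.const Index.w_nonneg _ fun i => ?_
    have := pow_pos i.τ_pos (2 * p.q)
    rw [Real.norm_of_nonneg this.le]
    exact le_add_of_nonneg_left (p.gauge_nonneg _ _)
  refine (h1.add h2).congr fun i => Filter.Eventually.of_forall fun y => ?_
  simp only [Index.z, gauge]
  congr 1
  rw [← Finset.sum_filter_add_sum_filter_not Finset.univ (fun s => s ∈ i.J)]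
  have e1 : ∑ s ∈ Finset.univ.filter (fun s => s ∉ i.J),
      (if s ∈ i.J then y s else 0) ^ (2 * p.q) = 0 :=
    Finset.sum_eq_zero fun s hs => by
      rw [if_neg (Finset.mem_filter.1 hs).2, zero_pow p.two_mul_q_ne_zero]
  rw [e1, add_zero, Finset.filter_mem_eq_inter, Finset.univ_inter]
  exact Finset.sum_congr rfl fun s hs => by rw [if_pos hs]

theorem symbolBound_slow :
    SymbolBound (fun i : p.Index => i.x) Index.w (fun _ => 1) (fun i y => slow (i.z y)) := by
  have hinv := p.symbolBound_z.inv Index.z_pos Index.w_nonneg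
  have hi0 : ∀ i : p.Index, 0 < (i.z i.x)⁻¹ := fun i => inv_pos.2 i.z_pos
  have h1 : SymbolBound (fun i : p.Index => i.x) Index.w (fun i => 1 + (i.z i.x)⁻¹)
      (fun i y => 1 + (i.z y)⁻¹) := by
    refine SymbolBound.add (SymbolBound.const Index.w_nonneg _ fun i => ?_)
      (hinv.mono Index.w_nonneg zero_le_one fun i => ?_)
    · have := hi0 i
      simp only [norm_one]
      linarith
    · linarith
  have h2 := SymbolBound.one_add_log (f := fun (i : p.Index) y => 1 + (i.z y)⁻¹) h1
    (fun i => by have := hi0 i; linarith) Index.w_nonneg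
  have h3 := SymbolBound.inv (f := fun (i : p.Index) y => 1 + Real.log (1 + (i.z y)⁻¹)) h2
    (fun i => zero_lt_one.trans_le (one_le_one_add_log i.z_pos)) Index.w_nonneg
  refine h3.mono Index.w_nonneg zero_le_one fun i => ?_
  rw [one_mul]
  exact slow_le_one i.z_pos

theorem symbolBound_chi :
    SymbolBound (fun i : p.Index => i.x) Index.w (fun _ => 1) (fun i y => p.χ (i.z y)) := by
  refine p.symbolBound_z.comp Index.z_pos (fun i => p.contDiff.contDiffAt) (fun n => ?_)
    Index.w_nonneg
  have hc : Continuous fun t => |iteratedDeriv n p.χ t| * t ^ n :=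
    ((p.contDiff.continuous_iteratedDeriv n (mod_cast le_top)).abs).mul (continuous_pow n)
  obtain ⟨C, hC⟩ := (isCompact_Icc (a := (0 : ℝ)) (b := 4 ^ p.q)).exists_bound_of_continuousOn
    hc.continuousOn
  refine ⟨max C 0, le_max_right _ _, fun i => ?_⟩
  rw [mul_one]
  exact (le_abs_self _).trans ((hC _ ⟨i.z_pos.le, i.le⟩).trans (le_max_left _ _))

theorem symbolBound_stretch : SymbolBound (fun i : p.Index => i.x) Index.w
    (fun i => (p.dist i.J i.τ i.x)⁻¹) (fun i y => p.stretch (i.z y)) := by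
  have hinv := p.symbolBound_z.inv Index.z_pos Index.w_nonneg
  have hm : ∀ i : p.Index, (0 : ℝ) ≤ 1 := fun _ => zero_le_one
  have h1 : SymbolBound (fun i : p.Index => i.x) Index.w (fun _ => 1)
      (fun i y => 2 * m + 1 + slow (i.z y)) := by
    refine SymbolBound.add ?_ p.symbolBound_slow
    exact (SymbolBound.const (A := fun _ => ‖(2 * m + 1 : ℝ)‖) Index.w_nonneg _ fun _ => le_rfl).mono
      Index.w_nonneg (norm_nonneg (2 * m + 1 : ℝ)) fun i => by simp
  have h2 := p.symbolBound_chi.mul (h1.mul hinv Index.w_nonneg hm) Index.w_nonneg hm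
  have h3 : SymbolBound (fun i : p.Index => i.x) Index.w (fun i => p.profile (i.z i.x))
      (fun i y => p.profile (i.z y)) := by
    refine SymbolBound.add (SymbolBound.const Index.w_nonneg _ fun i => ?_)
      (h2.mono Index.w_nonneg zero_le_one fun i => ?_)
    · simpa using p.one_le_profile i.z_pos
    · simpa using p.inv_le_profile i.z_pos
  refine (SymbolBound.rpow (f := fun (i : p.Index) y => p.profile (i.z y)) h3
    (fun i => zero_lt_one.trans_le (p.one_le_profile i.z_pos)) Index.w_nonneg
    ((2 * p.q : ℕ) : ℝ)⁻¹).mono Index.w_nonneg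
    (K := (4 ^ p.q + 2 * m + 2) ^ ((2 * p.q : ℕ) : ℝ)⁻¹) (by positivity) fun i => ?_
  have hz := i.z_pos
  have h4 := p.profile_le i.z_pos i.le
  have h5 : (p.dist i.J i.τ i.x)⁻¹ = (i.z i.x)⁻¹ ^ ((2 * p.q : ℕ) : ℝ)⁻¹ :=
    (Real.inv_rpow hz.le _).symm
  rw [h5, ← Real.mul_rpow (by positivity) (by positivity)]
  exact Real.rpow_le_rpow (zero_le_one.trans (p.one_le_profile hz)) h4 (by positivity)

/-- The derivatives of `expand` are controlled by powers of its frequency, uniformly in `τ`. -/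
theorem exists_norm_iteratedFDeriv_expand_le (n : ℕ) (hn : 1 ≤ n) : ∃ C, 0 ≤ C ∧
    ∀ (J : Finset (Fin m)) (τ : ℝ) (x : Euc m), 0 < τ →
      ‖iteratedFDeriv ℝ n (p.expand J τ) x‖ ≤ C * p.freq J τ x ^ n := by
  obtain ⟨n, rfl⟩ : ∃ k, n = k + 1 := ⟨n - 1, by omega⟩
  have hproj : SymbolBound (fun i : p.Index => i.x) Index.w (fun i => p.dist i.J i.τ i.x)
      (fun i y => coordProj i.J y) := by
    refine (SymbolBound.clm (A := fun i : p.Index => (m + 1 : ℝ) * p.dist i.J i.τ i.x)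
      Index.w_nonneg (fun i => coordProj i.J) (fun i => ?_) fun i => ?_).mono Index.w_nonneg
      (K := m + 1) (by positivity) fun i => le_rfl
    · have hd := (p.dist_pos (J := i.J) (x := i.x) i.τ_pos).le
      rw [EuclideanSpace.norm_eq]
      refine Real.sqrt_le_iff.2 ⟨by positivity, ?_⟩
      calc ∑ s, ‖coordProj i.J i.x s‖ ^ 2 ≤ ∑ s : Fin m, p.dist i.J i.τ i.x ^ 2 := by
            refine Finset.sum_le_sum fun s _ => pow_le_pow_left₀ (norm_nonneg _) ?_ 2
            rw [coordProj_apply]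
            split_ifs with hs
            · exact p.abs_le_dist i.τ_pos hs
            · simpa using hd
        _ = m * p.dist i.J i.τ i.x ^ 2 := by simp
        _ ≤ ((m + 1 : ℝ) * p.dist i.J i.τ i.x) ^ 2 := by
            rw [mul_pow]
            have : (m : ℝ) ≤ (m + 1 : ℝ) ^ 2 := by
              have : (0 : ℝ) ≤ m := by positivity
              nlinarith
            gcongr
    · have h0 : (0 : ℝ) ≤ m := by positivity
      have := norm_coordProj_le i.J
      rw [mul_assoc, i.dist_mul_w]
      linarith
  have hmul := p.symbolBound_stretch.smul hproj Index.w_nonneg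
    fun i => inv_nonneg.2 (p.dist_pos i.τ_pos).le
  obtain ⟨C, hC, h1⟩ := hmul.bound (n + 1)
  refine ⟨C + 2, by positivity, fun J τ x hτ => ?_⟩
  have hid : ∀ T : Euc m →L[ℝ] Euc m, ‖T‖ ≤ 2 → ‖iteratedFDeriv ℝ (n + 1) T x‖ ≤ 2 := by
    intro T hT
    refine (norm_iteratedFDeriv_succ_clm_le T x n).trans ?_
    split_ifs
    exacts [hT, zero_le_two]
  have hf1 : 1 ≤ p.freq J τ x ^ (n + 1) := one_le_pow₀ (p.one_le_freq hτ)
  by_cases hx : p.gauge J x + τ ^ (2 * p.q) ≤ 4 ^ p.q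
  · let i : p.Index := ⟨J, τ, x, hτ, hx⟩
    have hw : p.freq J τ x = i.w := by rw [freq, if_pos hx]; rfl
    have hdec : p.expand J τ = (ContinuousLinearMap.id ℝ (Euc m) - coordProj J : Euc m →L[ℝ] Euc m) +
        fun y => p.stretch (i.z y) • coordProj J y := by
      funext y
      change y + (p.stretch (p.gauge J y + τ ^ (2 * p.q)) - 1) • coordProj J y = _
      simp only [Pi.add_apply, Index.z, i]
      simp only [sub_smul, one_smul, sub_apply, ContinuousLinearMap.id_apply]
      abel
    have h2 := h1 i
    have hd := (p.dist_pos (J := J) (x := x) hτ).ne'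
    rw [inv_mul_cancel₀ hd, mul_one] at h2
    rw [hdec, iteratedFDeriv_add_apply (ContinuousLinearMap.contDiff _).contDiffAt
      ((hmul.contDiffAt i).of_le (mod_cast le_top))]
    have h3 : ‖(ContinuousLinearMap.id ℝ (Euc m) - coordProj J : Euc m →L[ℝ] Euc m)‖ ≤ 2 := by
      have := norm_sub_le (ContinuousLinearMap.id ℝ (Euc m)) (coordProj J)
      have := norm_coordProj_le J
      have := ContinuousLinearMap.norm_id_le (𝕜 := ℝ) (E := Euc m)
      linarith
    refine (norm_add_le _ _).trans ?_
    have h4 := hid _ h3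
    rw [hw] at hf1 ⊢
    nlinarith
  · have heq : p.expand J τ =ᶠ[nhds x] ContinuousLinearMap.id ℝ (Euc m) := by
      have hc : Continuous fun y => p.gauge J y + τ ^ (2 * p.q) :=
        p.contDiff_gauge.continuous.add continuous_const
      filter_upwards [hc.continuousAt.eventually (lt_mem_nhds (not_le.1 hx))] with y hy
      exact p.expand_eq_self hy.le
    rw [(heq.iteratedFDeriv ℝ (n + 1)).eq_of_nhds]
    have h4 := hid _ ((ContinuousLinearMap.norm_id_le (𝕜 := ℝ) (E := Euc m)).trans one_le_two)
    nlinarith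

/-- The Jacobian of `expand` dominates every power of the frequency of exponent less than the number
of expanded coordinates. -/
theorem exists_freq_rpow_le {β : ℝ} {d : ℕ} (hβd : β < d) : ∃ C, 1 ≤ C ∧
    ∀ (J : Finset (Fin m)) (τ : ℝ) (x : Euc m), J.card = d → 0 < τ →
      p.freq J τ x ^ β ≤ C * jac (p.expand J τ) x := by
  set q' : ℝ := ((2 * p.q : ℕ) : ℝ)⁻¹ with hq'
  have hq'p : 0 < q' := inv_pos.2 (Nat.cast_pos.2 (Nat.pos_of_ne_zero p.two_mul_q_ne_zero))
  obtain ⟨C, hC, hCs⟩ := exists_rpow_le_slow_sq (4 ^ p.q) (by positivity)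
    (s := q' * (d - β)) (mul_pos hq'p (by linarith))
  set K : ℝ := 2 * (4 ^ p.q + 2 * m + 2) with hK
  have hKp : 0 < K := by positivity
  refine ⟨max 1 (2 ^ β * C * K), le_max_left _ _, fun J τ x hJ hτ => ?_⟩
  have hdet := p.det_fderiv_expand hτ (J := J) x
  have hz := p.gauge_add_pos J hτ x
  rw [jac, abs_of_pos (p.det_fderiv_expand_pos hτ x)]
  by_cases hx : p.gauge J x + τ ^ (2 * p.q) ≤ 4 ^ p.q
  · have hB := zero_lt_one.trans_le (p.one_le_profile hz)
    have hrd := p.slow_sq_mul_profile_le (pow_pos hτ (2 * p.q)) (p.gauge_nonneg J x) hx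
    have hD := p.dist_pos (J := J) (x := x) hτ
    have h1 : slow (p.gauge J x + τ ^ (2 * p.q)) ^ 2 ≤
        K * (p.radialDeriv (τ ^ (2 * p.q)) (p.gauge J x) /
          p.profile (p.gauge J x + τ ^ (2 * p.q))) := by
      rw [← mul_div_assoc, le_div_iff₀ hB]
      exact hrd
    have h2 := pow_le_pow_left₀ (inv_pos.2 hD).le (p.inv_dist_le_stretch (J := J) (x := x) hτ) d
    have h3 : (p.dist J τ x) ^ ((d : ℝ) - β) ≤ C * slow (p.gauge J x + τ ^ (2 * p.q)) ^ 2 := by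
      rw [dist, ← Real.rpow_mul hz.le]
      exact hCs _ hz hx
    have h4 : (p.dist J τ x)⁻¹ ^ β = (p.dist J τ x)⁻¹ ^ d * p.dist J τ x ^ ((d : ℝ) - β) := by
      rw [← Real.rpow_natCast, Real.inv_rpow hD.le, Real.inv_rpow hD.le, ← Real.rpow_neg hD.le,
        ← Real.rpow_neg hD.le, ← Real.rpow_add hD]
      ring_nf
    rw [freq, if_pos hx, Real.mul_rpow zero_le_two (inv_pos.2 hD).le, h4, hdet, hJ]
    have hst := pow_pos (zero_lt_one.trans_le (p.one_le_stretch hz)) d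
    have hdp : 0 < (p.dist J τ x)⁻¹ ^ d := by positivity
    calc (2 : ℝ) ^ β * ((p.dist J τ x)⁻¹ ^ d * p.dist J τ x ^ ((d : ℝ) - β))
        ≤ 2 ^ β * (p.stretch (p.gauge J x + τ ^ (2 * p.q)) ^ d *
          (C * (K * (p.radialDeriv (τ ^ (2 * p.q)) (p.gauge J x) /
          p.profile (p.gauge J x + τ ^ (2 * p.q)))))) := by
          gcongr
          exact h3.trans (by gcongr)
      _ = (2 ^ β * C * K) * (p.stretch (p.gauge J x + τ ^ (2 * p.q)) ^ d *
          (p.radialDeriv (τ ^ (2 * p.q)) (p.gauge J x) /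
          p.profile (p.gauge J x + τ ^ (2 * p.q)))) := by ring
      _ ≤ _ := by
          have := p.radialDeriv_pos (pow_pos hτ (2 * p.q)) (p.gauge_nonneg J x)
          gcongr
          exact le_max_right _ _
  · have heq : p.expand J τ =ᶠ[nhds x] id := by
      have hc : Continuous fun y => p.gauge J y + τ ^ (2 * p.q) :=
        p.contDiff_gauge.continuous.add continuous_const
      filter_upwards [hc.continuousAt.eventually (lt_mem_nhds (not_le.1 hx))] with y hy
      exact p.expand_eq_self hy.le
    rw [freq, if_neg hx, Real.one_rpow, heq.fderiv_eq, fderiv_id]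
    simp [ContinuousLinearMap.det]

/-- Over the unit cube the frequency is of the order of `1 / τ`, and the Jacobian of `expand` dominates
the full power of exponent `d`. This leaves the additional power of `1 / τ`. -/
theorem exists_freq_rpow_mul_le {β : ℝ} {d : ℕ} (hβd : β < d) : ∃ C, 1 ≤ C ∧
    ∀ (J : Finset (Fin m)) (τ : ℝ) (x : Euc m), J.card = d → 0 < τ → τ < 1 / 2 →
      (∀ s ∈ J, |p.expand J τ x s| ≤ 1) →
      p.freq J τ x ^ β * τ ^ (-((d : ℝ) - β)) ≤ C * jac (p.expand J τ) x := by
  set q' : ℝ := ((2 * p.q : ℕ) : ℝ)⁻¹ with hq'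
  set K : ℝ := 2 * (4 ^ p.q + 2 * m + 2) with hK
  have hKp : 0 < K := by positivity
  refine ⟨max 1 (2 ^ β * 2 ^ ((d : ℝ) - β) * K), le_max_left _ _, fun J τ x hJ hτ hτ' hx => ?_⟩
  have hdet := p.det_fderiv_expand hτ (J := J) x
  have hz := p.gauge_add_pos J hτ x
  have hlt := p.gauge_lt_of_abs_expand_le hτ hτ' hx
  have hτq := p.tau_pow_le hτ hτ'
  have h4 : (1 : ℝ) ≤ 4 ^ p.q := one_le_pow₀ (by norm_num)
  have hB := zero_lt_one.trans_le (p.one_le_profile hz)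
  have hD := p.dist_pos (J := J) (x := x) hτ
  have h1 : 1 ≤ K * (p.radialDeriv (τ ^ (2 * p.q)) (p.gauge J x) /
      p.profile (p.gauge J x + τ ^ (2 * p.q))) := by
    rw [← mul_div_assoc, le_div_iff₀ hB, one_mul]
    exact p.profile_le_of_le (pow_pos hτ _) hτq (p.gauge_nonneg J x) hlt.le
  have h2 := pow_le_pow_left₀ (inv_pos.2 hD).le (p.inv_dist_le_stretch (J := J) (x := x) hτ) d
  have hD2 : p.dist J τ x ≤ 2 * τ := by
    refine le_of_pow_le_pow_left₀ p.two_mul_q_ne_zero (by positivity) ?_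
    rw [p.dist_pow hτ, mul_pow]
    have : (2 : ℝ) ≤ 2 ^ (2 * p.q) := le_self_pow₀ one_le_two p.two_mul_q_ne_zero
    have := pow_pos hτ (2 * p.q)
    nlinarith
  have h3 : τ ^ (-((d : ℝ) - β)) ≤ 2 ^ ((d : ℝ) - β) * (p.dist J τ x)⁻¹ ^ ((d : ℝ) - β) := by
    rw [Real.rpow_neg hτ.le, ← Real.inv_rpow hτ.le, ← Real.mul_rpow zero_le_two (inv_pos.2 hD).le]
    refine Real.rpow_le_rpow (by positivity) ?_ (by linarith)
    rw [← div_eq_mul_inv, le_div_iff₀ hD, inv_mul_le_iff₀ hτ]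
    linarith
  have h5 : (p.dist J τ x)⁻¹ ^ β * (p.dist J τ x)⁻¹ ^ ((d : ℝ) - β) = (p.dist J τ x)⁻¹ ^ d := by
    rw [← Real.rpow_natCast, ← Real.rpow_add (inv_pos.2 hD)]
    ring_nf
  rw [jac, abs_of_pos (p.det_fderiv_expand_pos hτ x), freq, if_pos (by linarith),
    Real.mul_rpow zero_le_two (inv_pos.2 hD).le, hdet, hJ]
  have hst := pow_pos (zero_lt_one.trans_le (p.one_le_stretch hz)) d
  have hrd := p.radialDeriv_pos (pow_pos hτ (2 * p.q)) (p.gauge_nonneg J x)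
  calc (2 : ℝ) ^ β * (p.dist J τ x)⁻¹ ^ β * τ ^ (-((d : ℝ) - β))
      ≤ 2 ^ β * (p.dist J τ x)⁻¹ ^ β *
        (2 ^ ((d : ℝ) - β) * (p.dist J τ x)⁻¹ ^ ((d : ℝ) - β)) := by gcongr
    _ = 2 ^ β * 2 ^ ((d : ℝ) - β) * ((p.dist J τ x)⁻¹ ^ d * 1) := by rw [mul_one, ← h5]; ring
    _ ≤ 2 ^ β * 2 ^ ((d : ℝ) - β) * (p.stretch (p.gauge J x + τ ^ (2 * p.q)) ^ d *
        (K * (p.radialDeriv (τ ^ (2 * p.q)) (p.gauge J x) /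
          p.profile (p.gauge J x + τ ^ (2 * p.q))))) := by gcongr
    _ = (2 ^ β * 2 ^ ((d : ℝ) - β) * K) * (p.stretch (p.gauge J x + τ ^ (2 * p.q)) ^ d *
        (p.radialDeriv (τ ^ (2 * p.q)) (p.gauge J x) /
          p.profile (p.gauge J x + τ ^ (2 * p.q)))) := by ring
    _ ≤ _ := by
      gcongr
      exact le_max_right _ _

end Cutoff

/-! ### Periodic expansions and their compositions -/

/-- The point of the lattice `(2 * L) • ℤ^m` nearest to `x`. -/
noncomputable def nearest {m : ℕ} (L : ℝ) (x : Euc m) : Euc m :=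
  WithLp.toLp 2 fun s => 2 * L * round (x s / (2 * L))

theorem nearest_apply {m : ℕ} (L : ℝ) (x : Euc m) (s : Fin m) :
    nearest L x s = 2 * L * round (x s / (2 * L)) := rfl

theorem nearest_apply_eq {m : ℕ} {L : ℝ} (hL : 0 < L) {x : Euc m} {s : Fin m} {k : ℤ}
    (h : |x s - 2 * L * k| < L) : nearest L x s = 2 * L * k := by
  have h1 : |x s / (2 * L) - k| < 1 / 2 := by
    have : x s / (2 * L) - k = (x s - 2 * L * k) / (2 * L) := by field_simp
    rw [this, abs_div, abs_of_pos (by positivity : 0 < 2 * L), div_lt_iff₀ (by positivity)]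
    linarith
  have h2 := abs_sub_round (x s / (2 * L))
  have h3 : |((round (x s / (2 * L)) - k : ℤ) : ℝ)| < 1 := by
    push_cast
    rw [abs_lt] at h1 ⊢
    rw [abs_le] at h2
    constructor <;> linarith
  have h4 : |round (x s / (2 * L)) - k| < 1 := by exact_mod_cast h3
  rw [nearest_apply, sub_eq_zero.1 (Int.abs_lt_one_iff.1 h4)]

theorem abs_sub_nearest_le {m : ℕ} {L : ℝ} (hL : 0 < L) (x : Euc m) (s : Fin m) (k : ℤ) :
    |x s - nearest L x s| ≤ |x s - 2 * L * k| := by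
  have h := round_le (x s / (2 * L)) k
  have e : ∀ j : ℤ, |x s - 2 * L * j| = 2 * L * |x s / (2 * L) - j| := fun j => by
    rw [← abs_of_pos (by positivity : 0 < 2 * L), ← abs_mul, abs_of_pos (by positivity : 0 < 2 * L)]
    congr 1
    field_simp
  rw [nearest_apply, e, e]
  gcongr

theorem abs_sub_nearest_le_half {m : ℕ} {L : ℝ} (hL : 0 < L) (x : Euc m) (s : Fin m) :
    |x s - nearest L x s| ≤ L := by
  have h := abs_sub_round (x s / (2 * L))
  have e : x s - nearest L x s = 2 * L * (x s / (2 * L) - round (x s / (2 * L))) := by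
    rw [nearest_apply]
    field_simp
  rw [e, abs_mul, abs_of_pos (by positivity : 0 < 2 * L)]
  nlinarith

theorem jac_nonneg {m : ℕ} (Φ : Euc m → Euc m) (x : Euc m) : 0 ≤ jac Φ x := abs_nonneg _

namespace Cutoff

variable {m : ℕ} (p : Cutoff m) {J : Finset (Fin m)} {L τ : ℝ}

theorem add_expand_sub_congr (x : Euc m) {c c' : Euc m} (h : ∀ s ∈ J, c s = c' s) :
    c + p.expand J τ (x - c) = c' + p.expand J τ (x - c') := by
  have hg : p.gauge J (x - c) = p.gauge J (x - c') := by
    unfold gauge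
    exact Finset.sum_congr rfl fun s hs => by simp [h s hs]
  ext s
  by_cases hs : s ∈ J
  · simp only [PiLp.add_apply, p.expand_apply_of_mem hs, hg, PiLp.sub_apply, h s hs]
  · simp [p.expand_apply_of_notMem hs]

/-- The expansion of the coordinates in `J`, repeated around every point of the lattice
`(2 * L) • ℤ^m`. -/
noncomputable def periodicExpand (J : Finset (Fin m)) (L τ : ℝ) (x : Euc m) : Euc m :=
  nearest L x + p.expand J τ (x - nearest L x)

theorem periodicExpand_eventuallyEq (hL : 2 < L) (hτ : 0 < τ) (x₀ : Euc m) :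
    p.periodicExpand J L τ =ᶠ[nhds x₀]
      fun x => nearest L x₀ + p.expand J τ (x - nearest L x₀) := by
  have hL0 : 0 < L := by linarith
  have hcont : ∀ s, Continuous fun x : Euc m => |x s - nearest L x₀ s| := fun s => by fun_prop
  by_cases hA : ∀ s ∈ J, |x₀ s - nearest L x₀ s| ≤ 2
  · have h1 : ∀ᶠ x in nhds x₀, ∀ s ∈ J, |x s - nearest L x₀ s| < L :=
      (Filter.eventually_all_finset J).2 fun s hs =>
        (hcont s).continuousAt.eventually (gt_mem_nhds ((hA s hs).trans_lt hL))
    filter_upwards [h1] with x hx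
    exact p.add_expand_sub_congr x fun s hs => nearest_apply_eq hL0 (hx s hs)
  · -- away from the lattice both sides are the identity
    push Not at hA
    obtain ⟨s, hs, h2⟩ := hA
    have h1 : ∀ᶠ x in nhds x₀, 2 + |x s - x₀ s| < |x₀ s - nearest L x₀ s| := by
      have hc : Continuous fun x : Euc m => 2 + |x s - x₀ s| := by fun_prop
      exact hc.continuousAt.eventually (gt_mem_nhds (by simpa using h2))
    have key : ∀ x : Euc m, 2 + |x s - x₀ s| < |x₀ s - nearest L x₀ s| → ∀ k : ℤ,
        2 < |x s - 2 * L * k| := fun x hx k => by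
      have h3 := abs_sub_nearest_le hL0 x₀ s k
      have h4 := abs_sub_abs_le_abs_sub (x₀ s - 2 * L * k) (x₀ s - x s)
      rw [sub_sub_sub_cancel_left, abs_sub_comm (x₀ s) (x s)] at h4
      linarith
    filter_upwards [h1] with x hx
    rw [periodicExpand, p.expand_eq_self_of_lt hτ hs (by simpa [nearest_apply] using key x hx _),
      p.expand_eq_self_of_lt hτ hs (by simpa [nearest_apply] using key x hx _)]
    simp

theorem contDiff_periodicExpand (hL : 2 < L) (hτ : 0 < τ) :
    ContDiff ℝ ∞ (p.periodicExpand J L τ) :=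
  contDiff_iff_contDiffAt.2 fun x =>
    (contDiff_const.add ((p.contDiff_expand J hτ).comp
      (contDiff_id.sub contDiff_const))).contDiffAt.congr_of_eventuallyEq
        (p.periodicExpand_eventuallyEq hL hτ x)

/-- In each coordinate, either a point does not move, or it stays within distance `2` of the same
lattice point. -/
theorem periodicExpand_apply_eq_or (hτ : 0 < τ) (x : Euc m) :
    p.periodicExpand J L τ x = x ∨ ∀ s, p.periodicExpand J L τ x s = x s ∨
      (|x s - nearest L x s| ≤ 2 ∧ |p.periodicExpand J L τ x s - nearest L x s| ≤ 2) := by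
  rcases p.expand_eq_self_or hτ (J := J) (x - nearest L x) with h | h
  · left
    rw [periodicExpand, h]
    simp
  · right
    intro s
    by_cases hs : s ∈ J
    · right
      simpa [periodicExpand] using h s hs
    · left
      simp [periodicExpand, p.expand_apply_of_notMem hs]

theorem abs_sub_nearest_le_abs_periodicExpand (hτ : 0 < τ) (x : Euc m) (s : Fin m) :
    |x s - nearest L x s| ≤ |p.periodicExpand J L τ x s - nearest L x s| := by
  simpa [periodicExpand] using p.abs_le_abs_expand hτ (J := J) (x - nearest L x) s

theorem nearest_periodicExpand (hL : 2 < L) (hτ : 0 < τ) (x : Euc m) :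
    nearest L (p.periodicExpand J L τ x) = nearest L x := by
  rcases p.periodicExpand_apply_eq_or hτ (J := J) (L := L) x with h | h
  · rw [h]
  · ext s
    rcases h s with h | h
    · rw [nearest_apply, h, nearest_apply]
    · exact nearest_apply_eq (by linarith) (h.2.trans_lt hL)

theorem bijective_periodicExpand (hL : 2 < L) (hτ : 0 < τ) :
    Function.Bijective (p.periodicExpand J L τ) := by
  refine ⟨fun x y h => ?_, fun y => ?_⟩
  · have hc : nearest L x = nearest L y := by
      rw [← p.nearest_periodicExpand hL hτ (J := J) x, h, p.nearest_periodicExpand hL hτ]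
    rw [periodicExpand, periodicExpand, hc] at h
    exact sub_left_injective (p.injective_expand J hτ (add_left_cancel h))
  · obtain ⟨v, hv⟩ := p.surjective_expand J hτ (y - nearest L y)
    refine ⟨nearest L y + v, ?_⟩
    have hL0 : 0 < L := by linarith
    have hc : p.periodicExpand J L τ (nearest L y + v) = nearest L y + p.expand J τ v := by
      rcases p.expand_eq_self_or hτ (J := J) v with h | h
      · have hvy : nearest L y + v = y := by
          rw [← h, hv]
          simp
        rw [periodicExpand, hvy, ← hv, h]
        simp [h]
      · have := p.add_expand_sub_congr (J := J) (τ := τ) (nearest L y + v)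
          (c := nearest L (nearest L y + v)) (c' := nearest L y) fun s hs =>
            nearest_apply_eq hL0 (by
              have := (h s hs).1.trans_lt hL
              simpa [nearest_apply] using this)
        rw [periodicExpand, this]
        simp
    rw [hc, hv]
    simp

theorem abs_sub_le_of_abs_periodicExpand_sub_le (hL : 2 < L) (hτ : 0 < τ) {x : Euc m} {s : Fin m}
    {k : ℤ} {r : ℝ} (hr : r ≤ 2) (h : |p.periodicExpand J L τ x s - 2 * L * k| ≤ r) :
    |x s - 2 * L * k| ≤ r := by
  have h1 := nearest_apply_eq (by linarith) (h.trans_lt (hr.trans_lt hL))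
  rw [p.nearest_periodicExpand hL hτ] at h1
  rw [← h1] at h ⊢
  exact (p.abs_sub_nearest_le_abs_periodicExpand hτ x s).trans h

theorem abs_sub_le_tau (hL : 2 < L) (hτ : 0 < τ) (hτ' : τ < 1 / 2) {x : Euc m} {z : Fin m → ℤ}
    (h : ∀ s ∈ J, |p.periodicExpand J L τ x s - 2 * L * z s| ≤ 1) :
    (∀ s ∈ J, |p.expand J τ (x - nearest L x) s| ≤ 1) ∧ ∀ s ∈ J, |x s - 2 * L * z s| ≤ τ := by
  have h1 : ∀ s ∈ J, nearest L x s = 2 * L * z s := fun s hs => by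
    rw [← p.nearest_periodicExpand hL hτ (J := J) x]
    exact nearest_apply_eq (by linarith) ((h s hs).trans_lt (by linarith))
  have h2 : ∀ s ∈ J, |p.expand J τ (x - nearest L x) s| ≤ 1 := fun s hs => by
    have := h s hs
    rw [← h1 s hs, periodicExpand] at this
    simpa using this
  refine ⟨h2, fun s hs => ?_⟩
  have := p.abs_le_of_abs_expand_le hτ hτ' h2 s hs
  rw [← h1 s hs]
  simpa using this

theorem abs_periodicExpand_sub_le (hL : 2 < L) (hτ : 0 < τ) {x : Euc m} {s : Fin m}
    {k : ℤ} (h : |x s - 2 * L * k| ≤ L) : |p.periodicExpand J L τ x s - 2 * L * k| ≤ L := by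
  rcases p.periodicExpand_apply_eq_or hτ (J := J) (L := L) x with h1 | h1
  · rwa [h1]
  rcases h1 s with h2 | h2
  · rwa [h2]
  -- a lattice point at distance less than `L` is the only one at distance at most `L`
  have hk : nearest L x s = 2 * L * k := by
    have h3 : |((round (x s / (2 * L)) - k : ℤ) : ℝ)| < 1 := by
      have h4 : |2 * L * ((round (x s / (2 * L)) - k : ℤ) : ℝ)| < 2 * L := by
        have e : 2 * L * ((round (x s / (2 * L)) - k : ℤ) : ℝ) =
            (x s - 2 * L * k) - (x s - nearest L x s) := by
          rw [nearest_apply]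
          push_cast
          ring
        rw [e]
        refine (abs_sub _ _).trans_lt ?_
        linarith [h2.1]
      rw [abs_mul, abs_of_pos (by linarith : 0 < 2 * L)] at h4
      exact lt_of_mul_lt_mul_left (by linarith) (by linarith : 0 ≤ 2 * L)
    have h4 : |round (x s / (2 * L)) - k| < 1 := by exact_mod_cast h3
    rw [nearest_apply, sub_eq_zero.1 (Int.abs_lt_one_iff.1 h4)]
  rw [← hk]
  exact h2.2.trans hL.le

theorem norm_iteratedFDeriv_periodicExpand (hL : 2 < L) (hτ : 0 < τ) (x : Euc m) {n : ℕ}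
    (hn : 1 ≤ n) : ‖iteratedFDeriv ℝ n (p.periodicExpand J L τ) x‖ =
      ‖iteratedFDeriv ℝ n (p.expand J τ) (x - nearest L x)‖ := by
  rw [((p.periodicExpand_eventuallyEq hL hτ x).iteratedFDeriv ℝ n).eq_of_nhds]
  have h1 : ContDiff ℝ n fun y => p.expand J τ (y - nearest L x) :=
    ((p.contDiff_expand J hτ).of_le (mod_cast le_top)).comp (contDiff_id.sub contDiff_const)
  have h2 := iteratedFDeriv_add_apply (𝕜 := ℝ) (i := n) (x := x)
    (f := fun _ => nearest L x) contDiff_const.contDiffAt h1.contDiffAt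
  have h3 : (fun y => nearest L x + p.expand J τ (y - nearest L x)) =
    (fun _ => nearest L x) + fun y => p.expand J τ (y - nearest L x) := rfl
  rw [h3, h2, iteratedFDeriv_const_of_ne (by omega), iteratedFDeriv_comp_sub]
  simp

theorem jac_periodicExpand (hL : 2 < L) (hτ : 0 < τ) (x : Euc m) :
    jac (p.periodicExpand J L τ) x = jac (p.expand J τ) (x - nearest L x) := by
  rw [jac, (p.periodicExpand_eventuallyEq hL hτ x).fderiv_eq, fderiv_const_add, fderiv_comp_sub, jac]

/-- The composition of the periodic expansions of the sets of coordinates in a list. -/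
noncomputable def compExpand (L τ : ℝ) : List (Finset (Fin m)) → Euc m → Euc m
  | [] => id
  | J :: l => p.periodicExpand J L τ ∘ compExpand L τ l

/-- The product of the frequencies of the factors of `compExpand`, each at the point to which it is
applied. -/
noncomputable def compFreq (L τ : ℝ) : List (Finset (Fin m)) → Euc m → ℝ
  | [], _ => 1
  | J :: l, x => p.freq J τ (p.compExpand L τ l x - nearest L (p.compExpand L τ l x)) *
      compFreq L τ l x

theorem contDiff_compExpand (hL : 2 < L) (hτ : 0 < τ) (l : List (Finset (Fin m))) :
    ContDiff ℝ ∞ (p.compExpand L τ l) := by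
  induction l with
  | nil => exact contDiff_id
  | cons J l ih => exact (p.contDiff_periodicExpand hL hτ).comp ih

theorem bijective_compExpand (hL : 2 < L) (hτ : 0 < τ) (l : List (Finset (Fin m))) :
    Function.Bijective (p.compExpand L τ l) := by
  induction l with
  | nil => exact Function.bijective_id
  | cons J l ih => exact (p.bijective_periodicExpand hL hτ).comp ih

theorem abs_compExpand_sub_le (hL : 2 < L) (hτ : 0 < τ) (l : List (Finset (Fin m))) {x : Euc m}
    {s : Fin m} {k : ℤ} (h : |x s - 2 * L * k| ≤ L) : |p.compExpand L τ l x s - 2 * L * k| ≤ L := by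
  induction l with
  | nil => exact h
  | cons J l ih => exact p.abs_periodicExpand_sub_le hL hτ ih

theorem abs_sub_le_of_abs_compExpand_sub_le (hL : 2 < L) (hτ : 0 < τ) (l : List (Finset (Fin m)))
    {x : Euc m} {s : Fin m} {k : ℤ} {r : ℝ} (hr : r ≤ 2)
    (h : |p.compExpand L τ l x s - 2 * L * k| ≤ r) : |x s - 2 * L * k| ≤ r := by
  induction l with
  | nil => exact h
  | cons J l ih => exact ih (p.abs_sub_le_of_abs_periodicExpand_sub_le hL hτ hr h)

theorem compExpand_eq_self (hτ : 0 < τ) (l : List (Finset (Fin m))) {x : Euc m}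
    (h : ∀ J ∈ l, ∀ z : Fin m → ℤ, ∃ s ∈ J, 2 < |x s - 2 * L * z s|) :
    p.compExpand L τ l x = x := by
  induction l with
  | nil => rfl
  | cons J l ih =>
    obtain ⟨s, hs, h2⟩ := h J (by simp) fun s => round (x s / (2 * L))
    rw [compExpand, Function.comp_apply, ih fun J' hJ' => h J' (by simp [hJ']), periodicExpand,
      p.expand_eq_self_of_lt hτ hs (by simpa [nearest_apply] using h2)]
    simp

theorem abs_sub_le_tau_of_mem (hL : 2 < L) (hτ : 0 < τ) (hτ' : τ < 1 / 2)
    (l : List (Finset (Fin m))) (hJ : J ∈ l) {x : Euc m} {z : Fin m → ℤ}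
    (h : ∀ s ∈ J, |p.compExpand L τ l x s - 2 * L * z s| ≤ 1) :
    ∀ s ∈ J, |x s - 2 * L * z s| ≤ τ := by
  induction l with
  | nil => simp at hJ
  | cons J' l ih =>
    rcases List.mem_cons.1 hJ with rfl | hJ
    · intro s hs
      exact p.abs_sub_le_of_abs_compExpand_sub_le hL hτ l (by linarith)
        ((p.abs_sub_le_tau hL hτ hτ' h).2 s hs)
    · exact ih hJ fun s hs =>
        p.abs_sub_le_of_abs_periodicExpand_sub_le hL hτ one_le_two (h s hs)

theorem one_le_compFreq (hτ : 0 < τ) (l : List (Finset (Fin m))) (x : Euc m) :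
    1 ≤ p.compFreq L τ l x := by
  induction l with
  | nil => exact le_rfl
  | cons J l ih => exact one_le_mul_of_one_le_of_one_le (p.one_le_freq hτ) ih

/-- The derivatives of the composition are controlled by powers of the product of the frequencies, by the
formula of Faà di Bruno. -/
theorem exists_norm_iteratedFDeriv_compExpand_le (l : List (Finset (Fin m))) (n : ℕ) (hn : 1 ≤ n) :
    ∃ C, 0 ≤ C ∧ ∀ (L τ : ℝ) (x : Euc m), 2 < L → 0 < τ →
      ‖iteratedFDeriv ℝ n (p.compExpand L τ l) x‖ ≤ C * p.compFreq L τ l x ^ n := by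
  induction l generalizing n with
  | nil =>
    refine ⟨1, zero_le_one, fun L τ x _ _ => ?_⟩
    obtain ⟨n, rfl⟩ : ∃ k, n = k + 1 := ⟨n - 1, by omega⟩
    have h := norm_iteratedFDeriv_succ_clm_le (ContinuousLinearMap.id ℝ (Euc m)) x n
    simp only [compFreq, one_pow, mul_one]
    refine h.trans ?_
    split_ifs
    exacts [ContinuousLinearMap.norm_id_le, zero_le_one]
  | cons J l ih =>
    have hJ : ∀ n, ∃ C, 0 ≤ C ∧ (1 ≤ n → ∀ (τ : ℝ) (x : Euc m), 0 < τ →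
        ‖iteratedFDeriv ℝ n (p.expand J τ) x‖ ≤ C * p.freq J τ x ^ n) := fun n => by
      by_cases h : 1 ≤ n
      · obtain ⟨C, hC, h1⟩ := p.exists_norm_iteratedFDeriv_expand_le n h
        exact ⟨C, hC, fun _ => h1 J⟩
      · exact ⟨0, le_rfl, fun h' => absurd h' h⟩
    have hl : ∀ n, ∃ C, 0 ≤ C ∧ (1 ≤ n → ∀ (L τ : ℝ) (x : Euc m), 2 < L → 0 < τ →
        ‖iteratedFDeriv ℝ n (p.compExpand L τ l) x‖ ≤ C * p.compFreq L τ l x ^ n) := fun n => by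
      by_cases h : 1 ≤ n
      · obtain ⟨C, hC, h1⟩ := ih n h
        exact ⟨C, hC, fun _ => h1⟩
      · exact ⟨0, le_rfl, fun h' => absurd h' h⟩
    choose C hC hCJ using hJ
    choose D hD hDl using hl
    refine ⟨∑ c : OrderedFinpartition n, C c.length * ∏ k, D (c.partSize k),
      Finset.sum_nonneg fun c _ => mul_nonneg (hC _) (Finset.prod_nonneg fun k _ => hD _),
      fun L τ x hL hτ => ?_⟩
    refine (norm_iteratedFDeriv_comp_le_sum (p.contDiff_periodicExpand hL hτ).contDiffAt
      (p.contDiff_compExpand hL hτ l).contDiffAt).trans ?_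
    rw [Finset.sum_mul]
    refine Finset.sum_le_sum fun c _ => ?_
    have hlen : 1 ≤ c.length := c.length_pos hn
    set y := p.compExpand L τ l x with hy
    have hf1 := p.one_le_freq (J := J) (x := y - nearest L y) hτ
    have hf2 := p.one_le_compFreq (L := L) hτ l x
    have e1 : ‖iteratedFDeriv ℝ c.length (p.periodicExpand J L τ) y‖ ≤
        C c.length * p.freq J τ (y - nearest L y) ^ n := by
      rw [p.norm_iteratedFDeriv_periodicExpand hL hτ y hlen]
      exact (hCJ _ hlen τ _ hτ).trans
        (mul_le_mul_of_nonneg_left (pow_le_pow_right₀ hf1 c.length_le) (hC _))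
    have hprod : ∏ k, p.compFreq L τ l x ^ c.partSize k = p.compFreq L τ l x ^ n := by
      simpa using c.prod_sigma_eq_prod (fun _ => p.compFreq L τ l x)
    have e2 : ∏ k, ‖iteratedFDeriv ℝ (c.partSize k) (p.compExpand L τ l) x‖ ≤
        (∏ k, D (c.partSize k)) * p.compFreq L τ l x ^ n := by
      rw [← hprod, ← Finset.prod_mul_distrib]
      exact Finset.prod_le_prod (fun _ _ => norm_nonneg _) fun k _ =>
        hDl _ (c.partSize_pos k) L τ x hL hτ
    have hDp : 0 ≤ ∏ k, D (c.partSize k) := Finset.prod_nonneg fun k _ => hD _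
    have hCc := hC c.length
    calc _ ≤ (C c.length * p.freq J τ (y - nearest L y) ^ n) *
          ((∏ k, D (c.partSize k)) * p.compFreq L τ l x ^ n) :=
          mul_le_mul e1 e2 (Finset.prod_nonneg fun _ _ => norm_nonneg _) (by positivity)
      _ = _ := by
        rw [compFreq, ← hy, mul_pow]
        ring

theorem jac_compExpand_cons (hL : 2 < L) (hτ : 0 < τ) (l : List (Finset (Fin m))) (x : Euc m) :
    jac (p.compExpand L τ (J :: l)) x = jac (p.expand J τ) (p.compExpand L τ l x -
      nearest L (p.compExpand L τ l x)) * jac (p.compExpand L τ l) x := by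
  rw [← p.jac_periodicExpand hL hτ, compExpand, jac, fderiv_comp _
    ((p.contDiff_periodicExpand hL hτ).differentiable (by simp) _)
    ((p.contDiff_compExpand hL hτ l).differentiable (by simp) _)]
  rw [jac, jac, ← abs_mul, ContinuousLinearMap.det, ContinuousLinearMap.det,
    ContinuousLinearMap.det, ← LinearMap.det_comp]
  rfl

theorem exists_compFreq_rpow_le {β : ℝ} {d : ℕ} (hβd : β < d) (l : List (Finset (Fin m)))
    (hl : ∀ J ∈ l, J.card = d) : ∃ C, 1 ≤ C ∧ ∀ (L τ : ℝ) (x : Euc m), 2 < L → 0 < τ →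
      p.compFreq L τ l x ^ β ≤ C * jac (p.compExpand L τ l) x := by
  induction l with
  | nil =>
    refine ⟨1, le_rfl, fun L τ x _ _ => ?_⟩
    simp [compFreq, compExpand, jac, ContinuousLinearMap.det]
  | cons J l ih =>
    obtain ⟨C, hC, h1⟩ := ih fun J' hJ' => hl J' (by simp [hJ'])
    obtain ⟨D, hD, h2⟩ := p.exists_freq_rpow_le hβd
    refine ⟨D * C, one_le_mul_of_one_le_of_one_le hD hC, fun L τ x hL hτ => ?_⟩
    rw [p.jac_compExpand_cons hL hτ, compFreq, Real.mul_rpow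
      (zero_le_one.trans (p.one_le_freq hτ)) (zero_le_one.trans (p.one_le_compFreq hτ l x))]
    have e1 := h1 L τ x hL hτ
    have e2 := h2 J τ (p.compExpand L τ l x - nearest L (p.compExpand L τ l x)) (hl J (by simp)) hτ
    have e3 := Real.rpow_nonneg (zero_le_one.trans (p.one_le_compFreq (L := L) hτ l x)) β
    calc _ ≤ (D * jac (p.expand J τ) _) * (C * jac (p.compExpand L τ l) x) :=
          mul_le_mul e2 e1 e3 (mul_nonneg (by linarith) (jac_nonneg _ _))
      _ = _ := by ring

/-- It suffices that one of the factors gains the additional power of `1 / τ`. The factors applied after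
it move points away from the lattice, so that its values are still in the unit cube. -/
theorem exists_compFreq_rpow_mul_le {β : ℝ} {d : ℕ} (hβd : β < d) (l : List (Finset (Fin m)))
    (hl : ∀ J ∈ l, J.card = d) : ∃ C, 1 ≤ C ∧ ∀ (L τ : ℝ) (x : Euc m), 2 < L → 0 < τ → τ < 1 / 2 →
      (∃ J ∈ l, ∃ z : Fin m → ℤ, ∀ s ∈ J, |p.compExpand L τ l x s - 2 * L * z s| ≤ 1) →
      p.compFreq L τ l x ^ β * τ ^ (-((d : ℝ) - β)) ≤ C * jac (p.compExpand L τ l) x := by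
  induction l with
  | nil => exact ⟨1, le_rfl, by simp⟩
  | cons J l ih =>
    have hl' : ∀ J' ∈ l, J'.card = d := fun J' hJ' => hl J' (by simp [hJ'])
    obtain ⟨C, hC, h1⟩ := ih hl'
    obtain ⟨C', hC', h1'⟩ := p.exists_compFreq_rpow_le hβd l hl'
    obtain ⟨D, hD, h2⟩ := p.exists_freq_rpow_le hβd
    obtain ⟨D', hD', h2'⟩ := p.exists_freq_rpow_mul_le hβd
    refine ⟨max (D * C) (D' * C'), (one_le_mul_of_one_le_of_one_le hD hC).trans (le_max_left _ _),
      fun L τ x hL hτ hτ' hx => ?_⟩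
    rw [p.jac_compExpand_cons hL hτ, compFreq, Real.mul_rpow
      (zero_le_one.trans (p.one_le_freq hτ)) (zero_le_one.trans (p.one_le_compFreq hτ l x))]
    set y := p.compExpand L τ l x with hy
    have f1 := Real.rpow_nonneg (zero_le_one.trans (p.one_le_compFreq (L := L) hτ l x)) β
    have f2 := Real.rpow_nonneg
      (zero_le_one.trans (p.one_le_freq (J := J) (x := y - nearest L y) hτ)) β
    have f3 := Real.rpow_nonneg hτ.le (-((d : ℝ) - β))
    have j1 := jac_nonneg (p.expand J τ) (y - nearest L y)
    have j2 := jac_nonneg (p.compExpand L τ l) x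
    obtain ⟨J', hJ', z, hz⟩ := hx
    rcases List.mem_cons.1 hJ' with rfl | hJ'
    · have e2 := h2' J' τ (y - nearest L y) (hl J' (by simp)) hτ hτ'
        (p.abs_sub_le_tau hL hτ hτ' hz).1
      have e1 := h1' L τ x hL hτ
      calc _ = (p.freq J' τ (y - nearest L y) ^ β * τ ^ (-((d : ℝ) - β))) *
            p.compFreq L τ l x ^ β := by ring
        _ ≤ (D' * jac (p.expand J' τ) (y - nearest L y)) * (C' * jac (p.compExpand L τ l) x) :=
            mul_le_mul e2 e1 f1 (mul_nonneg (by linarith) j1)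
        _ = (D' * C') * (jac (p.expand J' τ) (y - nearest L y) * jac (p.compExpand L τ l) x) := by
            ring
        _ ≤ _ := mul_le_mul_of_nonneg_right (le_max_right _ _) (mul_nonneg j1 j2)
    · have e2 := h2 J τ (y - nearest L y) (hl J (by simp)) hτ
      have e1 := h1 L τ x hL hτ hτ' ⟨J', hJ', z, fun s hs =>
        p.abs_sub_le_of_abs_periodicExpand_sub_le hL hτ one_le_two (hz s hs)⟩
      calc _ = p.freq J τ (y - nearest L y) ^ β *
            (p.compFreq L τ l x ^ β * τ ^ (-((d : ℝ) - β))) := by ring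
        _ ≤ (D * jac (p.expand J τ) (y - nearest L y)) * (C * jac (p.compExpand L τ l) x) :=
            mul_le_mul e2 e1 (mul_nonneg f1 f3) (mul_nonneg (by linarith) j1)
        _ = (D * C) * (jac (p.expand J τ) (y - nearest L y) * jac (p.compExpand L τ l) x) := by
            ring
        _ ≤ _ := mul_le_mul_of_nonneg_right (le_max_left _ _) (mul_nonneg j1 j2)

end Cutoff

/-! ### The map in the scale of the cubication -/

/-- The set of points with at least `ℓ + 1` coordinates at distance at most `r` from the coordinates
of the lattice `a + (2 * η) • ℤ^m`. -/
def latticeNhd {m : ℕ} (a : Euc m) (η : ℝ) (ℓ : ℕ) (r : ℝ) : Set (Euc m) :=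
  {x | ∃ J : Finset (Fin m), J.card = ℓ + 1 ∧ ∃ z : Fin m → ℤ,
    ∀ s ∈ J, |x s - a s - 2 * η * z s| ≤ r}

section Rescale

variable {m : ℕ} {a : Euc m} {ρ : ℝ} {Ψ : Euc m → Euc m}

/-- The conjugate of a map by the homothety of ratio `ρ` that sends `0` to `a`. -/
noncomputable def rescale (a : Euc m) (ρ : ℝ) (Ψ : Euc m → Euc m) (x : Euc m) : Euc m :=
  a + ρ • Ψ (ρ⁻¹ • (x - a))

theorem contDiff_rescale (hΨ : ContDiff ℝ ∞ Ψ) : ContDiff ℝ ∞ (rescale a ρ Ψ) :=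
  contDiff_const.add ((hΨ.comp (g := Ψ) (f := fun x => ρ⁻¹ • (x - a)) (by fun_prop)).const_smul ρ)

theorem bijective_rescale (hρ : 0 < ρ) (hΨ : Function.Bijective Ψ) :
    Function.Bijective (rescale a ρ Ψ) := by
  refine ⟨fun x y h => ?_, fun y => ?_⟩
  · have h1 := hΨ.1 (smul_right_injective _ hρ.ne' (add_left_cancel h))
    exact sub_left_injective (smul_right_injective _ (inv_pos.2 hρ).ne' h1)
  · obtain ⟨v, hv⟩ := hΨ.2 (ρ⁻¹ • (y - a))
    refine ⟨a + ρ • v, ?_⟩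
    simp [rescale, hv, smul_smul, hρ.ne']

theorem jac_rescale (hρ : 0 < ρ) (hΨ : ContDiff ℝ ∞ Ψ) (x : Euc m) :
    jac (rescale a ρ Ψ) x = jac Ψ (ρ⁻¹ • (x - a)) := by
  have h1 : HasFDerivAt (fun x : Euc m => ρ⁻¹ • (x - a)) (ρ⁻¹ • ContinuousLinearMap.id ℝ (Euc m)) x :=
    ((hasFDerivAt_id x).sub_const a).const_smul ρ⁻¹
  have h2 := (hΨ.differentiable (by simp) (ρ⁻¹ • (x - a))).hasFDerivAt
  have h3 : HasFDerivAt (rescale a ρ Ψ) _ x := ((h2.comp x h1).const_smul ρ).const_add a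
  rw [jac, jac, h3.fderiv]
  congr 2
  ext v s
  simp [hρ.ne']

theorem norm_iteratedFDeriv_rescale_le (hρ : 0 < ρ) (hΨ : ContDiff ℝ ∞ Ψ) (x : Euc m) {n : ℕ}
    (hn : 1 ≤ n) : ρ ^ (n - 1) * ‖iteratedFDeriv ℝ n (rescale a ρ Ψ) x‖ ≤
      ‖iteratedFDeriv ℝ n Ψ (ρ⁻¹ • (x - a))‖ := by
  set T : Euc m →L[ℝ] Euc m := ρ⁻¹ • ContinuousLinearMap.id ℝ (Euc m) with hT
  have hTn : ‖T‖ ≤ ρ⁻¹ := by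
    rw [hT, norm_smul, Real.norm_of_nonneg (inv_pos.2 hρ).le]
    exact mul_le_of_le_one_right (inv_pos.2 hρ).le ContinuousLinearMap.norm_id_le
  have hΨn : ContDiff ℝ n Ψ := hΨ.of_le (mod_cast le_top)
  have h1 : ContDiff ℝ n (Ψ ∘ T) := hΨn.comp T.contDiff
  have h2 : ContDiff ℝ n fun y => (Ψ ∘ T) (y - a) := h1.comp (contDiff_id.sub contDiff_const)
  have h2' : ContDiff ℝ n (ρ • fun y => (Ψ ∘ T) (y - a)) := h2.const_smul ρ
  have h3 : rescale a ρ Ψ = (fun _ => a) + ρ • fun y => (Ψ ∘ T) (y - a) := rfl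
  have h4 : iteratedFDeriv ℝ n (rescale a ρ Ψ) x =
      ρ • (iteratedFDeriv ℝ n Ψ (T (x - a))).compContinuousLinearMap fun _ => T := by
    rw [h3, iteratedFDeriv_add_apply contDiff_const.contDiffAt h2'.contDiffAt,
      iteratedFDeriv_const_of_ne (by omega), iteratedFDeriv_const_smul_apply h2.contDiffAt,
      iteratedFDeriv_comp_sub, T.iteratedFDeriv_comp_right hΨ _ (mod_cast le_top)]
    simp
  have h5 := (iteratedFDeriv ℝ n Ψ (T (x - a))).norm_compContinuousLinearMap_le fun _ => T
  rw [Finset.prod_const, Finset.card_univ, Fintype.card_fin] at h5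
  have h6 : ‖T‖ ^ n ≤ ρ⁻¹ ^ n := pow_le_pow_left₀ (norm_nonneg _) hTn n
  have h7 : ρ ^ (n - 1) * ρ * ρ⁻¹ ^ n = 1 := by
    rw [← pow_succ, Nat.sub_add_cancel hn, ← mul_pow, mul_inv_cancel₀ hρ.ne', one_pow]
  have h8 : T (x - a) = ρ⁻¹ • (x - a) := rfl
  rw [h4, norm_smul, Real.norm_of_nonneg hρ.le, ← h8]
  have h9 := norm_nonneg (iteratedFDeriv ℝ n Ψ (T (x - a)))
  calc _ ≤ ρ ^ (n - 1) * (ρ * (‖iteratedFDeriv ℝ n Ψ (T (x - a))‖ * ρ⁻¹ ^ n)) := by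
        gcongr
        exact h5.trans (by gcongr)
    _ = (ρ ^ (n - 1) * ρ * ρ⁻¹ ^ n) * ‖iteratedFDeriv ℝ n Ψ (T (x - a))‖ := by ring
    _ = _ := by rw [h7, one_mul]

end Rescale

theorem pow_le_of_rpow_le {M K β : ℝ} (hM : 0 ≤ M) (hβ : 0 < β) (h : M ^ β ≤ K) (n : ℕ) :
    M ^ n ≤ K ^ ((n : ℝ) / β) := by
  have h1 : M ^ n = (M ^ β) ^ ((n : ℝ) / β) := by
    rw [← Real.rpow_mul hM, mul_div_cancel₀ _ hβ.ne', Real.rpow_natCast]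
  rw [h1]
  exact Real.rpow_le_rpow (Real.rpow_nonneg hM _) h (by positivity)

/-- The properties, in the scale of the cubication, of the map constructed in this part. Here `ρ` is
the product `μ * η`, and `K`, `K'` are the constants in the estimates of the derivatives. -/
structure IsShrinking {m : ℕ} (K K' : ℝ → ℕ → ℝ) (ℓ : ℕ) (a : Euc m) (η ρ τ : ℝ)
    (Φ : Euc m → Euc m) : Prop where
  contDiff : ContDiff ℝ ∞ Φ
  bijective : Function.Bijective Φ
  exists_le_jac : ∃ c, 0 < c ∧ ∀ x, c ≤ jac Φ x
  abs_sub_le : ∀ (x : Euc m) (s : Fin m) (k : ℤ), |x s - a s - 2 * η * k| ≤ η →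
    |Φ x s - a s - 2 * η * k| ≤ η
  eq_self : ∀ x ∉ latticeNhd a η ℓ (2 * ρ), Φ x = x
  mem_of_mem : ∀ x, Φ x ∈ latticeNhd a η ℓ ρ → x ∈ latticeNhd a η ℓ (τ * ρ)
  le_jac : ∀ (β : ℝ) (j : ℕ), 0 < β → β < ℓ + 1 → 1 ≤ j → ∀ x,
    ρ ^ (j - 1) * ‖iteratedFDeriv ℝ j Φ x‖ ≤ K β j * jac Φ x ^ ((j : ℝ) / β)
  le_jac_of_mem : ∀ (β : ℝ) (j : ℕ), 0 < β → β < ℓ + 1 → 1 ≤ j → ∀ x,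
    Φ x ∈ latticeNhd a η ℓ ρ → ρ ^ (j - 1) * ‖iteratedFDeriv ℝ j Φ x‖ ≤
      K' β j * τ ^ ((j : ℝ) * ((ℓ + 1) / β - 1)) * jac Φ x ^ ((j : ℝ) / β)

theorem IsShrinking.jac_pos {m : ℕ} {K K' : ℝ → ℕ → ℝ} {ℓ : ℕ} {a : Euc m} {η ρ τ : ℝ}
    {Φ : Euc m → Euc m} (h : IsShrinking K K' ℓ a η ρ τ Φ) (x : Euc m) : 0 < jac Φ x :=
  let ⟨_, hc, h1⟩ := h.exists_le_jac
  hc.trans_le (h1 x)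

/-- The sets of `ℓ + 1` coordinates, as a list. -/
noncomputable def coordSets (m ℓ : ℕ) : List (Finset (Fin m)) :=
  (Finset.powersetCard (ℓ + 1) Finset.univ).toList

theorem mem_coordSets {m ℓ : ℕ} {J : Finset (Fin m)} : J ∈ coordSets m ℓ ↔ J.card = ℓ + 1 := by
  simp [coordSets]

namespace Cutoff

variable {m : ℕ} (p : Cutoff m)

theorem exists_le_jac_compExpand (ℓ : ℕ) (β : ℝ) (j : ℕ) : ∃ C, 0 < C ∧
    (0 < β → β < ℓ + 1 → 1 ≤ j → ∀ (L τ : ℝ) (x : Euc m), 2 < L → 0 < τ →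
      ‖iteratedFDeriv ℝ j (p.compExpand L τ (coordSets m ℓ)) x‖ ≤
        C * jac (p.compExpand L τ (coordSets m ℓ)) x ^ ((j : ℝ) / β)) := by
  by_cases h : 0 < β ∧ β < ℓ + 1 ∧ 1 ≤ j
  · obtain ⟨hβ, hβ', hj⟩ := h
    obtain ⟨C, hC, h1⟩ := p.exists_norm_iteratedFDeriv_compExpand_le (coordSets m ℓ) j hj
    obtain ⟨D, hD, h2⟩ := p.exists_compFreq_rpow_le (d := ℓ + 1) (by exact_mod_cast hβ')
      (coordSets m ℓ) fun J hJ => mem_coordSets.1 hJ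
    have hDp : 0 < D := by linarith
    refine ⟨(C + 1) * D ^ ((j : ℝ) / β), by positivity, fun _ _ _ L τ x hL hτ => ?_⟩
    have h3 := pow_le_of_rpow_le (zero_le_one.trans (p.one_le_compFreq hτ _ x)) hβ (h2 L τ x hL hτ) j
    rw [Real.mul_rpow hDp.le (jac_nonneg _ _)] at h3
    have h4 := p.one_le_compFreq (L := L) hτ (coordSets m ℓ) x
    rw [mul_assoc]
    refine (h1 L τ x hL hτ).trans ?_
    exact mul_le_mul (by linarith) h3 (by positivity) (by positivity)
  · exact ⟨1, one_pos, fun h1 h2 h3 => absurd ⟨h1, h2, h3⟩ h⟩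

theorem exists_le_jac_compExpand_of_mem (ℓ : ℕ) (β : ℝ) (j : ℕ) : ∃ C, 0 < C ∧
    (0 < β → β < ℓ + 1 → 1 ≤ j → ∀ (L τ : ℝ) (x : Euc m), 2 < L → 0 < τ → τ < 1 / 2 →
      (∃ J ∈ coordSets m ℓ, ∃ z : Fin m → ℤ, ∀ s ∈ J,
        |p.compExpand L τ (coordSets m ℓ) x s - 2 * L * z s| ≤ 1) →
      ‖iteratedFDeriv ℝ j (p.compExpand L τ (coordSets m ℓ)) x‖ ≤
        C * τ ^ ((j : ℝ) * ((ℓ + 1) / β - 1)) *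
          jac (p.compExpand L τ (coordSets m ℓ)) x ^ ((j : ℝ) / β)) := by
  by_cases h : 0 < β ∧ β < ℓ + 1 ∧ 1 ≤ j
  · obtain ⟨hβ, hβ', hj⟩ := h
    obtain ⟨C, hC, h1⟩ := p.exists_norm_iteratedFDeriv_compExpand_le (coordSets m ℓ) j hj
    obtain ⟨D, hD, h2⟩ := p.exists_compFreq_rpow_mul_le (d := ℓ + 1) (by exact_mod_cast hβ')
      (coordSets m ℓ) fun J hJ => mem_coordSets.1 hJ
    have hDp : 0 < D := by linarith
    refine ⟨(C + 1) * D ^ ((j : ℝ) / β), by positivity, fun _ _ _ L τ x hL hτ hτ' hx => ?_⟩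
    have h2' := h2 L τ x hL hτ hτ' hx
    push_cast at h2'
    rw [Real.rpow_neg hτ.le, ← div_eq_mul_inv, div_le_iff₀ (by positivity)] at h2'
    have h3 := pow_le_of_rpow_le (zero_le_one.trans (p.one_le_compFreq hτ _ x)) hβ h2' j
    rw [Real.mul_rpow (mul_nonneg hDp.le (jac_nonneg _ _)) (by positivity),
      Real.mul_rpow hDp.le (jac_nonneg _ _), ← Real.rpow_mul hτ.le] at h3
    have h4 := p.one_le_compFreq (L := L) hτ (coordSets m ℓ) x
    have h5 : (↑ℓ + 1 - β) * (↑j / β) = (j : ℝ) * ((ℓ + 1) / β - 1) := by field_simp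
    rw [h5] at h3
    calc _ ≤ C * p.compFreq L τ (coordSets m ℓ) x ^ j := h1 L τ x hL hτ
      _ ≤ (C + 1) * (D ^ ((j : ℝ) / β) * jac (p.compExpand L τ (coordSets m ℓ)) x ^ ((j : ℝ) / β) *
          τ ^ ((j : ℝ) * ((ℓ + 1) / β - 1))) :=
          mul_le_mul (by linarith) h3 (by positivity) (by positivity)
      _ = _ := by ring
  · exact ⟨1, one_pos, fun h1 h2 h3 => absurd ⟨h1, h2, h3⟩ h⟩

end Cutoff

/-- The constants do not depend on `ℓ`, because `ℓ` takes finitely many values. -/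
theorem exists_isShrinking (m : ℕ) : ∃ K K' : ℝ → ℕ → ℝ, (∀ β j, 0 < K β j) ∧ (∀ β j, 0 < K' β j) ∧
    ∀ (ℓ : ℕ) (a : Euc m) (η μ τ : ℝ), ℓ < m → 0 < η → 0 < μ → μ < 1 / 2 → 0 < τ → τ < 1 / 2 →
      ∃ Φ, IsShrinking K K' ℓ a η (μ * η) τ Φ := by
  obtain ⟨p⟩ := nonempty_cutoff m
  choose C hC hC1 using p.exists_le_jac_compExpand
  choose C' hC' hC1' using p.exists_le_jac_compExpand_of_mem
  have hle : ∀ (f : ℕ → ℝ), (∀ ℓ, 0 < f ℓ) → ∀ ℓ < m, f ℓ ≤ ∑ i ∈ Finset.range m, f i + 1 :=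
    fun f hf ℓ hℓ => (Finset.single_le_sum (fun i _ => (hf i).le) (Finset.mem_range.2 hℓ)).trans
      (by linarith)
  refine ⟨fun β j => ∑ ℓ ∈ Finset.range m, C ℓ β j + 1, fun β j => ∑ ℓ ∈ Finset.range m, C' ℓ β j + 1,
    fun β j => ?_, fun β j => ?_, fun ℓ a η μ τ hℓ hη hμ hμ' hτ hτ' => ?_⟩
  · exact add_pos_of_nonneg_of_pos (Finset.sum_nonneg fun i _ => (hC i β j).le) one_pos
  · exact add_pos_of_nonneg_of_pos (Finset.sum_nonneg fun i _ => (hC' i β j).le) one_pos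
  have hρ : 0 < μ * η := mul_pos hμ hη
  set ρ := μ * η with hρdef
  set L := η / ρ with hLdef
  have hL : 2 < L := by
    rw [hLdef, lt_div_iff₀ hρ, hρdef]
    nlinarith
  have hLρ : L * ρ = η := div_mul_cancel₀ _ hρ.ne'
  set Ψ := p.compExpand L τ (coordSets m ℓ) with hΨdef
  have hΨ : ContDiff ℝ ∞ Ψ := p.contDiff_compExpand hL hτ _
  have hdiv : ∀ (t : ℝ) (k : ℤ) (r : ℝ), |t - 2 * η * k| ≤ r * ρ ↔ |ρ⁻¹ * t - 2 * L * k| ≤ r := by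
    intro t k r
    have e : t - 2 * η * k = (ρ⁻¹ * t - 2 * L * k) * ρ := by
      rw [← hLρ]
      field_simp
    rw [e, abs_mul, abs_of_pos hρ, mul_le_mul_iff_left₀ hρ]
  have hy : ∀ x s, (ρ⁻¹ • (x - a)) s = ρ⁻¹ * (x s - a s) := fun x s => rfl
  have hΦ : ∀ x s, ρ⁻¹ * (rescale a ρ Ψ x s - a s) = Ψ (ρ⁻¹ • (x - a)) s := fun x s => by
    simp [rescale, hρ.ne']
  have hmem : ∀ x, rescale a ρ Ψ x ∈ latticeNhd a η ℓ ρ → ∃ J ∈ coordSets m ℓ, ∃ z : Fin m → ℤ,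
      ∀ s ∈ J, |Ψ (ρ⁻¹ • (x - a)) s - 2 * L * z s| ≤ 1 := by
    rintro x ⟨J, hJ, z, h⟩
    refine ⟨J, mem_coordSets.2 hJ, z, fun s hs => ?_⟩
    rw [← hΦ, ← hdiv, one_mul]
    exact h s hs
  refine ⟨rescale a ρ Ψ, contDiff_rescale hΨ, bijective_rescale hρ (p.bijective_compExpand hL hτ _),
    ?_, fun x s k h => ?_, fun x hx => ?_, fun x hx => ?_, fun β j hβ hβ' hj x => ?_,
    fun β j hβ hβ' hj x hx => ?_⟩
  · obtain ⟨D, hD, h⟩ := p.exists_compFreq_rpow_le (β := 0) (d := ℓ + 1) (by positivity)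
      (coordSets m ℓ) fun J hJ => mem_coordSets.1 hJ
    have hDp : 0 < D := by linarith
    refine ⟨D⁻¹, inv_pos.2 hDp, fun x => ?_⟩
    have h1 := h L τ (ρ⁻¹ • (x - a)) hL hτ
    rw [jac_rescale hρ hΨ, inv_le_iff_one_le_mul₀' hDp]
    rwa [Real.rpow_zero] at h1
  · have hdivL : ∀ t : ℝ, |t - 2 * η * k| ≤ η ↔ |ρ⁻¹ * t - 2 * L * k| ≤ L := fun t => by
      have := hdiv t k L
      rwa [hLρ] at this
    rw [hdivL] at h ⊢
    rw [hΦ]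
    rw [← hy] at h
    exact p.abs_compExpand_sub_le hL hτ _ h
  · have h1 : Ψ (ρ⁻¹ • (x - a)) = ρ⁻¹ • (x - a) := by
      refine p.compExpand_eq_self hτ _ fun J hJ z => ?_
      by_contra! hc
      exact hx ⟨J, mem_coordSets.1 hJ, z, fun s hs => (hdiv _ _ _).2 (hc s hs)⟩
    rw [rescale, h1, smul_smul, mul_inv_cancel₀ hρ.ne', one_smul, add_sub_cancel]
  · obtain ⟨J, hJ, z, h⟩ := hmem x hx
    exact ⟨J, mem_coordSets.1 hJ, z, fun s hs =>
      (hdiv _ _ _).2 (p.abs_sub_le_tau_of_mem hL hτ hτ' _ hJ h s hs)⟩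
  · refine (norm_iteratedFDeriv_rescale_le hρ hΨ x hj).trans ?_
    rw [jac_rescale hρ hΨ]
    refine (hC1 ℓ β j hβ hβ' hj L τ _ hL hτ).trans ?_
    exact mul_le_mul_of_nonneg_right (hle (fun i => C i β j) (fun i => hC i β j) ℓ hℓ)
      (Real.rpow_nonneg (jac_nonneg _ _) _)
  · refine (norm_iteratedFDeriv_rescale_le hρ hΨ x hj).trans ?_
    rw [jac_rescale hρ hΨ]
    refine (hC1' ℓ β j hβ hβ' hj L τ _ hL hτ hτ' (hmem x hx)).trans ?_
    rw [mul_assoc, mul_assoc]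
    exact mul_le_mul_of_nonneg_right (hle (fun i => C' i β j) (fun i => hC' i β j) ℓ hℓ)
      (mul_nonneg (Real.rpow_nonneg hτ.le _) (Real.rpow_nonneg (jac_nonneg _ _) _))

/-! ### Cubications are lattices of cubes -/

section Lattice

variable {m : ℕ} {η : ℝ} {S : Set (Set (Euc m))}

theorem cube_injective (hη : 0 ≤ η) {a b : Euc m} (h : cube a η = cube b η) : a = b := by
  have key : ∀ a b : Euc m, cube a η = cube b η → ∀ s, a s ≤ b s := fun a b h s => by
    have h1 : a + EuclideanSpace.single s η ∈ cube b η := by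
      rw [← h]
      intro t
      by_cases ht : t = s <;> simp [ht, abs_of_nonneg hη, hη]
    have h2 := (abs_le.1 (h1 s)).2
    simp at h2
    linarith
  ext s
  exact le_antisymm (key a b h s) (key b a h.symm s)

/-- The centers of two cubes of a cubication that meet differ by `0` or `± 2 * η` in each
coordinate. -/
theorem IsCubication.center_eq_or (hS : IsCubication η S univ) (hη : 0 < η) {a b : Euc m}
    (ha : cube a η ∈ S) (hb : cube b η ∈ S) (h : ∀ s, |a s - b s| ≤ 2 * η) (s : Fin m) :
    b s = a s ∨ b s = a s + 2 * η ∨ b s = a s - 2 * η := by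
  have hne : (cube a η ∩ cube b η).Nonempty := by
    refine ⟨(2 : ℝ)⁻¹ • (a + b), fun s => ?_, fun s => ?_⟩
    · have h1 : ((2 : ℝ)⁻¹ • (a + b)) s - a s = -(2⁻¹ * (a s - b s)) := by
        simp
        ring
      rw [h1, abs_neg, abs_mul, abs_of_pos (by norm_num : (0 : ℝ) < 2⁻¹)]
      linarith [h s]
    · have h1 : ((2 : ℝ)⁻¹ • (a + b)) s - b s = 2⁻¹ * (a s - b s) := by
        simp
        ring
      rw [h1, abs_mul, abs_of_pos (by norm_num : (0 : ℝ) < 2⁻¹)]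
      linarith [h s]
  obtain ⟨i, h1, h2⟩ := hS.2.2 _ ha _ hb hne
  -- if the coordinate `s` is free on the common face, then the cubes have the same extent in it
  have key : ∀ c c' : Euc m, (∃ (J : Finset (Fin m)) (ε : Fin m → ℝ), s ∈ J ∧
      (∀ s, ε s = 1 ∨ ε s = -1) ∧ cube a η ∩ cube b η =
        {x | (∀ s ∈ J, |x s - c s| ≤ η) ∧ ∀ s ∉ J, x s = c s + ε s * η}) →
      cube a η ∩ cube b η ⊆ cube c' η → c' s = c s := by
    rintro c c' ⟨J, ε, hs, -, hF⟩ hsub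
    have h3 : ∀ σ : ℝ, |σ| ≤ 1 → |c s + σ * η - c' s| ≤ η := fun σ hσ => by
      have h4 : (WithLp.toLp 2 fun t => if t = s then c t + σ * η else
          if t ∈ J then c t else c t + ε t * η : Euc m) ∈ cube c' η := by
        refine hsub (hF ▸ ⟨fun t ht => ?_, fun t ht => ?_⟩)
        · by_cases hts : t = s
          · simpa [hts, abs_mul, abs_of_pos hη] using mul_le_of_le_one_left hη.le hσ
          · simp [hts, ht, hη.le]
        · have hts : t ≠ s := fun h => ht (h ▸ hs)
          simp [hts, ht]
      simpa using h4 s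
    have h5 := abs_le.1 (h3 1 (by simp))
    have h6 := abs_le.1 (h3 (-1) (by simp))
    linarith
  obtain ⟨a', ha', J, ε, -, hε, hF⟩ := h1
  obtain ⟨b', hb', J', ε', -, hε', hF'⟩ := h2
  obtain rfl := cube_injective hη.le ha'
  obtain rfl := cube_injective hη.le hb'
  by_cases hs : s ∈ J
  · exact Or.inl (key _ _ ⟨J, ε, hs, hε, hF⟩ inter_subset_right)
  by_cases hs' : s ∈ J'
  · exact Or.inl (key _ _ ⟨J', ε', hs', hε', hF'⟩ inter_subset_left).symm
  obtain ⟨x, hx⟩ := hne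
  have e1 := (hF ▸ hx).2 s hs
  have e2 := (hF' ▸ hx).2 s hs'
  rcases hε s with h3 | h3 <;> rcases hε' s with h4 | h4 <;> rw [h3] at e1 <;> rw [h4] at e2
  · left; linarith
  · right; left; linarith
  · right; right; linarith
  · left; linarith

theorem IsCubication.exists_center (hS : IsCubication η S univ) (x : Euc m) :
    ∃ a, cube a η ∈ S ∧ ∀ s, |x s - a s| ≤ η := by
  obtain ⟨σ, hσ, hx⟩ := mem_sUnion.1 (hS.2.1 ▸ mem_univ x)
  obtain ⟨a, rfl⟩ := hS.1 σ hσ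
  exact ⟨a, hσ, hx⟩

/-- The reflection of a cube of a cubication in one of its faces belongs to the cubication. -/
theorem IsCubication.cube_add_single (hS : IsCubication η S univ) (hη : 0 < η) {a : Euc m}
    (ha : cube a η ∈ S) (s : Fin m) {σ : ℝ} (hσ : σ = 1 ∨ σ = -1) :
    cube (a + EuclideanSpace.single s (2 * η * σ)) η ∈ S := by
  have hσ2 : σ * σ = 1 := by rcases hσ with rfl | rfl <;> norm_num
  have hσabs : |σ| = 1 := by rcases hσ with rfl | rfl <;> norm_num
  -- a cube that contains a point beyond the face of `cube a η` in the direction `σ * e_s`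
  have hcov : ∀ δ, ∃ b, cube b η ∈ S ∧ (∀ t ≠ s, |a t - b t| ≤ η) ∧
      δ ≤ σ * (b s - a s) ∧ σ * (b s - a s) ≤ 2 * η + δ := fun δ => by
    obtain ⟨b, hb, h⟩ := hS.exists_center (a + EuclideanSpace.single s (σ * (η + δ)))
    refine ⟨b, hb, fun t ht => by simpa [ht] using h t, ?_⟩
    have h1 := h s
    have h2 : (a + EuclideanSpace.single s (σ * (η + δ))) s - b s =
        σ * (η + δ - σ * (b s - a s)) := by
      simp only [PiLp.add_apply, PiLp.single_apply, if_true]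
      linear_combination (b s - a s) * hσ2
    rw [h2, abs_mul, hσabs, one_mul, abs_le] at h1
    constructor <;> linarith [h1.1, h1.2]
  -- such a cube is the neighbor of `cube a η` as soon as it meets `cube a η`
  have hfin : ∀ b, cube b η ∈ S → (∀ t ≠ s, |a t - b t| ≤ η) → 0 < σ * (b s - a s) →
      σ * (b s - a s) ≤ 2 * η → cube (a + EuclideanSpace.single s (2 * η * σ)) η ∈ S := by
    intro b hb ht h0 h1
    have habs : ∀ t, |a t - b t| ≤ 2 * η := fun t => by
      by_cases hts : t = s
      · have : |σ * (b t - a t)| ≤ 2 * η := by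
          rw [hts, abs_of_pos h0]
          exact h1
        rwa [abs_mul, hσabs, one_mul, abs_sub_comm] at this
      · linarith [ht t hts]
    have hor := hS.center_eq_or hη ha hb habs
    have hbe : b = a + EuclideanSpace.single s (2 * η * σ) := by
      ext t
      by_cases hts : t = s
      · subst hts
        simp only [PiLp.add_apply, PiLp.single_apply, if_true]
        rcases hor t with h | h | h <;> rw [h] at h0 <;> rcases hσ with rfl | rfl <;>
          linarith
      · simp only [PiLp.add_apply, PiLp.single_apply, if_neg hts, add_zero]
        have h2 := abs_le.1 (ht t hts)
        rcases hor t with h | h | h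
        · exact h
        · linarith
        · linarith
    rwa [← hbe]
  obtain ⟨b, hb, hbt, h1, h2⟩ := hcov η
  by_cases h3 : σ * (b s - a s) ≤ 2 * η
  · exact hfin b hb hbt (by linarith) h3
  push Not at h3
  obtain ⟨b', hb', hbt', h1', h2'⟩ := hcov ((σ * (b s - a s) - 2 * η) / 2)
  by_cases h4 : σ * (b' s - a s) ≤ 2 * η
  · exact hfin b' hb' hbt' (by linarith) h4
  push Not at h4
  -- otherwise two cubes that do not meet `cube a η` overlap without being equal
  exfalso
  have hdiff : σ * (b s - b' s) = σ * (b s - a s) - σ * (b' s - a s) := by ring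
  have habs : ∀ t, |b t - b' t| ≤ 2 * η := fun t => by
    by_cases hts : t = s
    · have : |σ * (b t - b' t)| ≤ 2 * η := by
        rw [hts, hdiff, abs_of_pos (by linarith)]
        linarith
      rwa [abs_mul, hσabs, one_mul] at this
    · have e1 := abs_le.1 (hbt t hts)
      have e2 := abs_le.1 (hbt' t hts)
      rw [abs_le]
      constructor <;> linarith
  rcases hS.center_eq_or hη hb hb' habs s with h | h | h <;> rw [h] at hdiff <;>
    rcases hσ with rfl | rfl <;> linarith

theorem IsCubication.cube_add_single_int (hS : IsCubication η S univ) (hη : 0 < η) {a : Euc m}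
    (ha : cube a η ∈ S) (s : Fin m) (k : ℤ) :
    cube (a + EuclideanSpace.single s (2 * η * k)) η ∈ S := by
  induction k using Int.induction_on with
  | zero =>
    have h0 : a + EuclideanSpace.single s (2 * η * ((0 : ℤ) : ℝ)) = a := by
      ext t
      simp
    rwa [h0]
  | succ k ih =>
    have h := hS.cube_add_single hη ih s (Or.inl rfl)
    convert h using 2
    ext t
    by_cases ht : t = s
    · simp [ht]
      ring
    · simp [ht]
  | pred k ih =>
    have h := hS.cube_add_single hη ih s (Or.inr rfl)
    convert h using 2
    ext t
    by_cases ht : t = s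
    · simp [ht]
      ring
    · simp [ht]

/-- The cubes of a cubication of `ℝ^m` are the cubes whose centers form a lattice. -/
theorem IsCubication.exists_lattice (hS : IsCubication η S univ) (hη : 0 < η) :
    ∃ a : Euc m, ∀ c, cube c η ∈ S ↔ ∃ z : Fin m → ℤ, ∀ s, c s = a s + 2 * η * z s := by
  obtain ⟨a, ha, -⟩ := hS.exists_center 0
  have hmem : ∀ z : Fin m → ℤ, cube (WithLp.toLp 2 fun s => a s + 2 * η * z s) η ∈ S := by
    intro z
    have h1 : ∀ t : Finset (Fin m),
        cube (a + ∑ s ∈ t, EuclideanSpace.single s (2 * η * (z s : ℝ))) η ∈ S := by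
      intro t
      induction t using Finset.induction_on with
      | empty => simpa using ha
      | insert s t hs ih =>
        rw [Finset.sum_insert hs, add_comm (EuclideanSpace.single s _), ← add_assoc]
        exact hS.cube_add_single_int hη ih s (z s)
    convert h1 Finset.univ using 2
    ext s
    simp [Finset.sum_apply, Pi.single_apply]
  refine ⟨a, fun c => ⟨fun hc => ?_, ?_⟩⟩
  · refine ⟨fun s => round ((c s - a s) / (2 * η)), fun s => ?_⟩
    have hnear : ∀ s, |(a s + 2 * η * round ((c s - a s) / (2 * η))) - c s| ≤ η := fun s => by
      have := abs_sub_nearest_le_half hη (c - a) s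
      rw [nearest_apply, PiLp.sub_apply, abs_sub_comm] at this
      convert this using 2
      ring
    rcases hS.center_eq_or hη (hmem fun s => round ((c s - a s) / (2 * η))) hc
      (fun s => (hnear s).trans (by linarith)) s with h | h | h
    · exact h
    · have := abs_le.1 (hnear s)
      simp only at h
      linarith
    · have := abs_le.1 (hnear s)
      simp only at h
      linarith
  · rintro ⟨z, hz⟩
    have : c = WithLp.toLp 2 fun s => a s + 2 * η * z s := by
      ext s
      exact hz s
    rw [this]
    exact hmem z

variable {a : Euc m} {ℓ : ℕ} {r : ℝ}

/-- The neighborhoods of the dual skeleton are the neighborhoods `latticeNhd` of the planes on which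
`ℓ + 1` coordinates agree with those of a center of the cubication. -/
theorem dualNhd_eq_latticeNhd (hη : 0 < η) (hℓ : ℓ < m)
    (ha : ∀ c, cube c η ∈ S ↔ ∃ z : Fin m → ℤ, ∀ s, c s = a s + 2 * η * z s) (hr : 0 ≤ r) :
    dualNhd η ℓ S r = latticeNhd a η ℓ r := by
  ext x
  constructor
  · rintro ⟨y, ⟨F, ⟨σ', ⟨σ, hσ, b, rfl, J, ε, hJ, hε, hF⟩, a', v, ha', hv, rfl⟩, w, hw, hwy⟩, q, hq, rfl⟩
    obtain ⟨a'', haa, J₀, ε', hJ₀, hε', hv'⟩ := hv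
    obtain rfl := cube_injective hη.le haa
    rw [Finset.card_eq_zero] at hJ₀
    subst hJ₀
    have hv1 : v ∈ ({v} : Set (Euc m)) := rfl
    rw [hv'] at hv1
    rw [hF] at hw
    obtain ⟨z, hz⟩ := (ha b).1 hσ
    refine ⟨Jᶜ, ?_, ?_⟩
    · rw [Finset.card_compl, hJ, Fintype.card_fin]
      omega
    · have hk : ∀ s, ∃ k : ℤ, ε s + ε' s = 2 * k := fun s => by
        rcases hε s with h1 | h1 <;> rcases hε' s with h2 | h2 <;> rw [h1, h2]
        exacts [⟨1, by norm_num⟩, ⟨0, by norm_num⟩, ⟨0, by norm_num⟩, ⟨-1, by norm_num⟩]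
      choose k hk using hk
      refine ⟨fun s => z s + k s, fun s hs => ?_⟩
      have h1 := hw.2 s (Finset.mem_compl.1 hs)
      have h2 := hv1.2 s (by simp)
      have h3 := hq s
      have h4 : (y + q) s - a s - 2 * η * ((z s + k s : ℤ) : ℝ) = q s - (0 : Euc m) s := by
        rw [← hwy]
        simp only [PiLp.add_apply, PiLp.sub_apply, PiLp.zero_apply]
        push_cast
        rw [h1, h2, hz s]
        linear_combination η * hk s
      rw [← h4] at h3
      exact h3
  · rintro ⟨J, hJ, z, hz⟩
    -- the vertex of the cube of center `a` in the direction `(1, …, 1)`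
    set u : Euc m := WithLp.toLp 2 fun _ => η with hu
    set y : Euc m := WithLp.toLp 2 fun s => if s ∈ J then a s + 2 * η * z s else x s with hy
    set k : Fin m → ℤ := fun s => if s ∈ J then z s else round ((x s - η - a s) / (2 * η)) with hk
    set b : Euc m := WithLp.toLp 2 fun s => a s + 2 * η * k s with hb
    refine ⟨y, ⟨(fun y => y + ((a + u) - a)) '' {w | (∀ s ∈ Jᶜ, |w s - b s| ≤ η) ∧
      ∀ s ∉ Jᶜ, w s = b s + (-1) * η}, ⟨_, ⟨cube b η, (ha b).2 ⟨k, fun s => rfl⟩, b, rfl, Jᶜ,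
      fun _ => -1, ?_, fun _ => Or.inr rfl, rfl⟩, a, a + u, (ha a).2 ⟨0, by simp⟩,
      ⟨a, rfl, ∅, fun _ => 1, rfl, fun _ => Or.inl rfl, ?_⟩, rfl⟩, ?_⟩, x - y, ?_, by simp⟩
    · rw [Finset.card_compl, hJ, Fintype.card_fin]
      omega
    · ext w
      simp only [mem_singleton_iff, Finset.notMem_empty, false_imp_iff, implies_true, true_and,
        not_false_eq_true, forall_true_left, mem_ofPred_eq, one_mul]
      exact ⟨fun h s => by rw [h]; rfl, fun h => by ext s; rw [h s]; rfl⟩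
    · refine ⟨y - u, ⟨fun s hs => ?_, fun s hs => ?_⟩, by simp⟩
      · have hs' := Finset.mem_compl.1 hs
        have h1 := abs_sub_nearest_le_half hη (x - u - a) s
        rw [nearest_apply] at h1
        simp only [PiLp.sub_apply, hy, hb, hk, hu, if_neg hs'] at h1 ⊢
        convert h1 using 2
        ring
      · have hs' : s ∈ J := by simpa using hs
        simp only [PiLp.sub_apply, hy, hb, hk, hu, if_pos hs']
        ring
    · intro s
      by_cases hs : s ∈ J
      · have h1 := hz s hs
        simp only [PiLp.sub_apply, hy, if_pos hs, PiLp.zero_apply, sub_zero]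
        rwa [← sub_sub]
      · simp [hy, hs, hr]

theorem isClosed_exists_abs_sub_le (hη : 0 < η) (r : ℝ) :
    IsClosed {t : ℝ | ∃ k : ℤ, |t - 2 * η * k| ≤ r} := by
  have h : {t : ℝ | ∃ k : ℤ, |t - 2 * η * k| ≤ r} =
      {t : ℝ | ‖(t : AddCircle (2 * η))‖ ≤ r} := by
    ext t
    simp only [mem_ofPred_eq, AddCircle.norm_eq]
    constructor
    · rintro ⟨k, hk⟩
      refine le_trans ?_ hk
      have h1 := abs_sub_nearest_le hη (WithLp.toLp 2 fun _ : Fin 1 => t : Euc 1) 0 k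
      rw [← div_eq_inv_mul, mul_comm _ (2 * η)]
      exact h1
    · intro h
      exact ⟨round ((2 * η)⁻¹ * t), by rwa [mul_comm (2 * η)]⟩
  rw [h]
  exact isClosed_le (AddCircle.continuous_mk' _).norm continuous_const

theorem isClosed_latticeNhd (hη : 0 < η) : IsClosed (latticeNhd a η ℓ r) := by
  have h : latticeNhd a η ℓ r = ⋃ J ∈ {J : Finset (Fin m) | J.card = ℓ + 1}, ⋂ s ∈ J,
      (fun x : Euc m => x s - a s) ⁻¹' {t : ℝ | ∃ k : ℤ, |t - 2 * η * k| ≤ r} := by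
    ext x
    simp only [latticeNhd, mem_ofPred_eq, mem_iUnion, mem_iInter, mem_preimage, exists_prop]
    refine exists_congr fun J => and_congr_right fun _ => ?_
    constructor
    · rintro ⟨z, hz⟩ s hs
      exact ⟨z s, hz s hs⟩
    · intro h
      choose! z hz using h
      exact ⟨z, hz⟩
  rw [h]
  refine (Set.toFinite _).isClosed_biUnion fun J _ => isClosed_biInter fun s _ => ?_
  exact (isClosed_exists_abs_sub_le hη r).preimage (by fun_prop)

theorem volume_coord_eq_zero (s : Fin m) (c : ℝ) : volume {x : Euc m | x s = c} = 0 := by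
  have h := (PiLp.volume_preserving_ofLp (Fin m)).measure_preimage
    (s := {y : Fin m → ℝ | y s = c}) (measurableSet_eq_fun (by fun_prop) (by fun_prop)).nullMeasurableSet
  rw [volume_pi, Measure.pi_hyperplane] at h
  exact h

/-- The union of some of the cubes of a cubication, intersected with a neighborhood `latticeNhd`, has
a negligible boundary, because the boundary lies in countably many hyperplanes. -/
theorem volume_diff_interior_eq_zero
    (ha : ∀ c, cube c η ∈ S ↔ ∃ z : Fin m → ℤ, ∀ s, c s = a s + 2 * η * z s)
    (hS : ∀ σ ∈ S, ∃ c, σ = cube c η) {K : Set (Set (Euc m))} (hK : K ⊆ S) :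
    volume ((⋃₀ K ∩ latticeNhd a η ℓ r) \ interior (⋃₀ K ∩ latticeNhd a η ℓ r)) = 0 := by
  set H : Set (Euc m) := ⋃ (s : Fin m) (k : ℤ), ({x | x s = a s + 2 * η * k + η} ∪
    {x | x s = a s + 2 * η * k - η} ∪ {x | x s = a s + 2 * η * k + r} ∪
    {x | x s = a s + 2 * η * k - r}) with hH
  have hnull : volume H = 0 := by
    refine measure_iUnion_null fun s => measure_iUnion_null fun k => ?_
    simp only [measure_union_null_iff, volume_coord_eq_zero, and_self]
  refine measure_mono_null ?_ hnull
  rintro x ⟨⟨⟨σ, hσ, hx⟩, J, hJ, z, hz⟩, hxi⟩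
  by_contra hxH
  apply hxi
  obtain ⟨c, rfl⟩ := hS σ (hK hσ)
  obtain ⟨w, hw⟩ := (ha c).1 (hK hσ)
  have hxH' : ∀ (s : Fin m) (k : ℤ), x s ≠ a s + 2 * η * k + η ∧ x s ≠ a s + 2 * η * k - η ∧
      x s ≠ a s + 2 * η * k + r ∧ x s ≠ a s + 2 * η * k - r := fun s k => by
    simp only [hH, mem_iUnion, mem_union, mem_ofPred_eq, not_exists, not_or] at hxH
    obtain ⟨⟨⟨h1, h2⟩, h3⟩, h4⟩ := hxH s k
    exact ⟨h1, h2, h3, h4⟩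
  have hlt : ∀ t r : ℝ, |t| ≤ r → t ≠ r → t ≠ -r → |t| < r := fun t r h1 h2 h3 => by
    rw [abs_le] at h1
    exact abs_lt.2 ⟨lt_of_le_of_ne h1.1 (Ne.symm h3), lt_of_le_of_ne h1.2 h2⟩
  have h1 : ∀ s, |x s - c s| < η := fun s => by
    refine hlt _ _ (hx s) (fun h => (hxH' s (w s)).1 ?_) fun h => (hxH' s (w s)).2.1 ?_
    · rw [← hw s]; linarith
    · rw [← hw s]; linarith
  have h2 : ∀ s ∈ J, |x s - a s - 2 * η * z s| < r := fun s hs => by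
    refine hlt _ _ (hz s hs) (fun h => (hxH' s (z s)).2.2.1 ?_) fun h => (hxH' s (z s)).2.2.2 ?_
    · linarith
    · linarith
  rw [mem_interior_iff_mem_nhds]
  have e1 : ∀ᶠ y : Euc m in nhds x, ∀ s, |y s - c s| < η := Filter.eventually_all.2 fun s => by
    have hc : Continuous fun y : Euc m => |y s - c s| := by fun_prop
    exact hc.continuousAt.eventually (gt_mem_nhds (h1 s))
  have e2 : ∀ᶠ y : Euc m in nhds x, ∀ s ∈ J, |y s - a s - 2 * η * z s| < r :=
    (Filter.eventually_all_finset J).2 fun s hs => by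
      have hc : Continuous fun y : Euc m => |y s - a s - 2 * η * z s| := by fun_prop
      exact hc.continuousAt.eventually (gt_mem_nhds (h2 s hs))
  filter_upwards [e1, e2] with y hy1 hy2
  exact ⟨⟨_, hσ, fun s => (hy1 s).le⟩, J, hJ, z, fun s hs => (hy2 s hs).le⟩

end Lattice

/-! ### Integration by parts -/

section IntegrationByParts

variable {E F : Type*} [NormedAddCommGroup E] [NormedSpace ℝ E]
  [NormedAddCommGroup F] [NormedSpace ℝ F]

theorem contDiff_iteratedFDeriv_apply {f : E → F} (hf : ContDiff ℝ ∞ f) (n : ℕ) (v : Fin n → E) :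
    ContDiff ℝ ∞ fun x => iteratedFDeriv ℝ n f x v :=
  (ContinuousMultilinearMap.apply ℝ (fun _ : Fin n => E) F v).contDiff.comp
    (hf.iteratedFDeriv_right (m := ∞) (mod_cast le_top))

theorem iteratedFDeriv_succ_apply_eq_fderiv {f : E → F} (hf : ContDiff ℝ ∞ f) (n : ℕ)
    (v : Fin (n + 1) → E) (x : E) : iteratedFDeriv ℝ (n + 1) f x v =
      fderiv ℝ (fun y => iteratedFDeriv ℝ n f y (Fin.tail v)) x (v 0) := by
  rw [fderiv_continuousMultilinear_apply_const_apply, iteratedFDeriv_succ_apply_left]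
  exact (hf.iteratedFDeriv_right (m := ∞) (i := n) (mod_cast le_top)).differentiable (by simp) x

theorem contDiff_fderiv_apply {f : E → F} (hf : ContDiff ℝ ∞ f) (w : E) :
    ContDiff ℝ ∞ fun x => fderiv ℝ f x w :=
  (hf.fderiv_right (m := ∞) (by simp)).clm_apply contDiff_const

theorem fderiv_fderiv_apply_comm {f : E → F} (hf : ContDiff ℝ ∞ f) (x v w : E) :
    fderiv ℝ (fun y => fderiv ℝ f y v) x w = fderiv ℝ (fun y => fderiv ℝ f y w) x v := by
  have h1 : DifferentiableAt ℝ (fderiv ℝ f) x :=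
    (hf.fderiv_right (m := ∞) (by simp)).differentiable (by simp) x
  rw [fderiv_clm_apply h1 (differentiableAt_const v), fderiv_clm_apply h1 (differentiableAt_const w)]
  simpa using hf.contDiffAt.isSymmSndFDerivAt (x := x) (by simpa using ENat.LEInfty.out) w v

/-- The derivative in one direction commutes with the iterated derivative, by the symmetry of second
derivatives. -/
theorem iteratedFDeriv_fderiv_apply {f : E → F} (hf : ContDiff ℝ ∞ f) (n : ℕ) (w : E)
    (v : Fin n → E) (x : E) : iteratedFDeriv ℝ n (fun y => fderiv ℝ f y w) x v =
      fderiv ℝ (fun y => iteratedFDeriv ℝ n f y v) x w := by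
  induction n generalizing x with
  | zero => simp
  | succ n ih =>
    rw [iteratedFDeriv_succ_apply_eq_fderiv (contDiff_fderiv_apply hf w)]
    simp_rw [ih, iteratedFDeriv_succ_apply_eq_fderiv hf]
    exact fderiv_fderiv_apply_comm (contDiff_iteratedFDeriv_apply hf n _) x w (v 0)

theorem hasCompactSupport_iteratedFDeriv_apply {f : E → F} (hf : HasCompactSupport f) (n : ℕ)
    (v : Fin n → E) : HasCompactSupport fun x => iteratedFDeriv ℝ n f x v :=
  (hf.iteratedFDeriv (𝕜 := ℝ) n).comp_left
    (g := fun A : ContinuousMultilinearMap ℝ (fun _ : Fin n => E) F => A v) rfl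

variable [FiniteDimensional ℝ E] [MeasurableSpace E] [BorelSpace E] (μ : Measure E)
  [μ.IsAddHaarMeasure]

theorem integral_iteratedFDeriv_apply_mul {φ f : E → ℝ} (hφ : ContDiff ℝ ∞ φ)
    (hφ' : HasCompactSupport φ) (hf : ContDiff ℝ ∞ f) (n : ℕ) (v : Fin n → E) :
    ∫ x, iteratedFDeriv ℝ n φ x v * f x ∂μ =
      (-1) ^ n * ∫ x, φ x * iteratedFDeriv ℝ n f x v ∂μ := by
  induction n generalizing f with
  | zero => simp
  | succ n ih =>
    have h1 := contDiff_iteratedFDeriv_apply hφ n (Fin.tail v)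
    have h2 := hasCompactSupport_iteratedFDeriv_apply hφ' n (Fin.tail v)
    have h3 := contDiff_fderiv_apply hf (v 0)
    have h4 := contDiff_fderiv_apply h1 (v 0)
    have h5 : HasCompactSupport fun x =>
        fderiv ℝ (fun y => iteratedFDeriv ℝ n φ y (Fin.tail v)) x (v 0) :=
      h2.fderiv_apply (𝕜 := ℝ) (v 0)
    have key := integral_mul_fderiv_eq_neg_fderiv_mul_of_integrable (μ := μ) (v := v 0)
      ((h4.continuous.mul hf.continuous).integrable_of_hasCompactSupport h5.mul_right)
      ((h1.continuous.mul h3.continuous).integrable_of_hasCompactSupport h2.mul_right)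
      ((h1.continuous.mul hf.continuous).integrable_of_hasCompactSupport h2.mul_right)
      (fun x _ => h1.differentiable (by simp) x) (fun x _ => hf.differentiable (by simp) x)
    simp_rw [iteratedFDeriv_succ_apply_eq_fderiv hφ, iteratedFDeriv_succ_apply_eq_fderiv hf]
    rw [← neg_eq_iff_eq_neg.2 key, ih h3]
    simp_rw [iteratedFDeriv_fderiv_apply hf]
    ring

end IntegrationByParts

/-! ### Weak derivatives -/

section WeakDeriv

variable {m ν : ℕ} {Ω : Set (Euc m)}

/-- A test function on `Ω`. -/
structure IsTest (Ω : Set (Euc m)) (φ : Euc m → ℝ) : Prop where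
  contDiff : ContDiff ℝ ∞ φ
  hasCompactSupport : HasCompactSupport φ
  tsupport_subset : tsupport φ ⊆ Ω

theorem IsTest.eq_zero {φ : Euc m → ℝ} (hφ : IsTest Ω φ) {x : Euc m} (hx : x ∉ Ω) : φ x = 0 :=
  image_eq_zero_of_notMem_tsupport fun h => hx (hφ.tsupport_subset h)

theorem IsTest.iteratedFDeriv_apply {φ : Euc m → ℝ} (hφ : IsTest Ω φ) (n : ℕ) (v : Fin n → Euc m) :
    IsTest Ω fun x => iteratedFDeriv ℝ n φ x v where
  contDiff := contDiff_iteratedFDeriv_apply hφ.contDiff n v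
  hasCompactSupport := hasCompactSupport_iteratedFDeriv_apply hφ.hasCompactSupport n v
  tsupport_subset := ((tsupport_comp_subset (g := fun A : ContinuousMultilinearMap ℝ
    (fun _ : Fin n => Euc m) ℝ => A v) rfl _).trans (tsupport_iteratedFDeriv_subset n)).trans
      hφ.tsupport_subset

theorem IsTest.mul {φ ψ : Euc m → ℝ} (hφ : IsTest Ω φ) (hψ : ContDiff ℝ ∞ ψ) :
    IsTest Ω fun x => φ x * ψ x :=
  ⟨hφ.contDiff.mul hψ, hφ.hasCompactSupport.mul_right,
    (tsupport_mul_subset_left).trans hφ.tsupport_subset⟩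

theorem IsTest.const_mul {φ : Euc m → ℝ} (hφ : IsTest Ω φ) (c : ℝ) : IsTest Ω fun x => c * φ x := by
  simpa only [mul_comm] using hφ.mul (contDiff_const (c := c))

theorem IsTest.integral_smul {V : Type*} [NormedAddCommGroup V] [NormedSpace ℝ V] {φ : Euc m → ℝ}
    (hφ : IsTest Ω φ) (F : Euc m → V) : ∫ x in Ω, φ x • F x = ∫ x, φ x • F x :=
  setIntegral_eq_integral_of_forall_compl_eq_zero fun x hx => by rw [hφ.eq_zero hx, zero_smul]

theorem IsTest.integrable_smul {V : Type*} [NormedAddCommGroup V] [NormedSpace ℝ V] {φ : Euc m → ℝ}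
    (hφ : IsTest Ω φ) {F : Euc m → V} (hF : LocallyIntegrableOn F Ω volume) :
    Integrable fun x => φ x • F x := by
  have hc : IsCompact (tsupport φ) := hφ.hasCompactSupport
  have h1 := (hF.integrableOn_compact_subset hφ.tsupport_subset hc).continuousOn_smul
    hφ.contDiff.continuous.continuousOn hc
  rw [← integrableOn_iff_integrable_of_support_subset]
  · exact h1
  · exact (Function.support_smul_subset_left _ _).trans (subset_tsupport φ)

/-- The defining identity of the weak derivative, with integrals over the whole space. -/
theorem IsWeakDeriv.integral_eq {i : ℕ} {u : Euc m → Euc ν}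
    {g : Euc m → ContinuousMultilinearMap ℝ (fun _ : Fin i => Euc m) (Euc ν)}
    (h : IsWeakDeriv Ω i u g) {φ : Euc m → ℝ} (hφ : IsTest Ω φ) (v : Fin i → Euc m) :
    ∫ x, φ x • g x v = ∫ x, ((-1) ^ i * iteratedFDeriv ℝ i φ x v) • u x := by
  have h1 := h.2.2 φ hφ.contDiff hφ.hasCompactSupport hφ.tsupport_subset v
  rw [hφ.integral_smul fun x => g x v, (hφ.iteratedFDeriv_apply i v).integral_smul] at h1
  simp_rw [mul_smul]
  rw [integral_smul, h1, smul_smul, ← mul_pow]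
  simp

/-- A relation between integrals of derivatives of smooth functions extends to weak derivatives:
integration by parts turns it into a relation between integrals of the functions themselves, which,
since it holds for every smooth function, holds between the weights. -/
theorem integral_smul_eq_sum_of_forall_contDiff {ι : Type*} [Fintype ι] {n : ι → ℕ}
    {u : Euc m → Euc ν}
    {g : (c : ι) → Euc m → ContinuousMultilinearMap ℝ (fun _ : Fin (n c) => Euc m) (Euc ν)}
    (hu : LocallyIntegrableOn u Ω volume) (hg : ∀ c, IsWeakDeriv Ω (n c) u (g c))
    {ψ₀ : Euc m → ℝ} {ψ : ι → Euc m → ℝ} (hψ₀ : IsTest Ω ψ₀) (hψ : ∀ c, IsTest Ω (ψ c))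
    (w : (c : ι) → Fin (n c) → Euc m)
    (h : ∀ f : Euc m → ℝ, ContDiff ℝ ∞ f →
      ∫ x, ψ₀ x * f x = ∑ c, ∫ x, ψ c x * iteratedFDeriv ℝ (n c) f x (w c)) :
    ∫ x, ψ₀ x • u x = ∑ c, ∫ x, ψ c x • g c x (w c) := by
  have hD : ∀ c, IsTest Ω fun x => (-1) ^ n c * iteratedFDeriv ℝ (n c) (ψ c) x (w c) := fun c =>
    ((hψ c).iteratedFDeriv_apply (n c) (w c)).const_mul _
  have hsmul : ∀ {V : Type} [NormedAddCommGroup V] [NormedSpace ℝ V] (F : Euc m → V),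
      LocallyIntegrableOn F Ω volume →
      ∫ x, (ψ₀ x - ∑ c, (-1) ^ n c * iteratedFDeriv ℝ (n c) (ψ c) x (w c)) • F x =
        (∫ x, ψ₀ x • F x) -
          ∑ c, ∫ x, ((-1) ^ n c * iteratedFDeriv ℝ (n c) (ψ c) x (w c)) • F x := by
    intro V _ _ F hF
    simp_rw [sub_smul, Finset.sum_smul]
    rw [integral_sub (hψ₀.integrable_smul hF)
      (integrable_finsetSum _ fun c _ => (hD c).integrable_smul hF),
      integral_finsetSum _ fun c _ => (hD c).integrable_smul hF]
  have h0 : ∀ᵐ x, ψ₀ x - ∑ c, (-1) ^ n c * iteratedFDeriv ℝ (n c) (ψ c) x (w c) = 0 := by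
    refine ae_eq_zero_of_integral_contDiff_smul_eq_zero
      (hψ₀.contDiff.continuous.sub
        (continuous_finsetSum _ fun c _ => (hD c).contDiff.continuous)).locallyIntegrable
      fun f hf _ => ?_
    simp_rw [smul_eq_mul, mul_comm (f _)]
    refine (hsmul f (hf.continuous.locallyIntegrable.locallyIntegrableOn Ω)).trans ?_
    simp_rw [smul_eq_mul]
    rw [h f hf, sub_eq_zero]
    refine Finset.sum_congr rfl fun c _ => ?_
    simp_rw [mul_assoc]
    rw [integral_const_mul, integral_iteratedFDeriv_apply_mul _ (hψ c).contDiff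
      (hψ c).hasCompactSupport hf, ← mul_assoc, ← mul_pow]
    simp
  have h1 : ∫ x, (ψ₀ x - ∑ c, (-1) ^ n c * iteratedFDeriv ℝ (n c) (ψ c) x (w c)) • u x = 0 := by
    rw [integral_congr_ae (g := fun _ => (0 : Euc ν)), integral_zero]
    filter_upwards [h0] with x hx
    rw [hx, zero_smul]
  rw [hsmul u hu, sub_eq_zero] at h1
  rw [h1]
  exact Finset.sum_congr rfl fun c _ => ((hg c).integral_eq (hψ c) (w c)).symm

/-- Weak derivatives are unique up to null sets. -/
theorem IsWeakDeriv.ae_eq {i : ℕ} {u : Euc m → Euc ν}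
    {g h : Euc m → ContinuousMultilinearMap ℝ (fun _ : Fin i => Euc m) (Euc ν)} (hΩ : IsOpen Ω)
    (hg : IsWeakDeriv Ω i u g) (hh : IsWeakDeriv Ω i u h) : ∀ᵐ x, x ∈ Ω → g x = h x := by
  set b : Fin m → Euc m := fun s => EuclideanSpace.basisFun (Fin m) ℝ s with hb
  have key : ∀ v : Fin i → Fin m, ∀ᵐ x, x ∈ Ω → (g - h) x (fun r => b (v r)) = 0 := by
    intro v
    have hl : LocallyIntegrableOn (fun x => (g - h) x (fun r => b (v r))) Ω volume := by
      rw [locallyIntegrableOn_iff hΩ.isLocallyClosed]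
      intro k hk hk'
      exact (ContinuousMultilinearMap.apply ℝ (fun _ : Fin i => Euc m) (Euc ν)
        fun r => b (v r)).integrable_comp ((hg.2.1.sub hh.2.1).integrableOn_compact_subset hk hk')
    refine hΩ.ae_eq_zero_of_integral_contDiff_smul_eq_zero hl fun φ h1 h2 h3 => ?_
    have hφ : IsTest Ω φ := ⟨h1, h2, h3⟩
    have e : ∀ x, φ x • (g - h) x (fun r => b (v r)) =
        (φ x • g x fun r => b (v r)) - φ x • h x fun r => b (v r) := fun x => smul_sub _ _ _
    have hi : ∀ q, LocallyIntegrableOn q Ω volume →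
        Integrable fun x => φ x • (q x : ContinuousMultilinearMap ℝ (fun _ : Fin i => Euc m) (Euc ν))
          fun r => b (v r) := fun q hq =>
      (ContinuousMultilinearMap.apply ℝ (fun _ : Fin i => Euc m) (Euc ν)
        fun r => b (v r)).integrable_comp (hφ.integrable_smul hq)
    simp_rw [e]
    rw [integral_sub (hi g hg.2.1) (hi h hh.2.1), hg.integral_eq hφ, hh.integral_eq hφ, sub_self]
  filter_upwards [ae_all_iff.2 key] with x hx hxΩ
  refine ContinuousMultilinearMap.toMultilinearMap_injective
    (Module.Basis.ext_multilinear (fun _ => (EuclideanSpace.basisFun (Fin m) ℝ).toBasis) fun v => ?_)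
  have := hx v hxΩ
  simpa [sub_eq_zero, hb] using this

end WeakDeriv

/-! ### Change of variables -/

section ChangeOfVariables

variable {m : ℕ} {Φ : Euc m → Euc m}

theorem contDiff_det (m : ℕ) :
    ContDiff ℝ ∞ fun A : Euc m →L[ℝ] Euc m => A.det := by
  have e : (fun A : Euc m →L[ℝ] Euc m => A.det) = fun A => ∑ σ : Equiv.Perm (Fin m),
      ((Equiv.Perm.sign σ : ℤ) : ℝ) * ∏ i, A (EuclideanSpace.single i 1) (σ i) := by
    funext A
    rw [ContinuousLinearMap.det, ← LinearMap.det_toMatrix (EuclideanSpace.basisFun (Fin m) ℝ).toBasis,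
      Matrix.det_apply']
    simp [LinearMap.toMatrix_apply]
  rw [e]
  fun_prop

/-- A smooth bijection of `ℝ^m` whose Jacobian does not vanish. -/
structure IsDiffeo (Φ : Euc m → Euc m) : Prop where
  contDiff : ContDiff ℝ ∞ Φ
  bijective : Function.Bijective Φ
  jac_pos : ∀ x, 0 < jac Φ x

namespace IsDiffeo

variable (hΦ : IsDiffeo Φ)
include hΦ

theorem hasFDerivAt (x : Euc m) : HasFDerivAt Φ (fderiv ℝ Φ x) x :=
  (hΦ.contDiff.differentiable (by simp) x).hasFDerivAt

theorem exists_equiv : ∃ Φ' : Euc m → Euc m ≃L[ℝ] Euc m,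
    ∀ x, (Φ' x : Euc m →L[ℝ] Euc m) = fderiv ℝ Φ x :=
  ⟨fun x => (fderiv ℝ Φ x).toContinuousLinearEquivOfDetNeZero (abs_pos.1 (hΦ.jac_pos x)),
    fun x => by ext; simp⟩

theorem isOpenMap : IsOpenMap Φ := by
  obtain ⟨Φ', h⟩ := hΦ.exists_equiv
  refine isOpenMap_of_hasStrictFDerivAt_equiv (f' := Φ') fun x => ?_
  rw [h]
  exact hΦ.contDiff.contDiffAt.hasStrictFDerivAt (by simp)

/-- The inverse of `Φ` is smooth. -/
theorem exists_inverse : ∃ Ψ : Euc m → Euc m, ContDiff ℝ ∞ Ψ ∧ (∀ x, Ψ (Φ x) = x) ∧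
    ∀ y, Φ (Ψ y) = y := by
  obtain ⟨Φ', h⟩ := hΦ.exists_equiv
  let e : Euc m ≃ₜ Euc m := (Equiv.ofBijective Φ hΦ.bijective).toHomeomorphOfContinuousOpen
    hΦ.contDiff.continuous hΦ.isOpenMap
  refine ⟨e.symm, e.contDiff_symm (f₀' := Φ') (fun x => ?_) hΦ.contDiff,
    fun x => e.symm_apply_apply x, fun y => e.apply_symm_apply y⟩
  rw [h]
  exact hΦ.hasFDerivAt x

theorem contDiff_jac : ContDiff ℝ ∞ (jac Φ) := by
  have h1 : ContDiff ℝ ∞ fun x => (fderiv ℝ Φ x).det :=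
    (contDiff_det m).comp (hΦ.contDiff.fderiv_right (m := ∞) (by simp))
  exact contDiff_iff_contDiffAt.2 fun x => (h1.contDiffAt).abs (abs_pos.1 (hΦ.jac_pos x))

theorem integral_comp {V : Type*} [NormedAddCommGroup V] [NormedSpace ℝ V] (F : Euc m → V) :
    ∫ y, F y = ∫ x, jac Φ x • F (Φ x) := by
  have h := integral_image_eq_integral_abs_det_fderiv_smul volume MeasurableSet.univ
    (fun x _ => (hΦ.hasFDerivAt x).hasFDerivWithinAt) hΦ.bijective.1.injOn F
  rwa [image_univ, hΦ.bijective.2.range_eq, setIntegral_univ, setIntegral_univ] at h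

theorem lintegral_comp {s : Set (Euc m)} (hs : MeasurableSet s) (F : Euc m → ℝ≥0∞) :
    ∫⁻ x in s, ENNReal.ofReal (jac Φ x) * F (Φ x) = ∫⁻ y in Φ '' s, F y :=
  (lintegral_image_eq_lintegral_abs_det_fderiv_mul volume hs
    (fun x _ => (hΦ.hasFDerivAt x).hasFDerivWithinAt) hΦ.bijective.1.injOn F).symm

theorem locallyIntegrableOn_comp {V : Type*} [NormedAddCommGroup V] [NormedSpace ℝ V]
    {Ω Ω' : Set (Euc m)} (hΩ : IsOpen Ω) (hΩ' : MapsTo Φ Ω Ω') {F : Euc m → V}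
    (hF : LocallyIntegrableOn F Ω' volume) :
    LocallyIntegrableOn (fun x => F (Φ x)) Ω volume := by
  rw [locallyIntegrableOn_iff hΩ.isLocallyClosed]
  intro k hk hk'
  have h1 := hF.integrableOn_compact_subset (hΩ'.mono_left hk).image_subset
    (hk'.image hΦ.contDiff.continuous)
  rw [integrableOn_image_iff_integrableOn_abs_det_fderiv_smul volume hk'.measurableSet
    (fun x _ => (hΦ.hasFDerivAt x).hasFDerivWithinAt) hΦ.bijective.1.injOn F] at h1
  have h2 : ContinuousOn (fun x => (jac Φ x)⁻¹) k :=
    (hΦ.contDiff_jac.continuous.inv₀ fun x => (hΦ.jac_pos x).ne').continuousOn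
  refine (h1.continuousOn_smul h2 hk').congr_fun (fun x _ => ?_) hk'.measurableSet
  exact inv_smul_smul₀ (hΦ.jac_pos x).ne' _

/-- The measure `θ dx` with a test function `θ` is mapped by `Φ` to such a measure. -/
theorem exists_isTest_map {Ω Ω' : Set (Euc m)} (hΩ' : MapsTo Φ Ω Ω') {θ : Euc m → ℝ}
    (hθ : IsTest Ω θ) : ∃ ψ, IsTest Ω' ψ ∧
      ∀ {V : Type} [NormedAddCommGroup V] [NormedSpace ℝ V] (F : Euc m → V),
        ∫ y, ψ y • F y = ∫ x, θ x • F (Φ x) := by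
  obtain ⟨Ψ, hΨ, h1, h2⟩ := hΦ.exists_inverse
  have hsub : tsupport (fun y => θ (Ψ y) * (jac Φ (Ψ y))⁻¹) ⊆ Φ '' tsupport θ := by
    refine closure_minimal (fun y hy => ⟨Ψ y, subset_tsupport _ ?_, h2 y⟩)
      (hθ.hasCompactSupport.image hΦ.contDiff.continuous).isClosed
    exact left_ne_zero_of_mul hy
  refine ⟨fun y => θ (Ψ y) * (jac Φ (Ψ y))⁻¹, ⟨?_, ?_, ?_⟩, fun F => ?_⟩
  · exact (hθ.contDiff.comp hΨ).mul
      ((hΦ.contDiff_jac.comp hΨ).inv fun y => (hΦ.jac_pos _).ne')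
  · exact (hθ.hasCompactSupport.image hΦ.contDiff.continuous).of_isClosed_subset
      (isClosed_tsupport _) hsub
  · exact hsub.trans ((hΩ'.mono_left hθ.tsupport_subset).image_subset)
  · rw [hΦ.integral_comp]
    refine integral_congr_ae (Filter.Eventually.of_forall fun x => ?_)
    simp only [h1]
    rw [smul_smul, mul_left_comm, mul_inv_cancel₀ (hΦ.jac_pos x).ne', mul_one]

end IsDiffeo

end ChangeOfVariables

/-! ### The chain rule for weak derivatives -/

section ChainRule

variable {m : ℕ} {Φ : Euc m → Euc m}

/-- The coefficients of the formula of Faà di Bruno in the standard basis: the product of the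
coordinates `α i` of the derivatives of `Φ` along the parts of the partition `c`. -/
noncomputable def faaDiBrunoCoeff {j : ℕ} (Φ : Euc m → Euc m) (v : Fin j → Euc m)
    (q : Σ c : OrderedFinpartition j, (Fin c.length → Fin m)) (x : Euc m) : ℝ :=
  ∏ i, (iteratedFDeriv ℝ (q.1.partSize i) Φ x (v ∘ q.1.emb i)) (q.2 i)

theorem contDiff_faaDiBrunoCoeff (hΦ : ContDiff ℝ ∞ Φ) {j : ℕ} (v : Fin j → Euc m)
    (q : Σ c : OrderedFinpartition j, (Fin c.length → Fin m)) :
    ContDiff ℝ ∞ (faaDiBrunoCoeff Φ v q) :=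
  contDiff_prod fun i _ =>
    (EuclideanSpace.proj (q.2 i) : Euc m →L[ℝ] ℝ).contDiff.comp
      (contDiff_iteratedFDeriv_apply hΦ _ (v ∘ q.1.emb i))

/-- The expansion of a multilinear map in the standard basis. -/
theorem map_eq_sum_prod_smul {V : Type*} [NormedAddCommGroup V] [NormedSpace ℝ V] {n : ℕ}
    (A : ContinuousMultilinearMap ℝ (fun _ : Fin n => Euc m) V) (w : Fin n → Euc m) :
    A w = ∑ α : Fin n → Fin m, (∏ i, w i (α i)) • A fun i => EuclideanSpace.single (α i) 1 := by
  classical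
  have h : w = fun i => ∑ s, w i s • EuclideanSpace.single s (1 : ℝ) := by
    funext i
    ext t
    simp [Pi.single_apply]
  conv_lhs => rw [h]
  have h1 := A.toMultilinearMap.map_sum fun (i : Fin n) (s : Fin m) =>
    w i s • EuclideanSpace.single s (1 : ℝ)
  refine h1.trans (Finset.sum_congr rfl fun α _ => ?_)
  exact A.toMultilinearMap.map_smul_univ _ _

theorem taylorComp_apply {V : Type*} [NormedAddCommGroup V] [NormedSpace ℝ V] {j : ℕ}
    (A : FormalMultilinearSeries ℝ (Euc m) V) (Φ : Euc m → Euc m) (x : Euc m) (v : Fin j → Euc m) :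
    A.taylorComp (ftaylorSeries ℝ Φ x) j v =
      ∑ q : Σ c : OrderedFinpartition j, (Fin c.length → Fin m),
        faaDiBrunoCoeff Φ v q x • A q.1.length fun i => EuclideanSpace.single (q.2 i) 1 := by
  rw [FormalMultilinearSeries.taylorComp, _root_.sum_apply,
    Fintype.sum_sigma]
  refine Finset.sum_congr rfl fun c _ => ?_
  rw [FormalMultilinearSeries.compAlongOrderedFinpartition_apply, map_eq_sum_prod_smul]
  rfl

theorem continuous_compAlong {V : Type*} [NormedAddCommGroup V] [NormedSpace ℝ V]
    (hΦ : ContDiff ℝ ∞ Φ) {j : ℕ} (c : OrderedFinpartition j) :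
    Continuous fun x => (c.compAlongOrderedFinpartitionL ℝ (Euc m) (Euc m) V).flipMultilinear
      fun i => iteratedFDeriv ℝ (c.partSize i) Φ x :=
  (ContinuousLinearMap.flipMultilinear _).cont.comp
    (continuous_pi fun i => hΦ.continuous_iteratedFDeriv (m := c.partSize i) (mod_cast le_top))

theorem locallyIntegrableOn_clm_apply {V W : Type*} [NormedAddCommGroup V] [NormedSpace ℝ V]
    [NormedAddCommGroup W] [NormedSpace ℝ W] {Ω : Set (Euc m)} (hΩ : IsOpen Ω)
    {T : Euc m → V →L[ℝ] W} (hT : Continuous T) {F : Euc m → V}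
    (hF : LocallyIntegrableOn F Ω volume) : LocallyIntegrableOn (fun x => T x (F x)) Ω volume := by
  rw [locallyIntegrableOn_iff hΩ.isLocallyClosed] at hF ⊢
  intro k hk hk'
  have h1 := hF k hk hk'
  have h2 : IntegrableOn (fun x => ‖T x‖ • ‖F x‖) k :=
    IntegrableOn.continuousOn_smul h1.norm hT.norm.continuousOn hk'
  refine h2.mono' ?_ (Filter.Eventually.of_forall fun x => (T x).le_opNorm (F x))
  exact (ContinuousLinearMap.apply ℝ W).aestronglyMeasurable_comp₂ h1.1 hT.aestronglyMeasurable

theorem taylorComp_eq_sum {V : Type*} [NormedAddCommGroup V] [NormedSpace ℝ V] (j : ℕ)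
    (A : FormalMultilinearSeries ℝ (Euc m) V) (Φ : Euc m → Euc m) (x : Euc m) :
    A.taylorComp (ftaylorSeries ℝ Φ x) j = ∑ c : OrderedFinpartition j,
      (c.compAlongOrderedFinpartitionL ℝ (Euc m) (Euc m) V).flipMultilinear
        (fun i => iteratedFDeriv ℝ (c.partSize i) Φ x) (A c.length) :=
  Finset.sum_congr rfl fun _ _ => rfl

theorem locallyIntegrableOn_taylorComp {V : Type*} [NormedAddCommGroup V] [NormedSpace ℝ V]
    {Ω : Set (Euc m)} (hΩ : IsOpen Ω) (hΦ : ContDiff ℝ ∞ Φ) {j : ℕ}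
    {A : Euc m → FormalMultilinearSeries ℝ (Euc m) V}
    (hA : ∀ c : OrderedFinpartition j, LocallyIntegrableOn (fun x => A x c.length) Ω volume) :
    LocallyIntegrableOn (fun x => (A x).taylorComp (ftaylorSeries ℝ Φ x) j) Ω volume := by
  simp_rw [taylorComp_eq_sum]
  rw [locallyIntegrableOn_iff hΩ.isLocallyClosed]
  intro k hk hk'
  exact integrable_finsetSum _ fun c _ => (locallyIntegrableOn_clm_apply hΩ
    (continuous_compAlong hΦ c) (hA c)).integrableOn_compact_subset hk hk'

/-- The chain rule: the formula of Faà di Bruno gives the weak derivatives of `u ∘ Φ`. The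
classical formula, tested against smooth functions, is a relation between integrals of their
derivatives with smooth weights, and so it passes to weak derivatives. -/
theorem IsWeakDeriv.comp {ν j : ℕ} (hΦ : IsDiffeo Φ) {Ω : Set (Euc m)} (hΩ : IsOpen Ω)
    (hΦΩ : MapsTo Φ Ω Ω) (hj : 1 ≤ j) {u : Euc m → Euc ν}
    {g : (i : ℕ) → Euc m → ContinuousMultilinearMap ℝ (fun _ : Fin i => Euc m) (Euc ν)}
    (hg : ∀ i ∈ Finset.Icc 1 j, IsWeakDeriv Ω i u (g i)) :
    IsWeakDeriv Ω j (u ∘ Φ) fun x =>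
      FormalMultilinearSeries.taylorComp (fun i => g i (Φ x)) (ftaylorSeries ℝ Φ x) j := by
  have hmem : ∀ c : OrderedFinpartition j, c.length ∈ Finset.Icc 1 j := fun c =>
    Finset.mem_Icc.2 ⟨c.length_pos hj, c.length_le⟩
  have hu : LocallyIntegrableOn u Ω volume := (hg j (Finset.mem_Icc.2 ⟨hj, le_rfl⟩)).1
  have hgΦ : ∀ c : OrderedFinpartition j,
      LocallyIntegrableOn (fun x => g c.length (Φ x)) Ω volume := fun c =>
    hΦ.locallyIntegrableOn_comp hΩ hΦΩ (hg _ (hmem c)).2.1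
  refine ⟨hΦ.locallyIntegrableOn_comp hΩ hΦΩ hu,
    locallyIntegrableOn_taylorComp hΩ hΦ.contDiff hgΦ, fun φ h1 h2 h3 v => ?_⟩
  have hφ : IsTest Ω φ := ⟨h1, h2, h3⟩
  have hθ : ∀ q, IsTest Ω fun x => φ x * faaDiBrunoCoeff Φ v q x := fun q =>
    hφ.mul (contDiff_faaDiBrunoCoeff hΦ.contDiff v q)
  have hφ₀ := (hφ.iteratedFDeriv_apply j v).const_mul ((-1) ^ j)
  obtain ⟨ψ₀, hψ₀, h0⟩ := hΦ.exists_isTest_map hΦΩ hφ₀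
  choose ψ hψ h4 using fun q => hΦ.exists_isTest_map hΦΩ (hθ q)
  -- the relation between `u` and `g` that has to be shown, transported by `Φ`
  have key := integral_smul_eq_sum_of_forall_contDiff hu
    (fun q : Σ c : OrderedFinpartition j, (Fin c.length → Fin m) => hg _ (hmem q.1)) hψ₀ hψ
    (fun q i => EuclideanSpace.single (q.2 i) 1) fun f hf => ?_
  · rw [h0] at key
    simp_rw [h4] at key
    have hint : ∀ q : Σ c : OrderedFinpartition j, (Fin c.length → Fin m),
        Integrable fun x => (φ x * faaDiBrunoCoeff Φ v q x) •
          g q.1.length (Φ x) fun i => EuclideanSpace.single (q.2 i) 1 := fun q =>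
      (ContinuousMultilinearMap.apply ℝ (fun _ : Fin q.1.length => Euc m) (Euc ν)
        fun i => EuclideanSpace.single (q.2 i) 1).integrable_comp
          ((hθ q).integrable_smul (hgΦ q.1))
    rw [← integral_finsetSum _ fun q _ => hint q] at key
    simp_rw [mul_smul] at key
    rw [integral_smul] at key
    simp_rw [← Finset.smul_sum] at key
    rw [(hφ.iteratedFDeriv_apply j v).integral_smul, hφ.integral_smul fun x =>
      FormalMultilinearSeries.taylorComp (fun i => g i (Φ x)) (ftaylorSeries ℝ Φ x) j v]
    have hT : ∫ x, φ x • FormalMultilinearSeries.taylorComp (fun i => g i (Φ x))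
        (ftaylorSeries ℝ Φ x) j v = ∫ x, φ x •
          ∑ q : Σ c : OrderedFinpartition j, (Fin c.length → Fin m), faaDiBrunoCoeff Φ v q x •
            g q.1.length (Φ x) fun i => EuclideanSpace.single (q.2 i) 1 :=
      integral_congr_ae (Filter.Eventually.of_forall fun x =>
        congrArg (φ x • ·) (taylorComp_apply _ Φ x v))
    rw [hT, ← key, smul_smul, ← mul_pow]
    simp
  · -- for smooth `f` the relation is the classical formula, integrated by parts
    have e0 := h0 f
    have e4 := fun q : Σ c : OrderedFinpartition j, (Fin c.length → Fin m) =>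
      h4 q fun x => iteratedFDeriv ℝ q.1.length f x fun i => EuclideanSpace.single (q.2 i) 1
    simp_rw [smul_eq_mul] at e0 e4
    have hfΦ : ContDiff ℝ ∞ (f ∘ Φ) := hf.comp hΦ.contDiff
    have hD : ∀ x, iteratedFDeriv ℝ j (f ∘ Φ) x v =
        ∑ q : Σ c : OrderedFinpartition j, (Fin c.length → Fin m), faaDiBrunoCoeff Φ v q x *
          iteratedFDeriv ℝ q.1.length f (Φ x) fun i => EuclideanSpace.single (q.2 i) 1 := by
      intro x
      rw [iteratedFDeriv_comp hf.contDiffAt hΦ.contDiff.contDiffAt (i := j) (mod_cast le_top),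
        taylorComp_apply]
      rfl
    have hint : ∀ q : Σ c : OrderedFinpartition j, (Fin c.length → Fin m),
        Integrable fun x => φ x * faaDiBrunoCoeff Φ v q x *
          iteratedFDeriv ℝ q.1.length f (Φ x) fun i => EuclideanSpace.single (q.2 i) 1 :=
      fun q => (hθ q).integrable_smul (F := fun x => iteratedFDeriv ℝ q.1.length f (Φ x)
        fun i => EuclideanSpace.single (q.2 i) 1)
        (((contDiff_iteratedFDeriv_apply hf _ _).comp
          hΦ.contDiff).continuous.locallyIntegrable.locallyIntegrableOn Ω)
    rw [e0]
    simp_rw [e4]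
    rw [← integral_finsetSum _ fun q _ => hint q]
    simp_rw [mul_assoc, ← Finset.mul_sum, ← hD]
    rw [integral_const_mul]
    have hibp := integral_iteratedFDeriv_apply_mul volume h1 h2 hfΦ j v
    simp only [Function.comp_apply] at hibp
    rw [hibp, ← mul_assoc, ← mul_pow]
    simp

end ChainRule

/-! ### Sobolev estimates for the composition -/

section Estimate

variable {m : ℕ} {Φ : Euc m → Euc m}

/-- The constant in the estimate of the formula of Faà di Bruno of order `j`, when the derivative of
order `n` of the inner map is bounded by `D n`. -/
noncomputable def faaDiBrunoConst (j : ℕ) (D : ℕ → ℝ) : ℝ :=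
  ∑ c : OrderedFinpartition j, ∏ i, D (c.partSize i)

theorem faaDiBrunoConst_nonneg {D : ℕ → ℝ} (hD : ∀ n, 0 < D n) (j : ℕ) : 0 ≤ faaDiBrunoConst j D :=
  Finset.sum_nonneg fun _ _ => Finset.prod_nonneg fun _ _ => (hD _).le

theorem sum_partSize {j : ℕ} (c : OrderedFinpartition j) : ∑ i, c.partSize i = j := by
  have h := c.sum_sigma_eq_sum fun _ => 1
  simpa using h

/-- The formula of Faà di Bruno, when the derivatives of `Φ` at `x` are those of a map of frequency `t`.
The sizes of the parts of a partition add up to `j`, whence the power `t ^ j`. -/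
theorem pow_mul_norm_taylorComp_le {V : Type*} [NormedAddCommGroup V] [NormedSpace ℝ V] {j : ℕ}
    (hj : 1 ≤ j) {ρ t : ℝ} (hρ : 0 < ρ) {D : ℕ → ℝ}
    (A : FormalMultilinearSeries ℝ (Euc m) V) (Φ : Euc m → Euc m) (x : Euc m)
    (h : ∀ n, 1 ≤ n → ρ ^ (n - 1) * ‖iteratedFDeriv ℝ n Φ x‖ ≤ D n * t ^ n) :
    ρ ^ j * ‖A.taylorComp (ftaylorSeries ℝ Φ x) j‖ ≤
      faaDiBrunoConst j D * t ^ j * ∑ i ∈ Finset.Icc 1 j, ρ ^ i * ‖A i‖ := by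
  rw [faaDiBrunoConst, Finset.sum_mul, Finset.sum_mul]
  refine (mul_le_mul_of_nonneg_left (norm_sum_le _ _) (by positivity)).trans ?_
  rw [Finset.mul_sum]
  refine Finset.sum_le_sum fun c _ => ?_
  have h1 : ‖A.compAlongOrderedFinpartition (ftaylorSeries ℝ Φ x) c‖ ≤
      ‖A c.length‖ * ∏ i, ‖iteratedFDeriv ℝ (c.partSize i) Φ x‖ :=
    c.norm_compAlongOrderedFinpartition_le _ _
  have h2 : ρ ^ j = ρ ^ c.length * ∏ i, ρ ^ (c.partSize i - 1) := by
    have e : ∏ _i : Fin c.length, ρ = ρ ^ c.length := by simp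
    rw [← e, ← Finset.prod_mul_distrib]
    have e2 : ∀ i, ρ * ρ ^ (c.partSize i - 1) = ρ ^ c.partSize i := fun i => by
      rw [← pow_succ', Nat.sub_add_cancel (c.partSize_pos i)]
    simp_rw [e2]
    rw [Finset.prod_pow_eq_pow_sum, sum_partSize]
  have h3 : ∏ i, (ρ ^ (c.partSize i - 1) * ‖iteratedFDeriv ℝ (c.partSize i) Φ x‖) ≤
      ∏ i, (D (c.partSize i) * t ^ c.partSize i) :=
    Finset.prod_le_prod (fun i _ => by positivity) fun i _ => h _ (c.partSize_pos i)
  have h4 : ρ ^ c.length * ‖A c.length‖ ≤ ∑ i ∈ Finset.Icc 1 j, ρ ^ i * ‖A i‖ :=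
    Finset.single_le_sum (f := fun i => ρ ^ i * ‖A i‖) (fun i _ => by positivity)
      (Finset.mem_Icc.2 ⟨c.length_pos hj, c.length_le⟩)
  have h5 : 0 ≤ ∑ i ∈ Finset.Icc 1 j, ρ ^ i * ‖A i‖ := by positivity
  calc _ ≤ ρ ^ j * (‖A c.length‖ * ∏ i, ‖iteratedFDeriv ℝ (c.partSize i) Φ x‖) := by gcongr
    _ = (∏ i, (ρ ^ (c.partSize i - 1) * ‖iteratedFDeriv ℝ (c.partSize i) Φ x‖)) *
        (ρ ^ c.length * ‖A c.length‖) := by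
      rw [h2, Finset.prod_mul_distrib]
      ring
    _ ≤ (∏ i, (D (c.partSize i) * t ^ c.partSize i)) *
        ∑ i ∈ Finset.Icc 1 j, ρ ^ i * ‖A i‖ := by
      refine mul_le_mul h3 h4 (by positivity) ?_
      exact (Finset.prod_nonneg fun i _ => by positivity).trans h3
    _ = _ := by rw [Finset.prod_mul_distrib, Finset.prod_pow_eq_pow_sum, sum_partSize]

/-- The change of variables in an `L^p` norm. -/
theorem IsDiffeo.eLpNorm_comp (hΦ : IsDiffeo Φ) {V : Type*} [NormedAddCommGroup V] [NormedSpace ℝ V]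
    {p : ℝ} (hp : 0 < p) {s : Set (Euc m)} (hs : MeasurableSet s) (F : Euc m → V) :
    eLpNorm (fun x => jac Φ x ^ (1 / p) • F (Φ x)) (ENNReal.ofReal p) (volume.restrict s) =
      eLpNorm F (ENNReal.ofReal p) (volume.restrict (Φ '' s)) := by
  have h0 : ENNReal.ofReal p ≠ 0 := by simpa using hp
  rw [eLpNorm_eq_lintegral_rpow_enorm_toReal h0 ENNReal.ofReal_ne_top,
    eLpNorm_eq_lintegral_rpow_enorm_toReal h0 ENNReal.ofReal_ne_top,
    ENNReal.toReal_ofReal hp.le, ← hΦ.lintegral_comp hs]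
  congr 1
  refine lintegral_congr fun x => ?_
  have h1 := hΦ.jac_pos x
  rw [enorm_smul, ENNReal.mul_rpow_of_nonneg _ _ hp.le,
    Real.enorm_of_nonneg (Real.rpow_nonneg h1.le _), ENNReal.ofReal_rpow_of_nonneg
    (Real.rpow_nonneg h1.le _) hp.le, ← Real.rpow_mul h1.le, one_div_mul_cancel hp.ne',
    Real.rpow_one]

/-- A pointwise estimate with the power `1 / p` of the Jacobian gives an estimate in `L^p`. -/
theorem IsDiffeo.eLpNorm_le_of_forall_le (hΦ : IsDiffeo Φ) {V : ℕ → Type*} {W : Type*}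
    [∀ i, NormedAddCommGroup (V i)] [∀ i, NormedSpace ℝ (V i)] [NormedAddCommGroup W]
    [NormedSpace ℝ W] {p : ℝ} (hp : 1 ≤ p) {s s' : Set (Euc m)} (hs : MeasurableSet s)
    (hss' : MapsTo Φ s s') {I : Finset ℕ} {F : (i : ℕ) → Euc m → V i} {G : Euc m → W} {C b ρ : ℝ}
    (hC : 0 ≤ C) (hb : 0 ≤ b) (hρ : 0 ≤ ρ)
    (hF : ∀ i ∈ I, AEStronglyMeasurable (fun x => F i (Φ x)) (volume.restrict s))
    (h : ∀ x ∈ s, b * ‖G x‖ ≤ C * jac Φ x ^ (1 / p) * ∑ i ∈ I, ρ ^ i * ‖F i (Φ x)‖) :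
    ENNReal.ofReal b * eLpNorm G (ENNReal.ofReal p) (volume.restrict s) ≤
      ENNReal.ofReal C * ∑ i ∈ I, ENNReal.ofReal (ρ ^ i) *
        eLpNorm (F i) (ENNReal.ofReal p) (volume.restrict s') := by
  have hp0 : 0 < p := by linarith
  have h1 : ENNReal.ofReal b * eLpNorm G (ENNReal.ofReal p) (volume.restrict s) =
      eLpNorm (b • G) (ENNReal.ofReal p) (volume.restrict s) := by
    rw [eLpNorm_const_smul, Real.enorm_of_nonneg hb]
  set f : ℕ → Euc m → ℝ := fun i x => ‖jac Φ x ^ (1 / p) • F i (Φ x)‖ with hf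
  have hfm : ∀ i ∈ I, AEStronglyMeasurable (f i) (volume.restrict s) := fun i hi =>
    ((hΦ.contDiff_jac.continuous.rpow_const fun x => Or.inl
      (hΦ.jac_pos x).ne').aestronglyMeasurable.smul (hF i hi)).norm
  have h2 : eLpNorm (b • G) (ENNReal.ofReal p) (volume.restrict s) ≤
      eLpNorm (C • ∑ i ∈ I, (ρ ^ i) • f i) (ENNReal.ofReal p) (volume.restrict s) := by
    refine eLpNorm_mono_ae_real (ae_restrict_of_forall_mem hs fun x hx => ?_)
    rw [Pi.smul_apply, norm_smul, Real.norm_of_nonneg hb]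
    refine (h x hx).trans (le_of_eq ?_)
    simp only [hf, Pi.smul_apply, Finset.sum_apply, smul_eq_mul, norm_smul,
      Real.norm_of_nonneg (Real.rpow_nonneg (jac_nonneg Φ x) (1 / p))]
    rw [mul_assoc, Finset.mul_sum]
    congr 1
    exact Finset.sum_congr rfl fun i _ => by ring
  rw [h1]
  refine h2.trans ?_
  rw [eLpNorm_const_smul, Real.enorm_of_nonneg hC]
  gcongr
  refine (eLpNorm_sum_le (fun i hi => (hfm i hi).const_smul (ρ ^ i))
    (by simpa using hp)).trans ?_
  refine Finset.sum_le_sum fun i _ => ?_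
  rw [eLpNorm_const_smul, Real.enorm_of_nonneg (pow_nonneg hρ i)]
  gcongr
  rw [eLpNorm_norm, hΦ.eLpNorm_comp hp0 hs]
  exact eLpNorm_mono_measure _ (Measure.restrict_mono hss'.image_subset le_rfl)

theorem eLpNorm_restrict_le_diff_add_inter {V : Type*} [NormedAddCommGroup V] {p : ℝ≥0∞}
    (hp : 1 ≤ p) {s P : Set (Euc m)} (hP : MeasurableSet P) {G : Euc m → V}
    (hG : AEStronglyMeasurable G (volume.restrict s)) :
    eLpNorm G p (volume.restrict s) ≤
      eLpNorm G p (volume.restrict (s \ P)) + eLpNorm G p (volume.restrict (s ∩ P)) := by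
  have e : G = Pᶜ.indicator G + P.indicator G := (indicator_compl_add_self P G).symm
  conv_lhs => rw [e]
  refine (eLpNorm_add_le (hG.indicator hP.compl) (hG.indicator hP) hp).trans (le_of_eq ?_)
  rw [eLpNorm_indicator_eq_eLpNorm_restrict hP.compl, eLpNorm_indicator_eq_eLpNorm_restrict hP,
    Measure.restrict_restrict hP.compl, Measure.restrict_restrict hP, inter_comm P, inter_comm Pᶜ]
  rfl

end Estimate

namespace IsShrinking

variable {m ℓ : ℕ} {K K' : ℝ → ℕ → ℝ} {a : Euc m} {η ρ τ : ℝ} {Φ : Euc m → Euc m}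

theorem isDiffeo (h : IsShrinking K K' ℓ a η ρ τ Φ) : IsDiffeo Φ :=
  ⟨h.contDiff, h.bijective, h.jac_pos⟩

theorem mapsTo_latticeNhd (h : IsShrinking K K' ℓ a η ρ τ Φ) :
    MapsTo Φ (latticeNhd a η ℓ (2 * ρ)) (latticeNhd a η ℓ (2 * ρ)) := by
  intro x hx
  by_contra hc
  -- a point outside the neighborhood is fixed, so it is the image of no other point
  exact hc (by rwa [h.bijective.1 (h.eq_self _ hc)])

theorem mapsTo_cube (h : IsShrinking K K' ℓ a η ρ τ Φ) {c : Euc m} {z : Fin m → ℤ}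
    (hc : ∀ s, c s = a s + 2 * η * z s) : MapsTo Φ (cube c η) (cube c η) := by
  intro x hx s
  have h1 := h.abs_sub_le x s (z s)
  have h2 := hx s
  rw [hc] at h2 ⊢
  rw [← sub_sub] at h2 ⊢
  exact h1 h2

end IsShrinking

/-- The constant in the Sobolev estimates of order at most `k`. -/
noncomputable def sobolevConst (K K' : ℝ → ℕ → ℝ) (k : ℕ) (p : ℝ) : ℝ :=
  ∑ j ∈ Finset.Icc 1 k,
    (faaDiBrunoConst j (K (j * p)) + faaDiBrunoConst j (K' (j * p))) + 1

theorem sobolevConst_pos {K K' : ℝ → ℕ → ℝ} (hK : ∀ β j, 0 < K β j) (hK' : ∀ β j, 0 < K' β j)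
    (k : ℕ) (p : ℝ) : 0 < sobolevConst K K' k p :=
  add_pos_of_nonneg_of_pos (Finset.sum_nonneg fun j _ =>
    add_nonneg (faaDiBrunoConst_nonneg (hK _) j) (faaDiBrunoConst_nonneg (hK' _) j)) one_pos

theorem faaDiBrunoConst_add_le_sobolevConst {K K' : ℝ → ℕ → ℝ} (hK : ∀ β j, 0 < K β j)
    (hK' : ∀ β j, 0 < K' β j) {j k : ℕ} (hj : j ∈ Finset.Icc 1 k) (p : ℝ) :
    faaDiBrunoConst j (K (j * p)) + faaDiBrunoConst j (K' (j * p)) ≤ sobolevConst K K' k p :=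
  (Finset.single_le_sum (f := fun j : ℕ =>
    faaDiBrunoConst j (K (j * p)) + faaDiBrunoConst j (K' (j * p))) (fun j _ =>
    add_nonneg (faaDiBrunoConst_nonneg (hK _) j) (faaDiBrunoConst_nonneg (hK' _) j)) hj).trans
    (by rw [sobolevConst]; linarith)

namespace IsShrinking

variable {m ℓ : ℕ} {K K' : ℝ → ℕ → ℝ} {a : Euc m} {η ρ τ : ℝ} {Φ : Euc m → Euc m}

section Pointwise

variable {V : Type*} [NormedAddCommGroup V] [NormedSpace ℝ V]

theorem pow_mul_norm_taylorComp_le (h : IsShrinking K K' ℓ a η ρ τ Φ) (hK : ∀ β j, 0 < K β j)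
    (hK' : ∀ β j, 0 < K' β j) (hρ : 0 < ρ) {j k : ℕ} (hj : j ∈ Finset.Icc 1 k) {p : ℝ} (hp : 1 ≤ p)
    (hkp : k * p < ℓ + 1) (A : FormalMultilinearSeries ℝ (Euc m) V) (x : Euc m) :
    ρ ^ j * ‖A.taylorComp (ftaylorSeries ℝ Φ x) j‖ ≤
      sobolevConst K K' k p * jac Φ x ^ (1 / p) * ∑ i ∈ Finset.Icc 1 j, ρ ^ i * ‖A i‖ := by
  obtain ⟨hj1, hjk⟩ := Finset.mem_Icc.1 hj
  have hJ := h.jac_pos x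
  have hj0 : (0 : ℝ) < j := by exact_mod_cast hj1
  have hjk' : (j : ℝ) ≤ k := by exact_mod_cast hjk
  have hβ : 0 < j * p := by positivity
  have hβ' : j * p < ℓ + 1 := (mul_le_mul_of_nonneg_right hjk' (by linarith)).trans_lt hkp
  -- with `β = j * p` the power `t ^ j` is the power `1 / p` of the Jacobian
  have h1 := Cubication.pow_mul_norm_taylorComp_le hj1 hρ (t := jac Φ x ^ (1 / (j * p)))
    (D := K (j * p)) A Φ x fun n hn => by
      refine (h.le_jac (j * p) n hβ hβ' hn x).trans (le_of_eq ?_)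
      rw [← Real.rpow_natCast, ← Real.rpow_mul hJ.le, one_div_mul_eq_div]
  have h2 : (jac Φ x ^ (1 / (j * p))) ^ j = jac Φ x ^ (1 / p) := by
    rw [← Real.rpow_natCast, ← Real.rpow_mul hJ.le]
    congr 1
    field_simp
  rw [h2] at h1
  have h3 := faaDiBrunoConst_add_le_sobolevConst hK hK' hj p
  have h4 := faaDiBrunoConst_nonneg (hK' (j * p)) j
  have h5 : 0 ≤ ∑ i ∈ Finset.Icc 1 j, ρ ^ i * ‖A i‖ := by positivity
  refine h1.trans ?_
  gcongr
  linarith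

theorem pow_mul_norm_taylorComp_le_of_mem (h : IsShrinking K K' ℓ a η ρ τ Φ)
    (hK : ∀ β j, 0 < K β j) (hK' : ∀ β j, 0 < K' β j) (hρ : 0 < ρ) (hτ : 0 < τ) (hτ' : τ ≤ 1)
    {j k : ℕ} (hj : j ∈ Finset.Icc 1 k) {p : ℝ} (hp : 1 ≤ p) (hkp : k * p < ℓ + 1)
    (A : FormalMultilinearSeries ℝ (Euc m) V) {x : Euc m} (hx : Φ x ∈ latticeNhd a η ℓ ρ) :
    ρ ^ j * ‖A.taylorComp (ftaylorSeries ℝ Φ x) j‖ ≤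
      sobolevConst K K' k p * τ ^ (((ℓ : ℝ) + 1 - k * p) / p) * jac Φ x ^ (1 / p) *
        ∑ i ∈ Finset.Icc 1 j, ρ ^ i * ‖A i‖ := by
  obtain ⟨hj1, hjk⟩ := Finset.mem_Icc.1 hj
  have hJ := h.jac_pos x
  have hj0 : (0 : ℝ) < j := by exact_mod_cast hj1
  have hjk' : (j : ℝ) ≤ k := by exact_mod_cast hjk
  have hp0 : 0 < p := by linarith
  have hβ : 0 < j * p := by positivity
  have hβ' : j * p < ℓ + 1 := (mul_le_mul_of_nonneg_right hjk' (by linarith)).trans_lt hkp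
  have h1 := Cubication.pow_mul_norm_taylorComp_le hj1 hρ
    (t := τ ^ (((ℓ : ℝ) + 1) / (j * p) - 1) * jac Φ x ^ (1 / (j * p)))
    (D := K' (j * p)) A Φ x fun n hn => by
      refine (h.le_jac_of_mem (j * p) n hβ hβ' hn x hx).trans (le_of_eq ?_)
      rw [mul_pow, ← Real.rpow_natCast, ← Real.rpow_natCast, ← Real.rpow_mul hJ.le,
        ← Real.rpow_mul hτ.le, one_div_mul_eq_div, mul_assoc, mul_comm (n : ℝ)]
  have h2 : (τ ^ (((ℓ : ℝ) + 1) / (j * p) - 1) * jac Φ x ^ (1 / (j * p))) ^ j =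
      τ ^ (((ℓ : ℝ) + 1 - j * p) / p) * jac Φ x ^ (1 / p) := by
    rw [mul_pow, ← Real.rpow_natCast, ← Real.rpow_natCast, ← Real.rpow_mul hJ.le,
      ← Real.rpow_mul hτ.le]
    congr 2 <;> field_simp
  rw [h2, ← mul_assoc] at h1
  have h3 := faaDiBrunoConst_add_le_sobolevConst hK hK' hj p
  have h4 := faaDiBrunoConst_nonneg (hK (j * p)) j
  have h4' := faaDiBrunoConst_nonneg (hK' (j * p)) j
  have h5 : 0 ≤ ∑ i ∈ Finset.Icc 1 j, ρ ^ i * ‖A i‖ := by positivity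
  have h6 : τ ^ (((ℓ : ℝ) + 1 - j * p) / p) ≤ τ ^ (((ℓ : ℝ) + 1 - k * p) / p) :=
    Real.rpow_le_rpow_of_exponent_ge hτ hτ' (by gcongr)
  have h7 : faaDiBrunoConst j (K' (j * p)) ≤ sobolevConst K K' k p := by linarith
  have h8 := h4'.trans h7
  refine h1.trans ?_
  gcongr

end Pointwise

variable {ν k : ℕ} {p : ℝ} {A : Set (Euc m)} {u : Euc m → Euc ν}

theorem mapsTo_interior (h : IsShrinking K K' ℓ a η ρ τ Φ) (hA : MapsTo Φ A A) :
    MapsTo Φ (interior A) (interior A) := by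
  rw [mapsTo_iff_image_subset]
  exact interior_maximal ((image_mono interior_subset).trans hA.image_subset)
    (h.isDiffeo.isOpenMap _ isOpen_interior)

/-- The Sobolev estimate for the function given by the formula of Faà di Bruno. -/
theorem eLpNorm_taylorComp_le (h : IsShrinking K K' ℓ a η ρ τ Φ) (hK : ∀ β j, 0 < K β j)
    (hK' : ∀ β j, 0 < K' β j) (hη : 0 < η) (hρ : 0 < ρ) (hτ : 0 < τ) (hτ' : τ ≤ 1)
    (hA : MapsTo Φ A A) {j : ℕ} (hj : j ∈ Finset.Icc 1 k) (hp : 1 ≤ p) (hkp : k * p < ℓ + 1)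
    {g : (i : ℕ) → Euc m → ContinuousMultilinearMap ℝ (fun _ : Fin i => Euc m) (Euc ν)}
    (hg : ∀ i ∈ Finset.Icc 1 j, IsWeakDeriv (interior A) i u (g i)) :
    ENNReal.ofReal (ρ ^ j) *
        eLpNorm (fun x => FormalMultilinearSeries.taylorComp (fun i => g i (Φ x))
          (ftaylorSeries ℝ Φ x) j) (ENNReal.ofReal p) (volume.restrict (interior A)) ≤
      ENNReal.ofReal (sobolevConst K K' k p) *
          ∑ i ∈ Finset.Icc 1 j, ENNReal.ofReal (ρ ^ i) *
            eLpNorm (g i) (ENNReal.ofReal p) (volume.restrict (A \ latticeNhd a η ℓ ρ)) +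
        ENNReal.ofReal (sobolevConst K K' k p * τ ^ (((ℓ : ℝ) + 1 - k * p) / p)) *
          ∑ i ∈ Finset.Icc 1 j, ENNReal.ofReal (ρ ^ i) *
            eLpNorm (g i) (ENNReal.ofReal p) (volume.restrict (A ∩ latticeNhd a η ℓ ρ)) := by
  have hΦ := h.isDiffeo
  have hΩ := h.mapsTo_interior hA
  have hj1 := (Finset.mem_Icc.1 hj).1
  have hG := (IsWeakDeriv.comp hΦ isOpen_interior hΩ hj1 hg).2.1.aestronglyMeasurable
  have hN : MeasurableSet (Φ ⁻¹' latticeNhd a η ℓ ρ) :=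
    h.contDiff.continuous.measurable (isClosed_latticeNhd hη).measurableSet
  have hC := sobolevConst_pos hK hK' k p
  have hF : ∀ s ⊆ interior A, ∀ i ∈ Finset.Icc 1 j,
      AEStronglyMeasurable (fun x => g i (Φ x)) (volume.restrict s) := fun s hs i hi =>
    (hΦ.locallyIntegrableOn_comp isOpen_interior hΩ
      (hg i hi).2.1).aestronglyMeasurable.mono_measure (Measure.restrict_mono hs le_rfl)
  refine (mul_le_mul_right (eLpNorm_restrict_le_diff_add_inter (by simpa using hp)
    hN hG) _).trans ?_
  rw [mul_add]
  refine add_le_add ?_ ?_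
  · exact hΦ.eLpNorm_le_of_forall_le hp (s' := A \ latticeNhd a η ℓ ρ)
      (isOpen_interior.measurableSet.diff hN)
      (fun x hx => ⟨hA (interior_subset hx.1), hx.2⟩) hC.le (by positivity) hρ.le
      (hF _ sdiff_subset)
      fun x _ => h.pow_mul_norm_taylorComp_le hK hK' hρ hj hp hkp (fun i => g i (Φ x)) x
  · exact hΦ.eLpNorm_le_of_forall_le hp (s' := A ∩ latticeNhd a η ℓ ρ)
      (isOpen_interior.measurableSet.inter hN)
      (fun x hx => ⟨hA (interior_subset hx.1), hx.2⟩) (by positivity) (by positivity) hρ.le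
      (hF _ inter_subset_left)
      fun x hx => h.pow_mul_norm_taylorComp_le_of_mem hK hK' hρ hτ hτ' hj hp hkp
        (fun i => g i (Φ x)) hx.2

/-- The Jacobian is bounded from below, so that composition with `Φ` preserves `L^p`. -/
theorem memLp_comp (h : IsShrinking K K' ℓ a η ρ τ Φ) (hp : 1 ≤ p) {Ω : Set (Euc m)}
    (hΩ : IsOpen Ω) (hΦΩ : MapsTo Φ Ω Ω) (hu : MemLp u (ENNReal.ofReal p) (volume.restrict Ω))
    (hu' : LocallyIntegrableOn u Ω volume) :
    MemLp (u ∘ Φ) (ENNReal.ofReal p) (volume.restrict Ω) := by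
  have hΦ := h.isDiffeo
  have hp0 : 0 < p := by linarith
  obtain ⟨c, hc, hcJ⟩ := h.exists_le_jac
  have h1 : MemLp (fun x => jac Φ x ^ (1 / p) • u (Φ x)) (ENNReal.ofReal p)
      (volume.restrict Ω) := by
    refine ⟨((hΦ.contDiff_jac.continuous.rpow_const fun x => Or.inl
      (hΦ.jac_pos x).ne').aestronglyMeasurable.smul
        (hΦ.locallyIntegrableOn_comp hΩ hΦΩ hu').aestronglyMeasurable), ?_⟩
    rw [hΦ.eLpNorm_comp hp0 hΩ.measurableSet]
    exact (eLpNorm_mono_measure _ (Measure.restrict_mono hΦΩ.image_subset le_rfl)).trans_lt hu.2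
  refine h1.of_le_mul (c := (c ^ (1 / p))⁻¹)
    (hΦ.locallyIntegrableOn_comp hΩ hΦΩ hu').aestronglyMeasurable
    (Filter.Eventually.of_forall fun x => ?_)
  have h2 : c ^ (1 / p) ≤ jac Φ x ^ (1 / p) := Real.rpow_le_rpow hc.le (hcJ x) (by positivity)
  have h3 : 0 < c ^ (1 / p) := Real.rpow_pos_of_pos hc _
  rw [norm_smul, Real.norm_of_nonneg (h3.le.trans h2), ← mul_assoc]
  refine le_mul_of_one_le_left (norm_nonneg _) ?_
  rw [inv_mul_eq_div, one_le_div h3]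
  exact h2

theorem memSobolev_comp (h : IsShrinking K K' ℓ a η ρ τ Φ) (hK : ∀ β j, 0 < K β j)
    (hK' : ∀ β j, 0 < K' β j) (hη : 0 < η) (hρ : 0 < ρ) (hτ : 0 < τ) (hτ' : τ ≤ 1)
    (hA : MapsTo Φ A A) (hA' : volume (A \ interior A) = 0) (hk : 1 ≤ k) (hp : 1 ≤ p)
    (hkp : k * p < ℓ + 1) (hu : MemSobolev (interior A) k (ENNReal.ofReal p) u) :
    MemSobolev (interior A) k (ENNReal.ofReal p) (u ∘ Φ) := by
  choose g hg hg' using hu.2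
  have hAi : volume.restrict A = volume.restrict (interior A) :=
    Measure.restrict_congr_set (Filter.EventuallyLE.antisymm (ae_le_set.2 hA')
      interior_subset.eventuallyLE)
  classical
  set g' : (i : ℕ) → Euc m → ContinuousMultilinearMap ℝ (fun _ : Fin i => Euc m) (Euc ν) :=
    fun i => if hi : i ∈ Finset.Icc 1 k then g i hi else 0 with hg'def
  have hw : ∀ i ∈ Finset.Icc 1 k, IsWeakDeriv (interior A) i u (g' i) ∧
      MemLp (g' i) (ENNReal.ofReal p) (volume.restrict (interior A)) := fun i hi => by
    simp only [hg'def, dif_pos hi]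
    exact ⟨hg i hi, hg' i hi⟩
  refine ⟨h.memLp_comp hp isOpen_interior (h.mapsTo_interior hA) hu.1
    (hg 1 (Finset.mem_Icc.2 ⟨le_rfl, hk⟩)).1, fun j hj => ?_⟩
  have hjk : Finset.Icc 1 j ⊆ Finset.Icc 1 k :=
    Finset.Icc_subset_Icc le_rfl (Finset.mem_Icc.1 hj).2
  have hcomp := IsWeakDeriv.comp h.isDiffeo isOpen_interior (h.mapsTo_interior hA)
    (Finset.mem_Icc.1 hj).1 fun i hi => (hw i (hjk hi)).1
  refine ⟨_, hcomp, hcomp.2.1.aestronglyMeasurable, ?_⟩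
  have hle := h.eLpNorm_taylorComp_le hK hK' hη hρ hτ hτ' hA hj hp hkp
    fun i hi => (hw i (hjk hi)).1
  have hfin : ∀ s ⊆ A, ∑ i ∈ Finset.Icc 1 j, ENNReal.ofReal (ρ ^ i) *
      eLpNorm (g' i) (ENNReal.ofReal p) (volume.restrict s) < ⊤ := fun s hs =>
    ENNReal.sum_lt_top.2 fun i hi => ENNReal.mul_lt_top ENNReal.ofReal_lt_top
      ((eLpNorm_mono_measure _ ((Measure.restrict_mono hs le_rfl).trans_eq hAi)).trans_lt
        (hw i (hjk hi)).2.2)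
  have hlt := hle.trans_lt (ENNReal.add_lt_top.2
    ⟨ENNReal.mul_lt_top ENNReal.ofReal_lt_top (hfin _ sdiff_subset),
      ENNReal.mul_lt_top ENNReal.ofReal_lt_top (hfin _ inter_subset_left)⟩)
  exact ENNReal.lt_top_of_mul_ne_top_right hlt.ne (by simpa using pow_pos hρ j)

/-- The Sobolev estimate for the weak derivatives of `u ∘ Φ`. -/
theorem eLpNorm_weakDeriv_le (h : IsShrinking K K' ℓ a η ρ τ Φ) (hK : ∀ β j, 0 < K β j)
    (hK' : ∀ β j, 0 < K' β j) (hη : 0 < η) (hρ : 0 < ρ) (hτ : 0 < τ) (hτ' : τ ≤ 1)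
    (hA : MapsTo Φ A A) (hA' : volume (A \ interior A) = 0) {j : ℕ} (hj : j ∈ Finset.Icc 1 k)
    (hp : 1 ≤ p) (hkp : k * p < ℓ + 1)
    {g : (i : ℕ) → Euc m → ContinuousMultilinearMap ℝ (fun _ : Fin i => Euc m) (Euc ν)}
    {f : Euc m → ContinuousMultilinearMap ℝ (fun _ : Fin j => Euc m) (Euc ν)}
    (hg : ∀ i ∈ Finset.Icc 1 j, IsWeakDeriv (interior A) i u (g i))
    (hf : IsWeakDeriv (interior A) j (u ∘ Φ) f) :
    ENNReal.ofReal (ρ ^ j) * eLpNorm f (ENNReal.ofReal p) (volume.restrict A) ≤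
      ENNReal.ofReal (sobolevConst K K' k p) *
          ∑ i ∈ Finset.Icc 1 j, ENNReal.ofReal (ρ ^ i) *
            eLpNorm (g i) (ENNReal.ofReal p) (volume.restrict (A \ latticeNhd a η ℓ ρ)) +
        ENNReal.ofReal (sobolevConst K K' k p * τ ^ (((ℓ : ℝ) + 1 - k * p) / p)) *
          ∑ i ∈ Finset.Icc 1 j, ENNReal.ofReal (ρ ^ i) *
            eLpNorm (g i) (ENNReal.ofReal p) (volume.restrict (A ∩ latticeNhd a η ℓ ρ)) := by
  have hAi : volume.restrict A = volume.restrict (interior A) :=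
    Measure.restrict_congr_set (Filter.EventuallyLE.antisymm (ae_le_set.2 hA')
      interior_subset.eventuallyLE)
  have hcomp := IsWeakDeriv.comp h.isDiffeo isOpen_interior (h.mapsTo_interior hA)
    (Finset.mem_Icc.1 hj).1 hg
  rw [hAi, eLpNorm_congr_ae ((ae_restrict_iff' isOpen_interior.measurableSet).2
    (hf.ae_eq isOpen_interior hcomp))]
  exact h.eLpNorm_taylorComp_le hK hK' hη hρ hτ hτ' hA hj hp hkp hg

end IsShrinking

end Cubication

theorem mainTheorem6 (m : ℕ) :
    -- the constants depend only on `m` and on the arguments displayed here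
    ∃ (C C' : ℝ → ℕ → ℝ) (C'' : ℕ → ℝ → ℝ),
      (∀ β j, 0 < C β j) ∧ (∀ β j, 0 < C' β j) ∧ (∀ k p, 0 < C'' k p) ∧
      ∀ (ℓ : ℕ) (η μ τ : ℝ) (S : Set (Set (Euc m))),
        ℓ < m → 0 < η → 0 < μ → μ < 1 / 2 → 0 < τ → τ < 1 / 2 →
        IsCubication η S univ →
        ∃ Φ : Euc m → Euc m,
          ContDiff ℝ ∞ Φ ∧
          Function.Injective Φ ∧
          (∀ σ ∈ S, Φ '' σ ⊆ σ) ∧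
          geomSupport Φ ⊆ dualNhd η ℓ S (2 * μ * η) ∧
          dualNhd η ℓ S (μ * η) ⊆ Φ '' dualNhd η ℓ S (τ * μ * η) ∧
          (∀ (β : ℝ) (j : ℕ), 0 < β → β < ℓ + 1 → 1 ≤ j → ∀ x : Euc m,
            (μ * η) ^ (j - 1) * ‖iteratedFDeriv ℝ j Φ x‖ ≤ C β j * jac Φ x ^ ((j : ℝ) / β)) ∧
          (∀ (β : ℝ) (j : ℕ), 0 < β → β < ℓ + 1 → 1 ≤ j → ∀ x ∈ Φ ⁻¹' dualNhd η ℓ S (μ * η),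
            (μ * η) ^ (j - 1) * ‖iteratedFDeriv ℝ j Φ x‖ ≤
              C' β j * τ ^ ((j : ℝ) * ((ℓ + 1) / β - 1)) * jac Φ x ^ ((j : ℝ) / β)) ∧
          -- the Sobolev estimates, on `A = K^m ∩ (T^{ℓ*} + Q^m_{2μη})`
          ∀ K : Set (Set (Euc m)), K ⊆ S →
          ∀ A : Set (Euc m), A = ⋃₀ K ∩ dualNhd η ℓ S (2 * μ * η) →
          ∀ (k : ℕ) (p : ℝ), 1 ≤ k → 1 ≤ p → (k : ℝ) * p < ℓ + 1 →
          ∀ (ν : ℕ) (u : Euc m → Euc ν),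
            MemSobolev (interior A) k (ENNReal.ofReal p) u →
            MemSobolev (interior A) k (ENNReal.ofReal p) (u ∘ Φ) ∧
            ∀ j ∈ Finset.Icc 1 k,
            -- `g i` is `D^i u` and `h` is `D^j (u ∘ Φ)`
            ∀ (g : (i : ℕ) → Euc m → ContinuousMultilinearMap ℝ (fun _ : Fin i => Euc m) (Euc ν))
              (h : Euc m → ContinuousMultilinearMap ℝ (fun _ : Fin j => Euc m) (Euc ν)),
              (∀ i ∈ Finset.Icc 1 j, IsWeakDeriv (interior A) i u (g i)) →
              IsWeakDeriv (interior A) j (u ∘ Φ) h →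
              ENNReal.ofReal ((μ * η) ^ j) *
                  eLpNorm h (ENNReal.ofReal p) (volume.restrict A) ≤
                ENNReal.ofReal (C'' k p) *
                    ∑ i ∈ Finset.Icc 1 j, ENNReal.ofReal ((μ * η) ^ i) *
                      eLpNorm (g i) (ENNReal.ofReal p)
                        (volume.restrict (A \ dualNhd η ℓ S (μ * η))) +
                  ENNReal.ofReal (C'' k p * τ ^ (((ℓ : ℝ) + 1 - k * p) / p)) *
                    ∑ i ∈ Finset.Icc 1 j, ENNReal.ofReal ((μ * η) ^ i) *
                      eLpNorm (g i) (ENNReal.ofReal p)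
                        (volume.restrict (A ∩ dualNhd η ℓ S (μ * η))) := by
  obtain ⟨K, K', hK, hK', hex⟩ := exists_isShrinking m
  refine ⟨K, K', sobolevConst K K', hK, hK', sobolevConst_pos hK hK', ?_⟩
  intro ℓ η μ τ S hℓ hη hμ hμ' hτ hτ' hS
  obtain ⟨a, ha⟩ := hS.exists_lattice hη
  have hρ : 0 < μ * η := mul_pos hμ hη
  have hN : ∀ r, 0 ≤ r → dualNhd η ℓ S r = latticeNhd a η ℓ r := fun r hr =>
    dualNhd_eq_latticeNhd hη hℓ ha hr
  have h2 : dualNhd η ℓ S (2 * μ * η) = latticeNhd a η ℓ (2 * (μ * η)) := by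
    rw [mul_assoc, hN _ (by positivity)]
  have h1 : dualNhd η ℓ S (μ * η) = latticeNhd a η ℓ (μ * η) := hN _ hρ.le
  have hcube : ∀ σ ∈ S, ∃ c, σ = cube c η := hS.1
  obtain ⟨Φ, hΦ⟩ := hex ℓ a η μ τ hℓ hη hμ hμ' hτ hτ'
  have hσ : ∀ σ ∈ S, MapsTo Φ σ σ := fun σ hσ => by
    obtain ⟨c, rfl⟩ := hcube σ hσ
    obtain ⟨z, hz⟩ := (ha c).1 hσ
    exact hΦ.mapsTo_cube hz
  rw [h1, h2, mul_assoc τ μ η, hN _ (by positivity)]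
  refine ⟨Φ, hΦ.contDiff, hΦ.bijective.1, fun σ h => (hσ σ h).image_subset, ?_, ?_, ?_, ?_, ?_⟩
  · refine closure_minimal (fun x hx => ?_) (isClosed_latticeNhd hη)
    by_contra hc
    exact hx (hΦ.eq_self x hc)
  · intro y hy
    obtain ⟨x, rfl⟩ := hΦ.bijective.2 y
    exact ⟨x, hΦ.mem_of_mem x hy, rfl⟩
  · exact fun β j => hΦ.le_jac β j
  · exact fun β j hβ hβ' hj x hx => hΦ.le_jac_of_mem β j hβ hβ' hj x hx
  · intro Km hKm A hA k p hk hp hkp ν u hu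
    have hAA : MapsTo Φ A A := by
      rw [hA]
      rintro x ⟨⟨σ, hσK, hx⟩, hx'⟩
      exact ⟨⟨σ, hσK, hσ σ (hKm hσK) hx⟩, hΦ.mapsTo_latticeNhd hx'⟩
    have hA0 : volume (A \ interior A) = 0 := by
      rw [hA]
      exact volume_diff_interior_eq_zero ha hcube hKm
    exact ⟨hΦ.memSobolev_comp hK hK' hη hρ hτ (by linarith) hAA hA0 hk hp hkp hu,
      fun j hj g f hg hf =>
        hΦ.eLpNorm_weakDeriv_le hK hK' hη hρ hτ (by linarith) hAA hA0 hj hp hkp hg hf⟩
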